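/- Let $(M,g)$ be a closed (compact, without boundary) Riemannian manifold of even dimension $m>2$ with a smooth isometric action $\alpha$ of the torus $\mathbb T^n=\mathbb R^n/\mathbb Z^n$, and let $\theta$ be a real skew-symmetric $n\times n$ matrix. (In the application $M$ is spin; the spin structure is not needed for the statement.) For a complex function, one-form or covariant two-tensor $s$ on $M$ let $U_t(s)=\alpha_{-t}^*s$ and $s_r=\int_{\mathbb T^n}U_t(s)e^{-2\pi i r\cdot t}\,dt$ for $r\in\mathbb Z^n$. The deformed products (of functions, of functions with tensors on either side, and of one-forms with values in two-tensors) are $s\,w=\sum_{r,l\in\mathbb Z^n}e^{i\pi\langle\theta r,l\rangle}\,s_r\cdot w_l$, where $\cdot$ is the pointwise (tensor) product; $C^\infty(M_\theta)$ is $C^\infty(M)=C^\infty(M,\mathbb C)$ with this product and with complex conjugation as involution. All products and exponentials of functions below are taken in this algebra, $\nabla$ is the Levi-Civita connection of $g$ (so $\nabla^2h$ is the Hessian), "$\,\cdot\,g^{-1}$" is contraction of a covariant two-tensor with the inverse metric, $\mathcal S_\Delta$ is the scalar curvature of $g$, and $\varphi_0(f)=2^{m/2}\int_M f\,d\mathrm{vol}_g$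 ($2^{m/2}$ being the rank of the spinor bundle). For $h=h^*\in C^\infty(M_\theta)$ let $\slashed\bigtriangledown(\psi)=2(\psi h-h\psi)$. For an entire function $K(s)=\sum_k a_ks^k$ and a two-tensor $\psi$ put $K(\slashed\bigtriangledown)(\psi)=\sum_k a_k\slashed\bigtriangledown^k(\psi)$; for an entire function $H(s,t)=\sum_{k,l}a_{kl}s^kt^l$ put $H(\slashed\bigtriangledown,\slashed\bigtriangledown)(\nabla h\nabla h)=\sum_{k,l}a_{kl}\,\slashed\bigtriangledown^k(\nabla h)\otimes_\theta\slashed\bigtriangledown^l(\nabla h)$, where $\otimes_\theta$ is the deformed tensor product. Let $j_0=(m-2)/2$, $c(m)=-\tfrac1{12}\Gamma(m/2)$, $f_1(s)=(e^s-1)/s$, $g_2(s,t)=(f_1(s+t)-f_1(s))/t$, and $$F(u,s,m)=\frac{m(\sqrt s+1)(u-1)+2(2\sqrt s+u+1)}{m(u-1)^3(u-s)},\qquad G(u,s,t,m)=\frac{N(u,s,t,m)}{m(u-1)^3(u-s)^2(u-st)},$$ $$\begin{aligned}N={}&s^{3/2}\big(m((2\sqrt s+1)\sqrt t+2)-4((2\sqrt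 s+1)\sqrt t+1)\big)\\&+u^2\big(2(s+2\sqrt s+3)(\sqrt s\sqrt t+1)-m(s^{3/2}\sqrt t-2s(\sqrt t-1)-2\sqrt s+2)\big)\\&-u\sqrt s\big[s(6\sqrt t+4)+\sqrt s(10-4\sqrt t)-2(\sqrt t+1)+m(2s^{3/2}\sqrt t+2\sqrt s(\sqrt t-1)+2s+\sqrt t+2)\big]\\&+u^3(m\sqrt s\sqrt t+2m+2\sqrt s+2),\end{aligned}$$ $$K_{\Delta}(s)=\partial_u^{(m-4)/2}F(u,s,m)\big|_{u=0},\qquad H_{\Delta}(s,t)=\partial_u^{(m-4)/2}G(u,s,t,m)\big|_{u=0}\qquad(s,t>0),$$ $$\mathcal K_{D_h}(s)=e^{s/4}K_\Delta(e^s)f_1(s/2),$$ $$\mathcal H_{D_h}(s,t)=e^{s/4}e^{t/4}\big(e^{s/2}H_\Delta(e^s,e^t)f_1(s/2)f_1(t/2)+2g_2(s/2,t/2)K_\Delta(e^{s+t})\big)$$ (here and below all difference quotients are extended continuously; all functions of $s$ and of $(s,t)$ are then entire). Let the Einstein–Hilbert action be given by the local formula $$F_{\mathrm{EH}}(h)=\varphi_0\Big(e^{(2-m)h}\big(\mathcal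 K_{D_h}(\slashed\bigtriangledown)(\nabla^2h)+\mathcal H_{D_h}(\slashed\bigtriangledown,\slashed\bigtriangledown)(\nabla h\nabla h)\big)g^{-1}+c(m)\,e^{(2-m)h}\mathcal S_\Delta\Big).$$ Put $$\begin{aligned}T(s)&=2j_0\mathcal K_{D_h}(0)f_1(-j_0s)+\mathcal H_{D_h}(s,-s),\qquad \tilde T(s)=T(-s)e^{-j_0s},\\ L(s,t)&=-2j_0T(s)f_1(-j_0(s+t)),\\ M(s,t)&=2e^{-j_0(s+t)}\Big[\frac{T(-t)-T(s)}{s+t}+\frac{T(t)-T(-s)}{s+t}e^{j_0t}\Big],\\ P(s,t)&=-2j_0f_1(-j_0s)T(t)-2\,\frac{T(s+t)-T(t)}{s}+2\,\frac{T(s+t)-T(s)}{t},\\ Q(s,t)&=-2j_0f_1(-j_0s)\tilde T(t)-2\,\frac{\tilde T(s+t)-\tilde T(t)}{s}+2\,\frac{\tilde T(s+t)-\tilde T(s)}{t}.\end{aligned}$$ Then for every $h=h^*\in C^\infty(M_\theta)$ the gradient of $F_{\mathrm{EH}}$ at $h$ with respect to $\varphi_0$, that is, the unique $\mathrm{grad}_hF_{\mathrm{EH}}\in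 C^\infty(M_\theta)$ such that $\frac{d}{d\varepsilon}\big|_{\varepsilon=0}F_{\mathrm{EH}}(h+\varepsilon a)=\varphi_0(a\,\mathrm{grad}_hF_{\mathrm{EH}})$ for all $a=a^*\in C^\infty(M_\theta)$, exists and equals $$\mathrm{grad}_hF_{\mathrm{EH}}=e^{-2j_0h}\big(\tilde K_{\mathrm{EH}}(\slashed\bigtriangledown)(\nabla^2h)+\tilde H_{\mathrm{EH}}(\slashed\bigtriangledown,\slashed\bigtriangledown)(\nabla h\nabla h)\big)g^{-1}-2j_0\,c(m)\,e^{-2j_0h}\mathcal S_\Delta,$$ with $\tilde K_{\mathrm{EH}}=-(T+\tilde T)$ and $\tilde H_{\mathrm{EH}}=L+M-P-Q$. -/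

import Mathlib

open scoped Manifold ContDiff Nat
open MeasureTheory

noncomputable section

namespace ConnesLandi

/-! ### The one- and two-variable functions -/

section Functions

/-- `f₁(s) = (eˢ - 1) / s`, extended continuously by `f₁(0) = 1`. -/
def f₁ (s : ℝ) : ℝ := dslope Real.exp 0 s

/-- `g₂(s,t) = (f₁(s+t) - f₁(s)) / t`, extended continuously to `t = 0`. -/
def g₂ (s t : ℝ) : ℝ := dslope f₁ s (s + t)

/-- The function whose jets at `u = 0` give the one-variable curvature function. -/
def Ftot (m u s : ℝ) : ℝ :=
  (m * (√s + 1) * (u - 1) + 2 * (2 * √s + u + 1)) / (m * (u - 1) ^ 3 * (u - s))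

/-- The function whose jets at `u = 0` give the two-variable curvature function. -/
def Gtot (m u s t : ℝ) : ℝ :=
  (√s ^ 3 * (m * ((2 * √s + 1) * √t + 2) - 4 * ((2 * √s + 1) * √t + 1))
    + u ^ 2 * (2 * (s + 2 * √s + 3) * (√s * √t + 1)
        - m * (√s ^ 3 * √t - 2 * s * (√t - 1) - 2 * √s + 2))
    - u * √s * (s * (6 * √t + 4) + √s * (10 - 4 * √t) - 2 * (√t + 1)
        + m * (2 * √s ^ 3 * √t + 2 * √s * (√t - 1) + 2 * s + √t + 2))
    + u ^ 3 * (m * √s * √t + 2 * m + 2 * √s + 2))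
  / (m * (u - 1) ^ 3 * (u - s) ^ 2 * (u - s * t))

/-- `K_{Δ_k}^{(m)}(s) = ∂_u^{(m-4)/2} F(u,s,m)` at `u = 0`. -/
def KDelta (m : ℕ) (s : ℝ) : ℝ := iteratedDeriv ((m - 4) / 2) (fun u => Ftot m u s) 0

/-- `H_{Δ_k}^{(m)}(s,t) = ∂_u^{(m-4)/2} G(u,s,t,m)` at `u = 0`. -/
def HDelta (m : ℕ) (s t : ℝ) : ℝ := iteratedDeriv ((m - 4) / 2) (fun u => Gtot m u s t) 0

/-- The one-variable curvature function `𝒦_{D_h}^{(m)}`. -/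
def KD (m : ℕ) (s : ℝ) : ℝ := Real.exp (s / 4) * KDelta m (Real.exp s) * f₁ (s / 2)

/-- The two-variable curvature function `ℋ_{D_h}^{(m)}`. -/
def HD (m : ℕ) (s t : ℝ) : ℝ :=
  Real.exp (s / 4) * Real.exp (t / 4) *
    (Real.exp (s / 2) * HDelta m (Real.exp s) (Real.exp t) * f₁ (s / 2) * f₁ (t / 2)
      + 2 * g₂ (s / 2) (t / 2) * KDelta m (Real.exp (s + t)))

/-- `c(m) = -Γ(m/2)/12`. -/
def cScal (m : ℕ) : ℝ := -(1 / 12) * Real.Gamma ((m : ℝ) / 2)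

/-- `j₀ = (m - 2) / 2`. -/
def j₀ (m : ℕ) : ℝ := ((m : ℝ) - 2) / 2

def T (m : ℕ) (s : ℝ) : ℝ := 2 * j₀ m * KD m 0 * f₁ (-(j₀ m) * s) + HD m s (-s)

def Ttilde (m : ℕ) (s : ℝ) : ℝ := T m (-s) * Real.exp (-(j₀ m) * s)

def Lfun (m : ℕ) (s t : ℝ) : ℝ := -2 * T m s * j₀ m * f₁ (-(j₀ m) * (s + t))

/-- `2 e^{-j₀(s+t)} [ (T(-t) - T(s))/(s+t) + (T(t) - T(-s))/(s+t) · e^{j₀t} ]`, the difference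
quotients being extended continuously to `s + t = 0`. -/
def Mfun (m : ℕ) (s t : ℝ) : ℝ :=
  2 * Real.exp (-(j₀ m) * (s + t)) *
    (-(dslope (T m) (-t) s) + dslope (T m) (-s) t * Real.exp (j₀ m * t))

/-- `-2j₀ f₁(-j₀s) W(t) - 2 (W(s+t) - W(t))/s + 2 (W(s+t) - W(s))/t`, the difference quotients being
extended continuously to `s = 0` and `t = 0`. -/
def PQ (m : ℕ) (W : ℝ → ℝ) (s t : ℝ) : ℝ :=
  -2 * j₀ m * f₁ (-(j₀ m) * s) * W t + (-2) * dslope W t (s + t) + 2 * dslope W s (s + t)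

def Pfun (m : ℕ) (s t : ℝ) : ℝ := PQ m (T m) s t

def Qfun (m : ℕ) (s t : ℝ) : ℝ := PQ m (Ttilde m) s t

def KEH (m : ℕ) (s : ℝ) : ℝ := -(T m s + Ttilde m s)

def HEH (m : ℕ) (s t : ℝ) : ℝ := Lfun m s t + Mfun m s t - Pfun m s t - Qfun m s t

end Functions

/-! ### Riemannian geometry on a manifold modelled on `ℝᵐ`

The tangent space `TangentSpace (𝓡 m) x` is by definition the model space `ℝᵐ`, identified through
the preferred chart at `x`. Complex one-forms and complex covariant two-tensors on `M` are therefore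
functions on `M` with values in `CForm m` and `CTensor m`. -/

abbrev Eu (m : ℕ) : Type := EuclideanSpace ℝ (Fin m)

abbrev CForm (m : ℕ) : Type := Eu m →L[ℝ] ℂ

abbrev CTensor (m : ℕ) : Type := Eu m →L[ℝ] Eu m →L[ℝ] ℂ

/-- The standard basis vectors of `ℝᵐ`. -/
def e {m : ℕ} (i : Fin m) : Eu m := EuclideanSpace.single i 1

/-- The tensor product `τ ⊗ η : (u, v) ↦ τ(u) η(v)`. -/
def tens {m : ℕ} (τ η : CForm m) : CTensor m := ContinuousLinearMap.smulRight τ η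

/-- The coordinate covectors `dxⁱ` of `ℝᵐ`, complex valued. -/
def dx {m : ℕ} (i : Fin m) : CForm m := Complex.ofRealCLM.comp (EuclideanSpace.proj i)

/-- A compact manifold `M` of dimension `m` with a smooth Riemannian metric and a smooth isometric
action of the torus `𝕋ⁿ = ℝⁿ / ℤⁿ`, written as an action of `ℝⁿ` on which `ℤⁿ` acts trivially. -/
structure ToricManifold (m n : ℕ) (M : Type*) [TopologicalSpace M] [ChartedSpace (Eu m) M]
    [IsManifold (𝓡 m) ∞ M] where
  g : Bundle.ContMDiffRiemannianMetric (𝓡 m) ∞ (Eu m) (fun x : M => TangentSpace (𝓡 m) x)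
  act : (Fin n → ℝ) → M → M
  act_zero : ∀ x, act 0 x = x
  act_add : ∀ s t x, act (s + t) x = act s (act t x)
  act_int : ∀ (k : Fin n → ℤ) x, act (fun i => (k i : ℝ)) x = x
  act_smooth : ContMDiff (𝓘(ℝ, Fin n → ℝ).prod (𝓡 m)) (𝓡 m) ∞
    (fun p : (Fin n → ℝ) × M => act p.1 p.2)
  act_isometry : ∀ t x (v w : TangentSpace (𝓡 m) x),
    g.inner (act t x) (mfderiv (𝓡 m) (𝓡 m) (act t) x v) (mfderiv (𝓡 m) (𝓡 m) (act t) x w)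
      = g.inner x v w

section Geometry

variable {m n : ℕ} {M : Type*} [TopologicalSpace M] [ChartedSpace (Eu m) M]
  [IsManifold (𝓡 m) ∞ M] (A : ToricManifold m n M)

namespace ToricManifold

/-- The matrix `g_{ij}(y)` of the metric in the chart centred at `p`. -/
def gMat (p : M) (y : Eu m) : Matrix (Fin m) (Fin m) ℝ :=
  Matrix.of fun i j => A.g.inner ((extChartAt (𝓡 m) p).symm y)
    (mfderiv 𝓘(ℝ, Eu m) (𝓡 m) (extChartAt (𝓡 m) p).symm y (e i))
    (mfderiv 𝓘(ℝ, Eu m) (𝓡 m) (extChartAt (𝓡 m) p).symm y (e j))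

/-- The partial derivative `∂_l g_{ij}(y)`. -/
def dgMat (p : M) (y : Eu m) (l i j : Fin m) : ℝ :=
  fderiv ℝ (fun z => A.gMat p z i j) y (e l)

/-- The Christoffel symbol `Γᵏ_{ij}(y)` of the Levi-Civita connection in the chart centred
at `p`. -/
def christoffel (p : M) (k i j : Fin m) (y : Eu m) : ℝ :=
  1 / 2 * ∑ l, (A.gMat p y)⁻¹ k l * (A.dgMat p y i j l + A.dgMat p y j i l - A.dgMat p y l i j)

/-- The Ricci curvature
`R_{jk} = ∂_i Γⁱ_{jk} - ∂_j Γⁱ_{ik} + Γⁱ_{iq} Γ^q_{jk} - Γⁱ_{jq} Γ^q_{ik}` in the chart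
centred at `p`. -/
def ricci (p : M) (y : Eu m) (j k : Fin m) : ℝ :=
  ∑ i, (fderiv ℝ (A.christoffel p i j k) y (e i) - fderiv ℝ (A.christoffel p i i k) y (e j))
  + ∑ i, ∑ q, (A.christoffel p i i q y * A.christoffel p q j k y
      - A.christoffel p i j q y * A.christoffel p q i k y)

/-- The scalar curvature `S = g^{jk} R_{jk}`. -/
def scalarCurvature (x : M) : ℝ :=
  ∑ j, ∑ k, (A.gMat x (extChartAt (𝓡 m) x x))⁻¹ j k * A.ricci x (extChartAt (𝓡 m) x x) j k

/-- Contraction of a covariant two-tensor at `x` with `g⁻¹`. -/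
def contract (B : M → CTensor m) (x : M) : ℂ :=
  ∑ i, ∑ j, (((Matrix.of fun i j : Fin m => A.g.inner x (e i) (e j))⁻¹ i j : ℝ) : ℂ)
    * B x (e i) (e j)

/-- The differential `∇f` of a function. -/
def grad₁ (f : M → ℂ) : M → CForm m := fun x => mfderiv (𝓡 m) 𝓘(ℝ, ℂ) f x

/-- The covariant Hessian `∇²f = (∂_i ∂_j f - Γᵏ_{ij} ∂_k f) dxⁱ ⊗ dxʲ`. -/
def hess (f : M → ℂ) : M → CTensor m := fun x =>
  fderiv ℝ (fderiv ℝ (f ∘ (extChartAt (𝓡 m) x).symm)) (extChartAt (𝓡 m) x x)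
  - ∑ i, ∑ j, ∑ k, ((A.christoffel x k i j (extChartAt (𝓡 m) x x) : ℂ)
      * fderiv ℝ (f ∘ (extChartAt (𝓡 m) x).symm) (extChartAt (𝓡 m) x x) (e k))
        • tens (dx i) (dx j)

/-- The integral of `f` against the Riemannian volume, by a smooth partition of unity `ρ`
subordinate to the charts: `∑_p ∫ ρ_p f √(det g_{ij}) dy`. -/
def integral [T2Space M] [CompactSpace M] (f : M → ℂ) : ℂ :=
  let ρ := (SmoothPartitionOfUnity.exists_isSubordinate_chartAt_source (𝓡 m) M).choose
  ∑ᶠ p : M, ∫ y in (extChartAt (𝓡 m) p).target,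
    ((ρ p ((extChartAt (𝓡 m) p).symm y) * √(A.gMat p y).det : ℝ) : ℂ)
      * f ((extChartAt (𝓡 m) p).symm y)

/-- `φ₀(f) = ∫_M Tr_x(f) dvol_g`, the function `f` acting as a scalar on the spinor bundle, which
has rank `2^{m/2}`. -/
def φ₀ [T2Space M] [CompactSpace M] (f : M → ℂ) : ℂ := 2 ^ (m / 2) * A.integral f

/-! The pull-back action of the torus on functions, one-forms and two-tensors. -/

def U₀ (t : Fin n → ℝ) (f : M → ℂ) : M → ℂ := fun x => f (A.act (-t) x)

def U₁ (t : Fin n → ℝ) (τ : M → CForm m) : M → CForm m := fun x =>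
  (τ (A.act (-t) x)).comp
    (mfderiv (𝓡 m) (𝓡 m) (A.act (-t)) x : Eu m →L[ℝ] Eu m)

def U₂ (t : Fin n → ℝ) (B : M → CTensor m) : M → CTensor m := fun x =>
  (B (A.act (-t) x)).bilinearComp
    (mfderiv (𝓡 m) (𝓡 m) (A.act (-t)) x : Eu m →L[ℝ] Eu m)
    (mfderiv (𝓡 m) (𝓡 m) (A.act (-t)) x : Eu m →L[ℝ] Eu m)

end ToricManifold

/-! ### The θ-deformation -/

/-- The isotypic component `s_r = ∫_{𝕋ⁿ} U_t(s) e^{-2πi r·t} dt`. -/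
def isotypic {V : Type*} [NormedAddCommGroup V] [NormedSpace ℂ V]
    (U : (Fin n → ℝ) → (M → V) → M → V) (r : Fin n → ℤ) (s : M → V) : M → V := fun x =>
  ∫ t in Set.Icc (0 : Fin n → ℝ) 1,
    Complex.exp (-2 * Real.pi * Complex.I * ∑ i, (r i : ℂ) * (t i : ℂ)) • U t s x

/-- The bicharacter `χ_θ(r,l) = exp(iπ⟨θr,l⟩)`. -/
def χ (θ : Matrix (Fin n) (Fin n) ℝ) (r l : Fin n → ℤ) : ℂ :=
  Complex.exp (Complex.I * Real.pi * ((θ.mulVec (fun i => (r i : ℝ)) ⬝ᵥ fun i => (l i : ℝ) : ℝ) : ℂ))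

/-- The deformation `∑_{r,l} χ_θ(r,l) β(s_r, w_l)` of a fibrewise bilinear product `β`. -/
def dprod (θ : Matrix (Fin n) (Fin n) ℝ) {V W Z : Type*} [NormedAddCommGroup V] [NormedSpace ℂ V]
    [NormedAddCommGroup W] [NormedSpace ℂ W] [NormedAddCommGroup Z] [NormedSpace ℂ Z]
    (U : (Fin n → ℝ) → (M → V) → M → V) (U' : (Fin n → ℝ) → (M → W) → M → W)
    (β : V → W → Z) (s : M → V) (w : M → W) : M → Z := fun x =>
  ∑' p : (Fin n → ℤ) × (Fin n → ℤ),
    χ θ p.1 p.2 • β (isotypic U p.1 s x) (isotypic U' p.2 w x)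

variable (θ : Matrix (Fin n) (Fin n) ℝ)

/-- The deformed product of functions. -/
def mulθ (f f' : M → ℂ) : M → ℂ := dprod θ A.U₀ A.U₀ (fun a b => a * b) f f'

/-- The deformed tensor product of one-forms. -/
def tensθ (τ η : M → CForm m) : M → CTensor m := dprod θ A.U₁ A.U₁ tens τ η

/-- The modular derivation `ψ ↦ -2 ad_h(ψ) = 2(ψh - hψ)` on sections with torus action `U`. -/
def modDer {V : Type*} [NormedAddCommGroup V] [NormedSpace ℂ V]
    (U : (Fin n → ℝ) → (M → V) → M → V) (h : M → ℂ) (ψ : M → V) : M → V := fun x =>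
  (2 : ℂ) • (dprod θ U A.U₀ (fun v c => c • v) ψ h x - dprod θ A.U₀ U (fun c v => c • v) h ψ x)

/-- Powers in the deformed algebra. -/
def powθ (f : M → ℂ) : ℕ → M → ℂ
  | 0 => fun _ => 1
  | k + 1 => mulθ A θ f (powθ f k)

/-- The exponential in the deformed algebra. -/
def expθ (f : M → ℂ) : M → ℂ := fun x => ∑' k : ℕ, ((k ! : ℂ))⁻¹ * powθ A θ f k x

/-- `K(∇̸)(ψ)` for an entire function `K` and a two-tensor `ψ`, by the power series of `K`. -/
def calc₁ (K : ℝ → ℝ) (h : M → ℂ) (ψ : M → CTensor m) : M → CTensor m := fun x =>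
  ∑' k : ℕ, ((iteratedDeriv k K 0 / (k ! : ℝ) : ℝ) : ℂ) • (modDer A θ A.U₂ h)^[k] ψ x

/-- `H(∇̸₍₁₎, ∇̸₍₂₎)(τ η)` for an entire function `H` of two variables and one-forms `τ`, `η`, by the
power series of `H`; the two copies of `∇̸` act on the first and on the second factor. -/
def calc₂ (H : ℝ → ℝ → ℝ) (h : M → ℂ) (τ η : M → CForm m) : M → CTensor m := fun x =>
  ∑' p : ℕ × ℕ,
    ((iteratedDeriv p.1 (fun s => iteratedDeriv p.2 (fun t => H s t) 0) 0
        / ((p.1 ! : ℝ) * (p.2 ! : ℝ)) : ℝ) : ℂ)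
      • tensθ A θ ((modDer A θ A.U₁ h)^[p.1] τ) ((modDer A θ A.U₁ h)^[p.2] η) x

/-- `e^{(2-m)h} ( K(∇̸)(∇²h) + H(∇̸₍₁₎,∇̸₍₂₎)(∇h ∇h) ) g⁻¹ + c e^{(2-m)h} S`, where `S` is the scalar
curvature of the metric `g`. -/
def localExpr (K : ℝ → ℝ) (H : ℝ → ℝ → ℝ) (c : ℝ) (h : M → ℂ) : M → ℂ := fun x =>
  mulθ A θ (expθ A θ (fun z => (2 - (m : ℂ)) * h z))
      (A.contract fun z => calc₁ A θ K h (A.hess h) z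
        + calc₂ A θ H h (ToricManifold.grad₁ h) (ToricManifold.grad₁ h) z) x
    + (c : ℂ) * mulθ A θ (expθ A θ (fun z => (2 - (m : ℂ)) * h z))
        (fun z => (A.scalarCurvature z : ℂ)) x

/-- The modular scalar curvature `R_{D_h}`. -/
def modularCurvature (h : M → ℂ) : M → ℂ := localExpr A θ (KD m) (HD m) (cScal m) h

/-- The Einstein–Hilbert action `F_EH(h) = φ₀(R_{D_h})`. -/
def einsteinHilbert [T2Space M] [CompactSpace M] (h : M → ℂ) : ℂ :=
  A.φ₀ (modularCurvature A θ h)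

/-- `G ∈ C^∞(M_θ)` is a gradient at `h` of the functional `F` with respect to `φ₀`:
`d/dε|_{ε=0} F(h + εa) = φ₀(a G)` for all self-adjoint `a ∈ C^∞(M_θ)`. -/
def IsGradientAt [T2Space M] [CompactSpace M] (F : (M → ℂ) → ℂ) (h G : M → ℂ) : Prop :=
  ContMDiff (𝓡 m) 𝓘(ℝ, ℂ) ∞ G ∧
    ∀ a : M → ℂ, ContMDiff (𝓡 m) 𝓘(ℝ, ℂ) ∞ a → (∀ x, star (a x) = a x) →
      HasDerivAt (fun ε : ℝ => F (fun x => h x + (ε : ℂ) * a x)) (A.φ₀ (mulθ A θ a G)) 0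

end Geometry

end ConnesLandi

end

/-!
The gradient of the Einstein–Hilbert action of a noncommutative toric manifold.

**Passage to a Banach algebra.** The deformed products are defined by Fourier expansion along the
torus action. They are turned into honest products in the twisted group algebra `TwAlg θ = ℓ¹(ℤⁿ, θ)`:
a smooth function `f` on `M` lifts to a smooth map `X : M → TwAlg θ` whose coefficients at `x` are the
Fourier coefficients of `t ↦ f(α_{-t} x)` (`ToricManifold.exists_lift`), and `f` is recovered by
summing the coefficients. Deformed products of functions and of tensors correspond to pointwise
products in `TwAlg θ`, so every ingredient of the local expression has a counterpart with values in a
Banach algebra, where all series converge in norm (`TensorKind.Rep.localExpr`). Since the torus acts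
by isometries, `φ₀` becomes the integral over `M` of the coefficient at the unit
(`φ₀_eq_integral_coef`), which is a trace on `TwAlg θ` because `θ` is skew-symmetric.

**The calculus.** Let `B` be a Banach algebra with a continuous trace `τ` and let
`∇̸(y) = 2(yh - hy)`. All the functions that occur are integrals of exponentials `e^{αs + βt}` against
compactly supported weights (`IsExp`). This class contains the curvature functions, being closed under
sums, products, linear substitutions and difference quotients. As `e^{α∇̸}(y) = e^{-2αh} y e^{2αh}`,
identities for the functional calculus reduce to identities between products of exponentials. The
derivative of `h ↦ e^{-2jh} W(∇̸)(y)` is computed from Duhamel's formula and produces the difference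
quotients of `W` (`hasDerivAt_modOp_line`), while cyclicity of `τ` turns a slot of a two-variable
calculus into the outermost factor (`IsExp.trace_rotate_left`, `IsExp.trace_rotate_right`).

**The variation.** Under the trace, the second order term `K(∇̸)(∇²X)` equals `K(0)` times a divergence
plus a term quadratic in `∇X`, so with `V(y) = e^{-2jX} T(∇̸)(y)` the action becomes
`∫ τ(∇X · V(∇X)) + c ∫ S τ(e^{-2jX})` (`ToricManifold.trace_localB`). Here the divergence theorem
`ToricManifold.integral_divM` is used, which is proved in charts from the expression of the metric and
of its Christoffel symbols. Differentiating in the direction `Y`, the variation of the two factors `∇X`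
gives, after another partial integration, `-Y` times the divergences of `V(∇X)` and of its transpose;
these contain the term `-(T + T̃)(∇̸)(∇²X)` and, from the derivative of `V`, the terms `-P - Q`. The
variation of `V` itself gives `L + M` after rotation of the trace (`Lfun_add_Mfun`). This is
`ToricManifold.hasDerivAt_integral_trace_localB`.

**Uniqueness.** Inside `φ₀` a deformed product of two functions may be replaced by the pointwise one,
so a function orthogonal to all real smooth functions vanishes (`IsGradientAt.unique`).
-/

section

set_option linter.unusedSectionVars false
set_option maxSynthPendingDepth 3

open scoped Topology

noncomputable section

namespace ConnesLandi

/-! ### Smoothness of parametric integrals -/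

section ParametricIntegral

universe u

variable {Ω P E F : Type*} [MeasurableSpace Ω] {μ : Measure Ω} [IsFiniteMeasure μ]
  [NormedAddCommGroup P] [NormedSpace ℝ P] [NormedAddCommGroup E] [NormedSpace ℝ E]
  [NormedAddCommGroup F] [NormedSpace ℝ F]

theorem exists_nhds_bound_of_compact {G : Type*} [NormedAddCommGroup G] {g : P × E → G} {U : Set E}
    (hU : IsOpen U) (hg : ContinuousOn g (Set.univ ×ˢ U)) {K : Set P} (hK : IsCompact K) {x : E}
    (hx : x ∈ U) : ∃ C, ∃ s ∈ 𝓝 x, s ⊆ U ∧ ∀ p ∈ K, ∀ y ∈ s, ‖g (p, y)‖ ≤ C := by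
  have hopen : IsOpen (Set.univ ×ˢ U : Set (P × E)) := isOpen_univ.prod hU
  obtain ⟨C, hC⟩ := (hK.prod (isCompact_singleton (x := x))).exists_bound_of_continuousOn
    (hg.mono (Set.prod_mono (Set.subset_univ _) (Set.singleton_subset_iff.2 hx)))
  have hN : IsOpen ((Set.univ ×ˢ U) ∩ g ⁻¹' {z | ‖z‖ < C + 1}) :=
    hg.isOpen_inter_preimage hopen (isOpen_lt continuous_norm continuous_const)
  obtain ⟨u, v, -, hv, hKu, hxv, huv⟩ := generalized_tube_lemma hK (isCompact_singleton (x := x)) hN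
    (fun z hz => ⟨⟨trivial, by rw [Set.mem_singleton_iff.1 hz.2]; exact hx⟩,
      lt_of_le_of_lt (hC z hz) (by linarith)⟩)
  refine ⟨C + 1, v ∩ U, (hv.inter hU).mem_nhds ⟨hxv rfl, hx⟩, Set.inter_subset_right, ?_⟩
  exact fun p hp y hy => le_of_lt (huv ⟨hKu hp, hy.1⟩).2

theorem integrable_comp_of_compact {g : P → F} (hg : Continuous g) {q : Ω → P}
    (hq : AEStronglyMeasurable q μ) {K : Set P} (hK : IsCompact K) (hqK : ∀ᵐ o ∂μ, q o ∈ K) :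
    Integrable (fun o => g (q o)) μ := by
  obtain ⟨C, hC⟩ := hK.exists_bound_of_continuousOn hg.continuousOn
  exact Integrable.of_bound (hg.comp_aestronglyMeasurable hq) C (hqK.mono fun o h => hC _ h)

/-- Differentiation under the integral sign for an integrand that depends smoothly on a parameter
ranging over a compact set. -/
theorem hasFDerivAt_parametric_integral {g : P × E → F} {U : Set E} (hU : IsOpen U)
    (hg : ContDiffOn ℝ 1 g (Set.univ ×ˢ U)) {q : Ω → P} (hq : AEStronglyMeasurable q μ)
    {K : Set P} (hK : IsCompact K) (hqK : ∀ᵐ o ∂μ, q o ∈ K) {x : E} (hx : x ∈ U) :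
    HasFDerivAt (fun y => ∫ o, g (q o, y) ∂μ)
      (∫ o, (fderiv ℝ g (q o, x)).comp (ContinuousLinearMap.inr ℝ P E) ∂μ) x := by
  have hopen : IsOpen (Set.univ ×ˢ U : Set (P × E)) := isOpen_univ.prod hU
  have hd : ContinuousOn (fun z => (fderiv ℝ g z).comp (ContinuousLinearMap.inr ℝ P E))
      (Set.univ ×ˢ U) :=
    (hg.continuousOn_fderiv_of_isOpen hopen le_rfl).clm_comp continuousOn_const
  obtain ⟨C, s, hs, hsU, hC⟩ := exists_nhds_bound_of_compact hU hd hK hx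
  have hcont : ∀ y ∈ U, Continuous fun p => g (p, y) := fun y hy =>
    hg.continuousOn.comp_continuous (by fun_prop) (fun p => ⟨trivial, hy⟩)
  have hcont' : Continuous fun p => (fderiv ℝ g (p, x)).comp (ContinuousLinearMap.inr ℝ P E) :=
    hd.comp_continuous (by fun_prop) (fun p => ⟨trivial, hx⟩)
  refine hasFDerivAt_integral_of_dominated_of_fderiv_le (s := s) (bound := fun _ => C)
    (F' := fun y o => (fderiv ℝ g (q o, y)).comp (ContinuousLinearMap.inr ℝ P E)) hs ?_ ?_ ?_ ?_
    (integrable_const C) ?_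
  · filter_upwards [hU.mem_nhds hx] with y hy
    exact (hcont y hy).comp_aestronglyMeasurable hq
  · exact integrable_comp_of_compact (hcont x hx) hq hK hqK
  · exact hcont'.comp_aestronglyMeasurable hq
  · filter_upwards [hqK] with o ho y hy using hC _ ho y hy
  · refine .of_forall fun o y hy => ?_
    have h1 : HasFDerivAt g (fderiv ℝ g (q o, y)) (q o, y) :=
      ((hg.differentiableOn one_ne_zero).differentiableAt
        (hopen.mem_nhds ⟨trivial, hsU hy⟩)).hasFDerivAt
    exact h1.comp y (hasFDerivAt_prodMk_right (q o) y)

theorem hasDerivAt_parametric_integral {g : P × ℝ → F} (hg : ContDiff ℝ 1 g) {q : Ω → P}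
    (hq : AEStronglyMeasurable q μ) {K : Set P} (hK : IsCompact K) (hqK : ∀ᵐ o ∂μ, q o ∈ K)
    {g' : P → F} {s : ℝ} (hg' : ∀ p, HasDerivAt (fun s => g (p, s)) (g' p) s) :
    HasDerivAt (fun s => ∫ o, g (q o, s) ∂μ) (∫ o, g' (q o) ∂μ) s := by
  have h1 := hasFDerivAt_parametric_integral (μ := μ) isOpen_univ hg.contDiffOn hq hK hqK
    (Set.mem_univ s)
  have hc : Continuous fun p => (fderiv ℝ g (p, s)).comp (ContinuousLinearMap.inr ℝ P ℝ) :=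
    ((hg.continuous_fderiv one_ne_zero).comp (by fun_prop)).clm_comp continuous_const
  refine h1.hasDerivAt.congr_deriv ?_
  rw [ContinuousLinearMap.integral_apply (integrable_comp_of_compact hc hq hK hqK)]
  refine integral_congr_ae (.of_forall fun o => ?_)
  exact (((hg.differentiable one_ne_zero _).hasFDerivAt.comp s
    (hasFDerivAt_prodMk_right (q o) s)).hasDerivAt).unique (hg' (q o))

theorem continuousOn_parametric_integral {g : P × E → F} {U : Set E} (hU : IsOpen U)
    (hg : ContinuousOn g (Set.univ ×ˢ U)) {q : Ω → P} (hq : AEStronglyMeasurable q μ)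
    {K : Set P} (hK : IsCompact K) (hqK : ∀ᵐ o ∂μ, q o ∈ K) :
    ContinuousOn (fun y => ∫ o, g (q o, y) ∂μ) U := by
  intro x hx
  obtain ⟨C, s, hs, hsU, hC⟩ := exists_nhds_bound_of_compact hU hg hK hx
  refine ContinuousAt.continuousWithinAt ?_
  refine continuousAt_of_dominated (bound := fun _ => C) ?_ ?_ (integrable_const C) ?_
  · filter_upwards [hU.mem_nhds hx] with y hy
    exact (hg.comp_continuous (f := fun p => (p, y)) (by fun_prop)
      (fun p => ⟨trivial, hy⟩)).comp_aestronglyMeasurable hq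
  · filter_upwards [hs] with y hy
    filter_upwards [hqK] with o ho using hC _ ho y hy
  · refine .of_forall fun o => ?_
    exact (hg.continuousAt ((isOpen_univ.prod hU).mem_nhds ⟨trivial, hx⟩)).comp
      (f := fun y => (q o, y)) (by fun_prop)

/-- Induction on the order of differentiability. All spaces live in one universe, because the
induction replaces the target `F` by `E →L[ℝ] F`. -/
theorem contDiffOn_parametric_integral_nat {E : Type u} [NormedAddCommGroup E] [NormedSpace ℝ E]
    (n : ℕ) : ∀ {F : Type u} [NormedAddCommGroup F]
    [NormedSpace ℝ F] {g : P × E → F} {U : Set E} (_ : IsOpen U)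
    (_ : ContDiffOn ℝ n g (Set.univ ×ˢ U)) {q : Ω → P} (_ : AEStronglyMeasurable q μ)
    {K : Set P} (_ : IsCompact K) (_ : ∀ᵐ o ∂μ, q o ∈ K),
    ContDiffOn ℝ n (fun y => ∫ o, g (q o, y) ∂μ) U := by
  induction n with
  | zero =>
    intro F _ _ g U hU hg q hq K hK hqK
    rw [Nat.cast_zero, contDiffOn_zero] at hg ⊢
    exact continuousOn_parametric_integral hU hg hq hK hqK
  | succ n ih =>
    intro F _ _ g U hU hg q hq K hK hqK
    have hopen : IsOpen (Set.univ ×ˢ U : Set (P × E)) := isOpen_univ.prod hU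
    have hd : ∀ x ∈ U, HasFDerivAt (fun y => ∫ o, g (q o, y) ∂μ)
      (∫ o, (fderiv ℝ g (q o, x)).comp (ContinuousLinearMap.inr ℝ P E) ∂μ) x := fun x hx =>
        hasFDerivAt_parametric_integral hU (hg.of_le (by exact_mod_cast Nat.le_add_left 1 n))
          hq hK hqK hx
    rw [Nat.cast_add, Nat.cast_one, contDiffOn_succ_iff_fderiv_of_isOpen hU]
    refine ⟨fun x hx => (hd x hx).differentiableAt.differentiableWithinAt, by simp, ?_⟩
    have h1 : ContDiffOn ℝ n (fun z => (fderiv ℝ g z).comp (ContinuousLinearMap.inr ℝ P E))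
        (Set.univ ×ˢ U) :=
      (hg.fderiv_of_isOpen hopen (by norm_cast)).clm_comp contDiffOn_const
    exact (ih hU h1 hq hK hqK).congr fun x hx => (hd x hx).fderiv

theorem contDiffOn_parametric_integral {E F : Type u} [NormedAddCommGroup E]
    [NormedSpace ℝ E] [NormedAddCommGroup F] [NormedSpace ℝ F] {g : P × E → F} {U : Set E} (hU : IsOpen U)
    (hg : ContDiffOn ℝ ∞ g (Set.univ ×ˢ U)) {q : Ω → P} (hq : AEStronglyMeasurable q μ)
    {K : Set P} (hK : IsCompact K) (hqK : ∀ᵐ o ∂μ, q o ∈ K) :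
    ContDiffOn ℝ ∞ (fun y => ∫ o, g (q o, y) ∂μ) U :=
  contDiffOn_infty.2 fun n => contDiffOn_parametric_integral_nat n hU
    (hg.of_le (by exact_mod_cast le_top)) hq hK hqK

theorem contDiff_parametric_integral {E F : Type u} [NormedAddCommGroup E]
    [NormedSpace ℝ E] [NormedAddCommGroup F] [NormedSpace ℝ F] {g : P × E → F} (hg : ContDiff ℝ ∞ g) {q : Ω → P}
    (hq : AEStronglyMeasurable q μ) {K : Set P} (hK : IsCompact K) (hqK : ∀ᵐ o ∂μ, q o ∈ K) :
    ContDiff ℝ ∞ (fun y => ∫ o, g (q o, y) ∂μ) :=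
  contDiffOn_univ.1 (contDiffOn_parametric_integral isOpen_univ hg.contDiffOn hq hK hqK)

end ParametricIntegral

/-! ### Exponentials in a Banach algebra -/

section BanachExp

variable {B : Type*} [NormedRing B] [NormedAlgebra ℝ B] [CompleteSpace B]

/-- The one-parameter group `t ↦ exp (t h)` of a Banach algebra. -/
def bexp (t : ℝ) (h : B) : B := NormedSpace.exp (t • h)

theorem bexp_zero (h : B) : bexp 0 h = 1 := by simp [bexp]

theorem bexp_add (s t : ℝ) (h : B) : bexp (s + t) h = bexp s h * bexp t h := by
  let _ := NormedAlgebra.restrictScalars ℚ ℝ B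
  rw [bexp, add_smul, NormedSpace.exp_add_of_commute]
  · rfl
  · exact ((Commute.refl h).smul_left s).smul_right t

theorem bexp_mul_bexp_of_eq {s t u : ℝ} (h : B) (hst : s + t = u) :
    bexp s h * bexp t h = bexp u h := by rw [← bexp_add, hst]

theorem contDiff_bexp : ContDiff ℝ ∞ fun p : ℝ × B => bexp p.1 p.2 := by
  have h1 : ContDiff ℝ ∞ (NormedSpace.exp : B → B) := by
    rw [← contDiffOn_univ]
    exact AnalyticOnNhd.contDiffOn (fun x _ => NormedSpace.exp_analytic (𝕂 := ℝ) x)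
      uniqueDiffOn_univ
  exact h1.comp (contDiff_fst.smul contDiff_snd)

theorem bexp_mul_bexp_mul (s t : ℝ) (h x : B) :
    bexp s h * (bexp t h * x) = bexp (s + t) h * x := by rw [bexp_add, mul_assoc]

@[fun_prop]
theorem _root_.ContDiff.bexp {X : Type*} [NormedAddCommGroup X] [NormedSpace ℝ X] {f : X → ℝ}
    {g : X → B} {n : WithTop ℕ∞} (hn : n ≤ ∞) (hf : ContDiff ℝ n f) (hg : ContDiff ℝ n g) :
    ContDiff ℝ n fun x => bexp (f x) (g x) :=
  (contDiff_bexp.of_le hn).comp (hf.prodMk hg)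

@[fun_prop]
theorem _root_.Continuous.bexp {X : Type*} [TopologicalSpace X] {f : X → ℝ} {g : X → B}
    (hf : Continuous f) (hg : Continuous g) : Continuous fun x => bexp (f x) (g x) :=
  contDiff_bexp.continuous.comp (hf.prodMk hg)

theorem commute_bexp (t : ℝ) (h : B) : Commute h (bexp t h) := by
  let _ := NormedAlgebra.restrictScalars ℚ ℝ B
  exact ((Commute.refl h).smul_right t).exp_right

theorem hasDerivAt_bexp (h : B) (t : ℝ) : HasDerivAt (fun t => bexp t h) (bexp t h * h) t :=
  hasDerivAt_exp_smul_const h t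

/-- Duhamel's formula for the difference of two exponentials. -/
theorem bexp_sub_bexp (c : ℝ) (h k : B) :
    bexp c h - bexp c k =
      ∫ u in (0 : ℝ)..1, c • (bexp (u * c) h * (h - k) * bexp ((1 - u) * c) k) := by
  have hd : ∀ u ∈ Set.uIcc (0 : ℝ) 1, HasDerivAt (fun u => bexp (u * c) h * bexp ((1 - u) * c) k)
      (c • (bexp (u * c) h * (h - k) * bexp ((1 - u) * c) k)) u := by
    intro u _
    have h1 : HasDerivAt (fun u : ℝ => bexp (u * c) h) (c • (bexp (u * c) h * h)) u :=
      (hasDerivAt_bexp h (u * c)).scomp u (h := fun u : ℝ => u * c) (by simpa using (hasDerivAt_id u).mul_const c)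
    have h2 : HasDerivAt (fun u : ℝ => bexp ((1 - u) * c) k)
        ((-c) • (bexp ((1 - u) * c) k * k)) u :=
      (hasDerivAt_bexp k ((1 - u) * c)).scomp u (h := fun u : ℝ => (1 - u) * c)
        (by simpa using ((hasDerivAt_id u).const_sub 1).mul_const c)
    refine (h1.mul h2).congr_deriv ?_
    rw [← (commute_bexp _ k).eq]
    simp only [smul_mul_assoc, mul_smul_comm, neg_smul, mul_neg, mul_sub, sub_mul, smul_sub, mul_assoc]
    abel
  have hc : Continuous fun u : ℝ => c • (bexp (u * c) h * (h - k) * bexp ((1 - u) * c) k) := by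
    have := contDiff_bexp (B := B).continuous
    have h1 : Continuous fun u : ℝ => bexp (u * c) h := this.comp (by fun_prop : Continuous fun u : ℝ => (u * c, h))
    have h2 : Continuous fun u : ℝ => bexp ((1 - u) * c) k := this.comp (by fun_prop : Continuous fun u : ℝ => ((1 - u) * c, k))
    fun_prop
  rw [intervalIntegral.integral_eq_sub_of_hasDerivAt hd (hc.intervalIntegrable _ _)]
  simp [bexp_zero]

end BanachExp

/-! ### Integrals of exponentials -/

section ExpRep

/-- `H(s,t) = ∫ w e^{αs + βt} dμ` for a finite measure `μ` and bounded measurable `(w,α,β) = q`. -/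
structure ExpRep {Ω : Type*} [MeasurableSpace Ω] (μ : Measure Ω) (q : Ω → ℝ × ℝ × ℝ)
    (H : ℝ → ℝ → ℝ) : Prop where
  finite : IsFiniteMeasure μ
  meas : Measurable q
  bdd : ∃ C, ∀ᵐ o ∂μ, q o ∈ Metric.closedBall (0 : ℝ × ℝ × ℝ) C
  eq : ∀ s t, H s t = ∫ o, (q o).1 * Real.exp ((q o).2.1 * s + (q o).2.2 * t) ∂μ

/-- The functions of two variables that are integrals of exponentials `e^{αs + βt}` against a
compactly supported weight. They are entire, and form an algebra which is closed under linear
substitutions and under difference quotients. -/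
def IsExp (H : ℝ → ℝ → ℝ) : Prop :=
  ∃ μ : Measure (ℝ × ℝ × ℝ), ExpRep μ id H

variable {Ω : Type*} [MeasurableSpace Ω] {μ : Measure Ω} {q : Ω → ℝ × ℝ × ℝ} {H : ℝ → ℝ → ℝ}

theorem ExpRep.isExp (hH : ExpRep μ q H) : IsExp H := by
  obtain ⟨hf, hm, ⟨C, hC⟩, he⟩ := hH
  refine ⟨μ.map q, Measure.isFiniteMeasure_map μ q, measurable_id, ⟨C, ?_⟩, fun s t => ?_⟩
  · exact (ae_map_iff hm.aemeasurable Metric.isClosed_closedBall.measurableSet).2 hC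
  · rw [he, integral_map hm.aemeasurable]
    · rfl
    · exact Continuous.aestronglyMeasurable (by fun_prop)

theorem ExpRep.integrable {F : Type*} [NormedAddCommGroup F] [NormedSpace ℝ F] (hH : ExpRep μ q H)
    {g : ℝ × ℝ × ℝ → F} (hg : Continuous g) : Integrable (fun o => g (q o)) μ := by
  obtain ⟨hf, hm, ⟨C, hC⟩, he⟩ := hH
  exact integrable_comp_of_compact hg hm.aestronglyMeasurable (isCompact_closedBall _ _) hC

/-- Replacing the weight and the exponents by continuous functions of the old ones. -/
theorem ExpRep.comp (hH : ExpRep μ q H) {κ : ℝ × ℝ × ℝ → ℝ × ℝ × ℝ} (hκ : Continuous κ)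
    {H' : ℝ → ℝ → ℝ} (he : ∀ s t, H' s t =
      ∫ o, (κ (q o)).1 * Real.exp ((κ (q o)).2.1 * s + (κ (q o)).2.2 * t) ∂μ) :
    ExpRep μ (κ ∘ q) H' := by
  obtain ⟨hf, hm, ⟨C, hC⟩, -⟩ := hH
  obtain ⟨C', hC'⟩ := (isCompact_closedBall (0 : ℝ × ℝ × ℝ) C).exists_bound_of_continuousOn
    hκ.continuousOn
  exact ⟨hf, hκ.measurable.comp hm, ⟨C', hC.mono fun o h => by simpa using hC' _ h⟩, he⟩

theorem ExpRep.comp_prod_bdd (hH : ExpRep μ q H) {κ : (ℝ × ℝ × ℝ) × ℝ → ℝ × ℝ × ℝ}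
    (hκ : Continuous κ) : Measurable (fun p : Ω × ℝ => κ (q p.1, p.2)) ∧
      ∃ C, ∀ᵐ p ∂(μ.prod (volume.restrict (Set.Ioc (0 : ℝ) 1))),
        κ (q p.1, p.2) ∈ Metric.closedBall (0 : ℝ × ℝ × ℝ) C := by
  obtain ⟨hf, hm, ⟨C, hC⟩, -⟩ := hH
  obtain ⟨C', hC'⟩ := ((isCompact_closedBall (0 : ℝ × ℝ × ℝ) C).prod
    (isCompact_Icc (a := (0 : ℝ)) (b := 1))).exists_bound_of_continuousOn hκ.continuousOn
  refine ⟨hκ.measurable.comp ((hm.comp measurable_fst).prodMk measurable_snd), C', ?_⟩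
  have h1 : ∀ᵐ p ∂(μ.prod (volume.restrict (Set.Ioc (0 : ℝ) 1))),
      q p.1 ∈ Metric.closedBall (0 : ℝ × ℝ × ℝ) C :=
    Measure.quasiMeasurePreserving_fst.ae hC
  have h2 : ∀ᵐ p ∂(μ.prod (volume.restrict (Set.Ioc (0 : ℝ) 1))), p.2 ∈ Set.Ioc (0 : ℝ) 1 :=
    Measure.quasiMeasurePreserving_snd.ae (ae_restrict_mem measurableSet_Ioc)
  filter_upwards [h1, h2] with p hp1 hp2
  simpa using hC' (q p.1, p.2) ⟨hp1, ⟨hp2.1.le, hp2.2⟩⟩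

theorem ExpRep.integral_comp_prod (hH : ExpRep μ q H) {κ : (ℝ × ℝ × ℝ) × ℝ → ℝ × ℝ × ℝ}
    (hκ : Continuous κ) {F : Type*} [NormedAddCommGroup F] [NormedSpace ℝ F]
    {g : ℝ × ℝ × ℝ → F} (hg : Continuous g) :
    ∫ p, g (κ (q p.1, p.2)) ∂(μ.prod (volume.restrict (Set.Ioc (0 : ℝ) 1)))
      = ∫ o, (∫ u in (0 : ℝ)..1, g (κ (q o, u))) ∂μ := by
  obtain ⟨hmeas, C, hb⟩ := hH.comp_prod_bdd hκ
  have := hH.finite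
  rw [integral_prod _ (integrable_comp_of_compact hg hmeas.aestronglyMeasurable
    (isCompact_closedBall _ _) hb)]
  simp only [intervalIntegral.integral_of_le zero_le_one]

/-- The analogue of `ExpRep.comp` with an additional parameter running through `(0,1]`. -/
theorem ExpRep.comp_prod (hH : ExpRep μ q H) {κ : (ℝ × ℝ × ℝ) × ℝ → ℝ × ℝ × ℝ} (hκ : Continuous κ)
    {H' : ℝ → ℝ → ℝ} (he : ∀ s t, H' s t = ∫ o, (∫ u in (0 : ℝ)..1,
      (κ (q o, u)).1 * Real.exp ((κ (q o, u)).2.1 * s + (κ (q o, u)).2.2 * t)) ∂μ) :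
    ExpRep (μ.prod (volume.restrict (Set.Ioc (0 : ℝ) 1))) (fun p => κ (q p.1, p.2)) H' := by
  have := hH.finite
  refine ⟨inferInstance, (hH.comp_prod_bdd hκ).1, (hH.comp_prod_bdd hκ).2, fun s t => ?_⟩
  exact (he s t).trans (hH.integral_comp_prod hκ
    (g := fun r : ℝ × ℝ × ℝ => r.1 * Real.exp (r.2.1 * s + r.2.2 * t)) (by fun_prop)).symm

theorem ExpRep.add {μ ν : Measure (ℝ × ℝ × ℝ)} {H H' : ℝ → ℝ → ℝ} (hμ : ExpRep μ id H)
    (hν : ExpRep ν id H') : ExpRep (μ + ν) id fun s t => H s t + H' s t := by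
  have i1 := fun s t => hμ.integrable (g := fun r : ℝ × ℝ × ℝ =>
    r.1 * Real.exp (r.2.1 * s + r.2.2 * t)) (by fun_prop)
  have i2 := fun s t => hν.integrable (g := fun r : ℝ × ℝ × ℝ =>
    r.1 * Real.exp (r.2.1 * s + r.2.2 * t)) (by fun_prop)
  obtain ⟨hf, hm, ⟨C, hC⟩, he⟩ := hμ
  obtain ⟨hf', hm', ⟨C', hC'⟩, he'⟩ := hν
  refine ⟨inferInstance, measurable_id, ⟨max C C', ?_⟩, fun s t => ?_⟩
  · rw [ae_add_measure_iff]
    exact ⟨hC.mono fun o h => Metric.closedBall_subset_closedBall (le_max_left _ _) h,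
      hC'.mono fun o h => Metric.closedBall_subset_closedBall (le_max_right _ _) h⟩
  · rw [he, he', integral_add_measure (i1 s t) (i2 s t)]

theorem IsExp.add {H H' : ℝ → ℝ → ℝ} (h : IsExp H) (h' : IsExp H') :
    IsExp fun s t => H s t + H' s t := by
  obtain ⟨μ, hμ⟩ := h
  obtain ⟨ν, hν⟩ := h'
  exact ⟨μ + ν, hμ.add hν⟩

theorem IsExp.const_mul {H : ℝ → ℝ → ℝ} (h : IsExp H) (c : ℝ) : IsExp fun s t => c * H s t := by
  obtain ⟨μ, hμ⟩ := h
  refine (hμ.comp (κ := fun r => (c * r.1, r.2)) (by fun_prop) fun s t => ?_).isExp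
  simp only [hμ.eq, id, ← integral_const_mul, mul_assoc]

theorem IsExp.congr {H H' : ℝ → ℝ → ℝ} (h : IsExp H) (he : ∀ s t, H' s t = H s t) : IsExp H' := by
  have : H' = H := funext fun s => funext fun t => he s t
  rwa [this]

theorem IsExp.sub {H H' : ℝ → ℝ → ℝ} (h : IsExp H) (h' : IsExp H') :
    IsExp fun s t => H s t - H' s t :=
  (h.add (h'.const_mul (-1))).congr fun s t => by ring

/-- The product of two integrals of exponentials is one over the product measure, in which the
exponents are added. -/
theorem IsExp.mul {H H' : ℝ → ℝ → ℝ} (h : IsExp H) (h' : IsExp H') :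
    IsExp fun s t => H s t * H' s t := by
  obtain ⟨μ, hμ⟩ := h
  obtain ⟨ν, hν⟩ := h'
  obtain ⟨hf, hm, ⟨C, hC⟩, he⟩ := hμ
  obtain ⟨hf', hm', ⟨C', hC'⟩, he'⟩ := hν
  let κ : (ℝ × ℝ × ℝ) × (ℝ × ℝ × ℝ) → ℝ × ℝ × ℝ := fun p => (p.1.1 * p.2.1, p.1.2 + p.2.2)
  have hκ : Continuous κ := by fun_prop
  obtain ⟨D, hD⟩ := ((isCompact_closedBall (0 : ℝ × ℝ × ℝ) C).prod
    (isCompact_closedBall (0 : ℝ × ℝ × ℝ) C')).exists_bound_of_continuousOn hκ.continuousOn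
  refine ExpRep.isExp (μ := μ.prod ν) (q := κ) ⟨inferInstance, hκ.measurable, ⟨D, ?_⟩, fun s t => ?_⟩
  · have h1 : ∀ᵐ p ∂(μ.prod ν), p.1 ∈ Metric.closedBall (0 : ℝ × ℝ × ℝ) C :=
      Measure.quasiMeasurePreserving_fst.ae hC
    have h2 : ∀ᵐ p ∂(μ.prod ν), p.2 ∈ Metric.closedBall (0 : ℝ × ℝ × ℝ) C' :=
      Measure.quasiMeasurePreserving_snd.ae hC'
    filter_upwards [h1, h2] with p hp1 hp2
    simpa using hD p ⟨hp1, hp2⟩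
  · rw [he, he', ← integral_prod_mul]
    refine integral_congr_ae (.of_forall fun p => ?_)
    simp only [κ, id, Prod.fst_add, Prod.snd_add]
    rw [show (p.1.2.1 + p.2.2.1) * s + (p.1.2.2 + p.2.2.2) * t =
      (p.1.2.1 * s + p.1.2.2 * t) + (p.2.2.1 * s + p.2.2.2 * t) by ring,
      Real.exp_add (p.1.2.1 * s + p.1.2.2 * t)]
    ring

theorem IsExp.subst {H : ℝ → ℝ → ℝ} (h : IsExp H) (a b c d : ℝ) :
    IsExp fun s t => H (a * s + b * t) (c * s + d * t) := by
  obtain ⟨μ, hμ⟩ := h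
  refine (hμ.comp (κ := fun r => (r.1, r.2.1 * a + r.2.2 * c, r.2.1 * b + r.2.2 * d)) (by fun_prop)
    fun s t => ?_).isExp
  simp only [hμ.eq, id]
  congr! 4
  ring

theorem isExp_exp (a b : ℝ) : IsExp fun s t => Real.exp (a * s + b * t) :=
  ExpRep.isExp (μ := Measure.dirac ()) (q := fun _ => (1, a, b))
    ⟨inferInstance, measurable_const, ⟨‖((1, a, b) : ℝ × ℝ × ℝ)‖, by simp⟩, fun s t => by simp⟩

theorem isExp_const (c : ℝ) : IsExp fun _ _ => c :=
  ((isExp_exp 0 0).const_mul c).congr fun s t => by simp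

theorem IsExp.sum {ι : Type*} (S : Finset ι) {H : ι → ℝ → ℝ → ℝ} (h : ∀ i, IsExp (H i)) :
    IsExp fun s t => ∑ i ∈ S, H i s t := by
  classical
  induction S using Finset.induction_on with
  | empty => simpa using isExp_const 0
  | insert i S hi ih => simpa [Finset.sum_insert hi] using (h i).add ih

theorem mul_f₁ (x : ℝ) : x * f₁ x = Real.exp x - 1 := by
  have := sub_smul_dslope Real.exp 0 x
  simpa [f₁] using this

theorem f₁_zero : f₁ 0 = 1 := by simp [f₁]

theorem f₁_eq_integral (x : ℝ) : f₁ x = ∫ u in (0 : ℝ)..1, Real.exp (u * x) := by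
  rcases eq_or_ne x 0 with rfl | hx
  · simp [f₁_zero]
  · have h1 : x * f₁ x = x * ∫ u in (0 : ℝ)..1, Real.exp (u * x) := by
      rw [mul_f₁, ← smul_eq_mul, intervalIntegral.smul_integral_comp_mul_right, integral_exp]
      simp
    exact mul_left_cancel₀ hx h1

theorem hasDerivAt_integral_exp {ν : Measure Ω} [IsFiniteMeasure ν] {r : Ω → ℝ × ℝ × ℝ}
    (hr : Measurable r) {C : ℝ} (hC : ∀ᵐ o ∂ν, r o ∈ Metric.closedBall (0 : ℝ × ℝ × ℝ) C) (s : ℝ) :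
    HasDerivAt (fun s => ∫ o, (r o).1 * Real.exp ((r o).2.1 * s + (r o).2.2) ∂ν)
      (∫ o, (r o).1 * (r o).2.1 * Real.exp ((r o).2.1 * s + (r o).2.2) ∂ν) s := by
  refine hasDerivAt_parametric_integral (μ := ν)
    (g := fun p : (ℝ × ℝ × ℝ) × ℝ => p.1.1 * Real.exp (p.1.2.1 * p.2 + p.1.2.2))
    (g' := fun p => p.1 * p.2.1 * Real.exp (p.2.1 * s + p.2.2)) (by fun_prop)
    hr.aestronglyMeasurable (isCompact_closedBall _ _) hC fun p => ?_
  have h2 : HasDerivAt (fun x => p.1 * Real.exp (p.2.1 * x + p.2.2))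
      (p.1 * (Real.exp (p.2.1 * s + p.2.2) * (p.2.1 * 1))) s :=
    ((((hasDerivAt_id s).const_mul _).add_const _).exp).const_mul _
  exact h2.congr_deriv (by ring)

theorem iteratedDeriv_integral_exp {ν : Measure Ω} [IsFiniteMeasure ν] {r : Ω → ℝ × ℝ × ℝ}
    (hr : Measurable r) {C : ℝ} (hC : ∀ᵐ o ∂ν, r o ∈ Metric.closedBall (0 : ℝ × ℝ × ℝ) C) (n : ℕ) :
    iteratedDeriv n (fun s => ∫ o, (r o).1 * Real.exp ((r o).2.1 * s + (r o).2.2) ∂ν) =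
      fun s => ∫ o, (r o).1 * (r o).2.1 ^ n * Real.exp ((r o).2.1 * s + (r o).2.2) ∂ν := by
  induction n with
  | zero => simp [iteratedDeriv_zero]
  | succ n ih =>
    rw [iteratedDeriv_succ, ih]
    funext s
    have hκ : Continuous fun p : ℝ × ℝ × ℝ => (p.1 * p.2.1 ^ n, p.2.1, p.2.2) := by fun_prop
    obtain ⟨C', hC'⟩ := (isCompact_closedBall (0 : ℝ × ℝ × ℝ) C).exists_bound_of_continuousOn
      hκ.continuousOn
    have := hasDerivAt_integral_exp (hκ.measurable.comp hr)
      (C := C') (hC.mono fun o h => by simpa using hC' _ h) s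
    simp only [Function.comp_def] at this
    rw [this.deriv]
    simp only [pow_succ, mul_assoc]

/-- The Taylor coefficients at the origin of an integral of exponentials. -/
theorem ExpRep.coeff (hH : ExpRep μ q H) (k l : ℕ) :
    iteratedDeriv k (fun s => iteratedDeriv l (fun t => H s t) 0) 0 =
      ∫ o, (q o).1 * (q o).2.1 ^ k * (q o).2.2 ^ l ∂μ := by
  obtain ⟨hf, hm, ⟨C, hC⟩, he⟩ := hH
  have key : ∀ {κ : ℝ × ℝ × ℝ → ℝ × ℝ × ℝ} (_ : Continuous κ) (n : ℕ),
      iteratedDeriv n (fun s => ∫ o, (κ (q o)).1 * Real.exp ((κ (q o)).2.1 * s + (κ (q o)).2.2) ∂μ) =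
      fun s => ∫ o, (κ (q o)).1 * (κ (q o)).2.1 ^ n *
        Real.exp ((κ (q o)).2.1 * s + (κ (q o)).2.2) ∂μ := by
    intro κ hκ n
    obtain ⟨C', hC'⟩ := (isCompact_closedBall (0 : ℝ × ℝ × ℝ) C).exists_bound_of_continuousOn
      hκ.continuousOn
    exact iteratedDeriv_integral_exp (r := fun o => κ (q o)) (hκ.measurable.comp hm)
      (C := C') (hC.mono fun o h => by simpa using hC' _ h) n
  have h1 : (fun s => iteratedDeriv l (fun t => H s t) 0) =
      fun s => ∫ o, (q o).1 * (q o).2.2 ^ l * Real.exp ((q o).2.1 * s + 0) ∂μ := by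
    funext s
    have : (fun t => H s t) =
        fun t => ∫ o, (q o).1 * Real.exp ((q o).2.2 * t + (q o).2.1 * s) ∂μ := by
      funext t
      rw [he]
      simp only [add_comm]
    rw [this, key (κ := fun r => (r.1, r.2.2, r.2.1 * s)) (by fun_prop) l]
    simp
  rw [h1, key (κ := fun r => (r.1 * r.2.2 ^ l, r.2.1, 0)) (by fun_prop) k]
  simp only [mul_zero, add_zero, Real.exp_zero, mul_one]
  congr 1
  funext o
  ring

variable {W : ℝ → ℝ}

theorem ExpRep.dslope_eq (hW : ExpRep μ q fun s _ => W s) (s t : ℝ) :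
    dslope W t (s + t) =
      ∫ o, (q o).1 * (q o).2.1 * Real.exp ((q o).2.1 * t) * f₁ ((q o).2.1 * s) ∂μ := by
  have he : ∀ s, W s = ∫ o, (q o).1 * Real.exp ((q o).2.1 * s) ∂μ := fun s => by
    simpa using hW.eq s 0
  rcases eq_or_ne s 0 with rfl | hs
  · rw [zero_add, dslope_same]
    obtain ⟨hf, hm, ⟨C, hC⟩, -⟩ := hW
    obtain ⟨C', hC'⟩ := (isCompact_closedBall (0 : ℝ × ℝ × ℝ) C).exists_bound_of_continuousOn
      (f := fun p : ℝ × ℝ × ℝ => (p.1, p.2.1, (0 : ℝ))) (by fun_prop)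
    have := hasDerivAt_integral_exp (ν := μ) (r := fun o => ((q o).1, (q o).2.1, 0)) (by fun_prop)
      (C := C') (hC.mono fun o h => by simpa using hC' _ h) t
    simp only [add_zero, ← he] at this
    rw [this.deriv]
    simp [f₁_zero]
  · have h1 : s * dslope W t (s + t) = W (s + t) - W t := by
      simpa using sub_smul_dslope W t (s + t)
    refine mul_left_cancel₀ hs ?_
    rw [h1, he, he, ← integral_sub, ← integral_const_mul]
    · refine integral_congr_ae (.of_forall fun o => ?_)
      have h2 := mul_f₁ ((q o).2.1 * s)
      simp only [mul_add, Real.exp_add]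
      linear_combination (-(q o).1 * Real.exp ((q o).2.1 * t)) * h2
    · exact hW.integrable (g := fun r : ℝ × ℝ × ℝ => r.1 * Real.exp (r.2.1 * (s + t))) (by fun_prop)
    · exact hW.integrable (g := fun r : ℝ × ℝ × ℝ => r.1 * Real.exp (r.2.1 * t)) (by fun_prop)

theorem ExpRep.dslope_rep (hW : ExpRep μ q fun s _ => W s) (s t : ℝ) :
    dslope W t (s + t) = ∫ o, (∫ u in (0 : ℝ)..1, (q o).1 * (q o).2.1 *
      Real.exp ((q o).2.1 * u * s + (q o).2.1 * t)) ∂μ := by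
  rw [hW.dslope_eq]
  refine integral_congr_ae (.of_forall fun o => ?_)
  simp only
  rw [f₁_eq_integral, ← intervalIntegral.integral_const_mul]
  refine intervalIntegral.integral_congr fun u _ => ?_
  simp only [Real.exp_add]
  rw [show (q o).2.1 * u * s = u * ((q o).2.1 * s) by ring]
  ring

/-- The difference quotient of `W` is `∫ w α e^{αt} f₁(αs) dμ`, and `f₁` is itself an integral of
exponentials. -/
theorem IsExp.dslope {W : ℝ → ℝ} (hW : IsExp fun s _ => W s) :
    IsExp fun s t => dslope W t (s + t) := by
  obtain ⟨μ, hμ⟩ := hW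
  exact (hμ.comp_prod (κ := fun p => (p.1.1 * p.1.2.1, p.1.2.1 * p.2, p.1.2.1)) (by fun_prop)
    fun s t => hμ.dslope_rep s t).isExp

theorem isExp_f₁ : IsExp fun s _ => f₁ s := by
  have h : IsExp fun s _ => Real.exp s := (isExp_exp 1 0).congr fun s t => by simp
  exact (h.dslope.subst 1 0 0 0).congr fun s t => by simp [f₁]

theorem intervalIntegral_reflect (f : ℝ → ℝ) :
    ∫ u in (0 : ℝ)..1, f (1 - u) = ∫ u in (0 : ℝ)..1, f u := by
  simp

/-- The symbol of the derivative of `h ↦ e^{-2jh} W(∇̸)` in the slot to the left of the argument. -/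
def leftSymbol (j : ℝ) (W : ℝ → ℝ) (s t : ℝ) : ℝ :=
  -2 * j * f₁ (-j * s) * W t + (-2) * dslope W t (s + t)

/-- The symbol of the derivative of `h ↦ e^{-2jh} W(∇̸)` in the slot to the right of the argument. -/
def rightSymbol (W : ℝ → ℝ) (s t : ℝ) : ℝ := 2 * dslope W s (s + t)

/-- The exponents are those produced by Duhamel's formula for `e^{(-2j-2α)h}`. -/
theorem ExpRep.leftSymbol_rep (hW : ExpRep μ q fun s _ => W s) (j s t : ℝ) :
    leftSymbol j W s t = ∫ o, (∫ u in (0 : ℝ)..1, (q o).1 * (-2 * j - 2 * (q o).2.1) *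
      Real.exp (((q o).2.1 + (1 - u) * (-j - (q o).2.1)) * s + (q o).2.1 * t)) ∂μ := by
  have he : ∀ s, W s = ∫ o, (q o).1 * Real.exp ((q o).2.1 * s) ∂μ := fun s => by
    simpa using hW.eq s 0
  have hf : Continuous f₁ := by
    have : f₁ = fun x => ∫ u in (0 : ℝ)..1, Real.exp (u * x) := funext f₁_eq_integral
    rw [this]
    exact intervalIntegral.continuous_parametric_intervalIntegral_of_continuous' (by fun_prop) 0 1
  rw [leftSymbol, hW.dslope_eq, he, ← integral_const_mul, ← integral_const_mul, ← integral_add]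
  · refine integral_congr_ae (.of_forall fun o => ?_)
    simp only
    set α := (q o).2.1
    have h1 : ∫ u in (0 : ℝ)..1, (q o).1 * (-2 * j - 2 * α) *
        Real.exp ((α + (1 - u) * (-j - α)) * s + α * t) =
        (q o).1 * (-2 * j - 2 * α) * Real.exp (α * s + α * t) * f₁ ((-j - α) * s) := by
      rw [f₁_eq_integral, ← intervalIntegral.integral_const_mul,
        ← intervalIntegral_reflect]
      refine intervalIntegral.integral_congr fun u _ => ?_
      rw [mul_assoc _ (Real.exp _) (Real.exp _), ← Real.exp_add]
      congr 2
      ring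
    rw [h1]
    rcases eq_or_ne s 0 with rfl | hs
    · simp [f₁_zero]
      ring
    · refine mul_left_cancel₀ hs ?_
      have e1 := mul_f₁ (-j * s)
      have e2 := mul_f₁ (α * s)
      have e3 := mul_f₁ ((-j - α) * s)
      have e4 : Real.exp (α * s + α * t) * Real.exp ((-j - α) * s) =
        Real.exp (α * t) * Real.exp (-j * s) := by
        rw [← Real.exp_add, ← Real.exp_add]
        congr 1
        ring
      have e5 : Real.exp (α * s + α * t) = Real.exp (α * s) * Real.exp (α * t) := Real.exp_add _ _
      linear_combination (2 * (q o).1 * Real.exp (α * t)) * e1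
        - 2 * (q o).1 * Real.exp (α * t) * e2 - 2 * (q o).1 * Real.exp (α * s + α * t) * e3
        - 2 * (q o).1 * e4 + 2 * (q o).1 * e5
  · exact hW.integrable (g := fun r : ℝ × ℝ × ℝ => -2 * j * f₁ (-j * s) *
      (r.1 * Real.exp (r.2.1 * t))) (by fun_prop)
  · exact hW.integrable (g := fun r : ℝ × ℝ × ℝ => -2 *
      (r.1 * r.2.1 * Real.exp (r.2.1 * t) * f₁ (r.2.1 * s))) (by fun_prop)

/-- The exponents are those produced by Duhamel's formula for `e^{2αh}`. -/
theorem ExpRep.rightSymbol_rep (hW : ExpRep μ q fun s _ => W s) (s t : ℝ) :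
    rightSymbol W s t = ∫ o, (∫ u in (0 : ℝ)..1, (q o).1 * (2 * (q o).2.1) *
      Real.exp ((q o).2.1 * s + (1 - u) * (q o).2.1 * t)) ∂μ := by
  rw [rightSymbol, add_comm s t, hW.dslope_rep, ← integral_const_mul]
  refine integral_congr_ae (.of_forall fun o => ?_)
  simp only
  rw [← intervalIntegral_reflect, ← intervalIntegral.integral_const_mul]
  refine intervalIntegral.integral_congr fun u _ => ?_
  rw [add_comm, mul_comm (q o).2.1 (1 - u)]
  ring

end ExpRep

/-! ### The modular derivation of a Banach algebra -/

section BanachCalculus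

variable {B : Type*} [NormedRing B] [NormedAlgebra ℝ B] [CompleteSpace B]

theorem hasDerivAt_bexp_line (c : ℝ) (h a : B) :
    HasDerivAt (fun ε : ℝ => bexp c (h + ε • a))
      (∫ u in (0 : ℝ)..1, c • (bexp (u * c) h * a * bexp ((1 - u) * c) h)) 0 := by
  have hb := contDiff_bexp (B := B).continuous
  have hc : Continuous fun ε : ℝ => ∫ u in (0 : ℝ)..1,
      c • (bexp (u * c) (h + ε • a) * a * bexp ((1 - u) * c) h) := by
    refine intervalIntegral.continuous_parametric_intervalIntegral_of_continuous' ?_ 0 1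
    have h1 : Continuous fun p : ℝ × ℝ => bexp (p.2 * c) (h + p.1 • a) :=
      hb.comp (by fun_prop : Continuous fun p : ℝ × ℝ => (p.2 * c, h + p.1 • a))
    have h2 : Continuous fun p : ℝ × ℝ => bexp ((1 - p.2) * c) h :=
      hb.comp (by fun_prop : Continuous fun p : ℝ × ℝ => ((1 - p.2) * c, h))
    exact ((h1.mul continuous_const).mul h2).const_smul c
  rw [hasDerivAt_iff_tendsto_slope_zero]
  have h0 := (hc.tendsto 0).mono_left (nhdsWithin_le_nhds (s := {0}ᶜ))
  simp only [zero_smul, add_zero] at h0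
  refine h0.congr' ?_
  filter_upwards [self_mem_nhdsWithin] with ε hε
  have hε' : ε ≠ 0 := hε
  simp only [zero_add, zero_smul, add_zero]
  rw [bexp_sub_bexp, add_sub_cancel_left, ← intervalIntegral.integral_smul]
  refine intervalIntegral.integral_congr fun u _ => ?_
  simp only [mul_smul_comm, smul_mul_assoc, smul_smul]
  congr 1
  field_simp

/-- The modular derivation `y ↦ 2 (y h - h y)` of a Banach algebra. -/
def bder (h : B) : B →L[ℝ] B :=
  (2 : ℝ) • ((ContinuousLinearMap.mul ℝ B).flip h - ContinuousLinearMap.mul ℝ B h)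

theorem bder_apply (h y : B) : bder h y = (2 : ℝ) • (y * h - h * y) := by simp [bder]

/-- The modular automorphism `e^{α∇̸}(y) = e^{-2αh} y e^{2αh}`. -/
def modAut (α : ℝ) (h y : B) : B := bexp (-2 * α) h * y * bexp (2 * α) h

theorem modAut_one (α : ℝ) (h : B) : modAut α h 1 = 1 := by
  rw [modAut, mul_one, bexp_mul_bexp_of_eq h (by ring : -2 * α + 2 * α = 0), bexp_zero]

theorem smul_pow_apply (X : B →L[ℝ] B) (c : ℝ) (n : ℕ) (z : B) :
    ((c • X) ^ n) z = c ^ n • X^[n] z := by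
  induction n with
  | zero => simp
  | succ n ih =>
    rw [pow_succ', mul_apply_eq_comp, ih, Function.iterate_succ_apply', pow_succ', mul_smul,
      smul_apply, map_smul]

theorem hasSum_exp_apply (X : B →L[ℝ] B) (c : ℝ) (z : B) :
    HasSum (fun k : ℕ => (c ^ k / (k ! : ℝ)) • X^[k] z) (NormedSpace.exp (c • X) z) := by
  have h1 := (NormedSpace.exp_series_hasSum_exp' (𝕂 := ℝ) (c • X)).mapL
      (ContinuousLinearMap.apply ℝ B z)
  rw [ContinuousLinearMap.apply_apply] at h1
  refine h1.congr_fun fun k => ?_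
  rw [ContinuousLinearMap.apply_apply, smul_apply, smul_pow_apply, smul_smul, div_eq_inv_mul]

/-- The modular automorphism is the exponential of the modular derivation, because left and right
multiplication by `h` commute. -/
theorem hasSum_modAut (α : ℝ) (h y : B) :
    HasSum (fun k : ℕ => (α ^ k / (k ! : ℝ)) • (bder h)^[k] y) (modAut α h y) := by
  let L : B →L[ℝ] B := ContinuousLinearMap.mul ℝ B h
  let R : B →L[ℝ] B := (ContinuousLinearMap.mul ℝ B).flip h
  have hL : ∀ (c : ℝ) (z : B), NormedSpace.exp (c • L) z = bexp c h * z := by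
    intro c z
    have h2 := (NormedSpace.exp_series_hasSum_exp' (𝕂 := ℝ) (c • h)).mul_right z
    refine (hasSum_exp_apply L c z).unique (h2.congr_fun fun n => ?_)
    have : ∀ n : ℕ, L^[n] z = h ^ n * z := by
      intro n
      induction n with
      | zero => simp
      | succ n ih => rw [Function.iterate_succ_apply', ih, pow_succ', mul_assoc]; rfl
    rw [this, smul_pow, smul_mul_assoc, smul_mul_assoc, smul_smul, div_eq_inv_mul]
  have hR : ∀ (c : ℝ) (z : B), NormedSpace.exp (c • R) z = z * bexp c h := by
    intro c z
    have h2 := (NormedSpace.exp_series_hasSum_exp' (𝕂 := ℝ) (c • h)).mul_left z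
    refine (hasSum_exp_apply R c z).unique (h2.congr_fun fun n => ?_)
    have : ∀ n : ℕ, R^[n] z = z * h ^ n := by
      intro n
      induction n with
      | zero => simp
      | succ n ih => rw [Function.iterate_succ_apply', ih, pow_succ, ← mul_assoc]; rfl
    rw [this, smul_pow, mul_smul_comm, mul_smul_comm, smul_smul, div_eq_inv_mul]
  have hD : α • bder h = (2 * α) • R + (-2 * α) • L := by
    ext z
    simp only [bder, R, L, smul_apply, sub_apply, add_apply]
    module
  have hcomm : Commute ((2 * α) • R) ((-2 * α) • L) := by
    ext z
    simp [R, L, mul_assoc, smul_smul, mul_comm]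
  have h3 : NormedSpace.exp (α • bder h) y = modAut α h y := by
    let _ : NormedAlgebra ℚ (B →L[ℝ] B) := NormedAlgebra.restrictScalars ℚ ℝ (B →L[ℝ] B)
    rw [hD, NormedSpace.exp_add_of_commute hcomm, mul_apply_eq_comp, hL, hR, modAut]
  rw [← h3]
  exact hasSum_exp_apply _ _ _

end BanachCalculus

/-! ### The functional calculus of the modular derivation -/

section BanachCalculus

variable {B : Type*} [NormedRing B] [NormedAlgebra ℝ B] [CompleteSpace B]
variable {Ω : Type*} [MeasurableSpace Ω] {μ : Measure Ω} {q : Ω → ℝ × ℝ × ℝ} {H : ℝ → ℝ → ℝ}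
  {W : ℝ → ℝ}

@[fun_prop]
theorem _root_.Continuous.modAut {X : Type*} [TopologicalSpace X] {f : X → ℝ} {g k : X → B}
    (hf : Continuous f) (hg : Continuous g) (hk : Continuous k) :
    Continuous fun x => modAut (f x) (g x) (k x) := by
  unfold ConnesLandi.modAut
  fun_prop

/-- The Taylor coefficient of `s^k t^l` of a function of two variables. -/
def taylor₂ (H : ℝ → ℝ → ℝ) (p : ℕ × ℕ) : ℝ :=
  iteratedDeriv p.1 (fun s => iteratedDeriv p.2 (fun t => H s t) 0) 0
    / ((p.1 ! : ℝ) * (p.2 ! : ℝ))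

/-- `H(∇̸₍₁₎, ∇̸₍₂₎)(y z)` in a Banach algebra, by the power series of `H`. -/
def bcalc (H : ℝ → ℝ → ℝ) (h y z : B) : B :=
  ∑' p : ℕ × ℕ, taylor₂ H p • ((bder h)^[p.1] y * (bder h)^[p.2] z)

theorem norm_iterate_bder_le (h y : B) (k : ℕ) : ‖(bder h)^[k] y‖ ≤ ‖bder h‖ ^ k * ‖y‖ := by
  induction k with
  | zero => simp
  | succ k ih =>
    rw [Function.iterate_succ_apply', pow_succ', mul_assoc]
    exact ((bder h).le_opNorm _).trans (mul_le_mul_of_nonneg_left ih (norm_nonneg _))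

theorem summable_norm_modAut (α : ℝ) (h y : B) :
    Summable fun k : ℕ => ‖(α ^ k / (k ! : ℝ)) • (bder h)^[k] y‖ := by
  refine Summable.of_nonneg_of_le (fun _ => norm_nonneg _) (fun k => ?_)
    ((Real.summable_pow_div_factorial (|α| * ‖bder h‖)).mul_right ‖y‖)
  rw [norm_smul, Real.norm_eq_abs, abs_div, abs_pow, Nat.abs_cast, mul_pow]
  calc |α| ^ k / (k ! : ℝ) * ‖(bder h)^[k] y‖
      ≤ |α| ^ k / (k ! : ℝ) * (‖bder h‖ ^ k * ‖y‖) := by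
        gcongr
        exact norm_iterate_bder_le h y k
    _ = |α| ^ k * ‖bder h‖ ^ k / (k ! : ℝ) * ‖y‖ := by ring

theorem ExpRep.summable_integral_norm (hH : ExpRep μ q H) (h y z : B) :
    Summable fun p : ℕ × ℕ => ∫ o, ‖(q o).1 • ((((q o).2.1 ^ p.1 / (p.1 ! : ℝ)) •
      (bder h)^[p.1] y) * (((q o).2.2 ^ p.2 / (p.2 ! : ℝ)) • (bder h)^[p.2] z))‖ ∂μ := by
  obtain ⟨C, hC⟩ := hH.bdd
  have := hH.finite
  refine Summable.of_nonneg_of_le (fun p => integral_nonneg fun o => norm_nonneg _) (fun p => ?_)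
    (((((summable_norm_modAut C h y).mul_of_nonneg (summable_norm_modAut C h z)
      (fun _ => norm_nonneg _) (fun _ => norm_nonneg _))).mul_left C).mul_right (μ.real Set.univ))
  refine (integral_mono_of_nonneg (.of_forall fun o => norm_nonneg _) (integrable_const
    (C * (‖(C ^ p.1 / (p.1 ! : ℝ)) • (bder h)^[p.1] y‖ *
      ‖(C ^ p.2 / (p.2 ! : ℝ)) • (bder h)^[p.2] z‖))) ?_).trans_eq ?_
  · filter_upwards [hC] with o ho
    rw [mem_closedBall_zero_iff, Prod.norm_def, Prod.norm_def, max_le_iff, max_le_iff] at ho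
    obtain ⟨h1, h2, h3⟩ := ho
    have hC0 : 0 ≤ C := (norm_nonneg _).trans h1
    have key : ∀ (x : ℝ) (k : ℕ) (v : B), ‖x‖ ≤ C →
        ‖(x ^ k / (k ! : ℝ)) • v‖ ≤ ‖(C ^ k / (k ! : ℝ)) • v‖ := by
      intro x k v hx
      rw [norm_smul, norm_smul, norm_div, norm_div, norm_pow, norm_pow, Real.norm_of_nonneg hC0]
      gcongr
    rw [norm_smul]
    exact mul_le_mul h1 ((norm_mul_le _ _).trans (mul_le_mul (key _ _ _ h2) (key _ _ _ h3)
      (norm_nonneg _) (norm_nonneg _))) (norm_nonneg _) hC0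
  · rw [integral_const, smul_eq_mul, mul_comm]

theorem hasSum_smul_modAut_mul (r : ℝ × ℝ × ℝ) (h y z : B) :
    HasSum (fun p : ℕ × ℕ => r.1 • (((r.2.1 ^ p.1 / (p.1 ! : ℝ)) • (bder h)^[p.1] y) *
      ((r.2.2 ^ p.2 / (p.2 ! : ℝ)) • (bder h)^[p.2] z)))
      (r.1 • (modAut r.2.1 h y * modAut r.2.2 h z)) := by
  have h1 := summable_mul_of_summable_norm (summable_norm_modAut r.2.1 h y)
    (summable_norm_modAut r.2.2 h z)
  have h2 := HasSum.mul (hasSum_modAut r.2.1 h y) (hasSum_modAut r.2.2 h z) h1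
  exact h2.const_smul r.1

theorem ExpRep.hasSum_bcalc (hH : ExpRep μ q H) (h y z : B) :
    HasSum (fun p : ℕ × ℕ => taylor₂ H p • ((bder h)^[p.1] y * (bder h)^[p.2] z))
      (∫ o, (q o).1 • (modAut (q o).2.1 h y * modAut (q o).2.2 h z) ∂μ) := by
  let g : ℕ × ℕ → ℝ × ℝ × ℝ → B := fun p r => r.1 • (((r.2.1 ^ p.1 / (p.1 ! : ℝ)) •
    (bder h)^[p.1] y) * ((r.2.2 ^ p.2 / (p.2 ! : ℝ)) • (bder h)^[p.2] z))
  have hc : ∀ p, Continuous (g p) := fun p => by fun_prop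
  have h1 := hasSum_integral_of_summable_integral_norm (F := fun p o => g p (q o))
    (fun p => hH.integrable (hc p)) (hH.summable_integral_norm h y z)
  have h2 : ∀ o, ∑' p, g p (q o) = (q o).1 • (modAut (q o).2.1 h y * modAut (q o).2.2 h z) :=
    fun o => (hasSum_smul_modAut_mul (q o) h y z).tsum_eq
  simp only [h2] at h1
  refine h1.congr_fun fun p => ?_
  have h3 : ∀ o, g p (q o) = ((q o).1 * (q o).2.1 ^ p.1 * (q o).2.2 ^ p.2 /
      ((p.1 ! : ℝ) * (p.2 ! : ℝ))) • ((bder h)^[p.1] y * (bder h)^[p.2] z) := fun o => by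
    simp only [g, smul_mul_assoc, mul_smul_comm, smul_smul]
    congr 1
    ring
  simp only [h3]
  rw [taylor₂, hH.coeff, ← integral_div, integral_smul_const]

/-- For an integral of exponentials the power series sums to the integral of products of modular
automorphisms. All later computations start from this formula. -/
theorem ExpRep.bcalc_eq (hH : ExpRep μ q H) (h y z : B) :
    bcalc H h y z = ∫ o, (q o).1 • (modAut (q o).2.1 h y * modAut (q o).2.2 h z) ∂μ :=
  (hH.hasSum_bcalc h y z).tsum_eq

theorem IsExp.hasSum_bcalc (hH : IsExp H) (h y z : B) :
    HasSum (fun p : ℕ × ℕ => taylor₂ H p • ((bder h)^[p.1] y * (bder h)^[p.2] z))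
      (bcalc H h y z) := by
  obtain ⟨μ, hμ⟩ := hH
  rw [hμ.bcalc_eq]
  exact hμ.hasSum_bcalc h y z

theorem iterate_bder_one (h : B) {k : ℕ} (hk : k ≠ 0) : (bder h)^[k] (1 : B) = 0 := by
  obtain ⟨k, rfl⟩ := Nat.exists_eq_succ_of_ne_zero hk
  rw [Function.iterate_succ_apply, bder_apply]
  simp [iterate_map_zero]

/-- The functional calculus `K(∇̸)(y)` of one variable is the case `z = 1` of the one of two
variables. -/
theorem IsExp.hasSum_bcalc_one (hW : IsExp fun s _ => W s) (h y : B) :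
    HasSum (fun k : ℕ => (iteratedDeriv k W 0 / (k ! : ℝ)) • (bder h)^[k] y)
      (bcalc (fun s _ => W s) h y 1) := by
  have h1 := hW.hasSum_bcalc h y 1
  have hinj : Function.Injective fun k : ℕ => (k, 0) := fun a b hab => by simpa using hab
  rw [← hinj.hasSum_iff] at h1
  · refine h1.congr_fun fun k => ?_
    simp [taylor₂]
  · rintro ⟨k, l⟩ hkl
    have hl : l ≠ 0 := by
      rintro rfl
      exact hkl ⟨k, rfl⟩
    simp [iterate_bder_one h hl]

theorem IsExp.contDiff_bcalc (hH : IsExp H) :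
    ContDiff ℝ ∞ fun p : B × B × B => bcalc H p.1 p.2.1 p.2.2 := by
  obtain ⟨μ, hμ⟩ := hH
  have h1 : (fun p : B × B × B => bcalc H p.1 p.2.1 p.2.2) = fun p => ∫ r, r.1 •
      (modAut r.2.1 p.1 p.2.1 * modAut r.2.2 p.1 p.2.2) ∂μ := funext fun p => hμ.bcalc_eq _ _ _
  rw [h1]
  obtain ⟨hf, hm, ⟨C, hC⟩, -⟩ := hμ
  refine contDiff_parametric_integral (g := fun x : (ℝ × ℝ × ℝ) × (B × B × B) => x.1.1 •
      (modAut x.1.2.1 x.2.1 x.2.2.1 * modAut x.1.2.2 x.2.1 x.2.2.2)) ?_ hm.aestronglyMeasurable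
      (isCompact_closedBall _ _) hC
  have hb : ∀ {f : (ℝ × ℝ × ℝ) × (B × B × B) → ℝ}, ContDiff ℝ ∞ f →
      ContDiff ℝ ∞ fun x => bexp (f x) x.2.1 := fun hf => hf.bexp le_rfl (by fun_prop)
  have e1 := hb (f := fun x => -2 * x.1.2.1) (by fun_prop)
  have e2 := hb (f := fun x => 2 * x.1.2.1) (by fun_prop)
  have e3 := hb (f := fun x => -2 * x.1.2.2) (by fun_prop)
  have e4 := hb (f := fun x => 2 * x.1.2.2) (by fun_prop)
  unfold modAut
  fun_prop

theorem ExpRep.integrable_bcalc (hH : ExpRep μ q H) (h y z : B) :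
    Integrable (fun o => (q o).1 • (modAut (q o).2.1 h y * modAut (q o).2.2 h z)) μ :=
  hH.integrable (g := fun r : ℝ × ℝ × ℝ => r.1 • (modAut r.2.1 h y * modAut r.2.2 h z))
    (by fun_prop)

theorem IsExp.bcalc_add {H' : ℝ → ℝ → ℝ} (hH : IsExp H) (hH' : IsExp H') (h y z : B) :
    bcalc (fun s t => H s t + H' s t) h y z = bcalc H h y z + bcalc H' h y z := by
  obtain ⟨μ, hμ⟩ := hH
  obtain ⟨ν, hν⟩ := hH'
  rw [(hμ.add hν).bcalc_eq, hμ.bcalc_eq, hν.bcalc_eq,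
    integral_add_measure (hμ.integrable_bcalc h y z) (hν.integrable_bcalc h y z)]

theorem IsExp.bcalc_const_mul (hH : IsExp H) (c : ℝ) (h y z : B) :
    bcalc (fun s t => c * H s t) h y z = c • bcalc H h y z := by
  obtain ⟨μ, hμ⟩ := hH
  have h1 : ExpRep μ _ (fun s t => c * H s t) :=
    hμ.comp (κ := fun r => (c * r.1, r.2)) (by fun_prop) fun s t => by
      simp only [hμ.eq, id, ← integral_const_mul, mul_assoc]
  rw [h1.bcalc_eq, hμ.bcalc_eq, ← integral_smul]
  simp [mul_smul]

theorem IsExp.bcalc_sub {H' : ℝ → ℝ → ℝ} (hH : IsExp H) (hH' : IsExp H') (h y z : B) :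
    bcalc (fun s t => H s t - H' s t) h y z = bcalc H h y z - bcalc H' h y z := by
  have : (fun s t => H s t - H' s t) = fun s t => H s t + (-1) * H' s t := by
    funext s t
    ring
  rw [this, hH.bcalc_add (hH'.const_mul _), hH'.bcalc_const_mul]
  module

theorem IsExp.bcalc_add_left (hH : IsExp H) (h y y' z : B) :
    bcalc H h (y + y') z = bcalc H h y z + bcalc H h y' z := by
  refine HasSum.unique (hH.hasSum_bcalc h _ z) (((hH.hasSum_bcalc h y z).add
    (hH.hasSum_bcalc h y' z)).congr_fun fun p => ?_)
  rw [iterate_map_add, add_mul, smul_add]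

theorem IsExp.bcalc_add_right (hH : IsExp H) (h y z z' : B) :
    bcalc H h y (z + z') = bcalc H h y z + bcalc H h y z' := by
  refine HasSum.unique (hH.hasSum_bcalc h y _) (((hH.hasSum_bcalc h y z).add
    (hH.hasSum_bcalc h y z')).congr_fun fun p => ?_)
  rw [iterate_map_add, mul_add, smul_add]

theorem iterate_bder_smul (h y : B) (c : ℝ) (k : ℕ) :
    (bder h)^[k] (c • y) = c • (bder h)^[k] y := by
  induction k with
  | zero => rfl
  | succ k ih => rw [Function.iterate_succ_apply', ih, map_smul, Function.iterate_succ_apply']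

theorem IsExp.bcalc_smul_left (hH : IsExp H) (c : ℝ) (h y z : B) :
    bcalc H h (c • y) z = c • bcalc H h y z := by
  refine HasSum.unique (hH.hasSum_bcalc h _ z) (((hH.hasSum_bcalc h y z).const_smul c).congr_fun
    fun p => ?_)
  rw [iterate_bder_smul, smul_mul_assoc, smul_comm]

theorem IsExp.bcalc_smul_right (hH : IsExp H) (c : ℝ) (h y z : B) :
    bcalc H h y (c • z) = c • bcalc H h y z := by
  refine HasSum.unique (hH.hasSum_bcalc h y _) (((hH.hasSum_bcalc h y z).const_smul c).congr_fun
    fun p => ?_)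
  rw [iterate_bder_smul, mul_smul_comm, smul_comm]

/-! ### Identities under a trace -/

theorem word_congr {a a' b b' : ℝ} (h x y : B) (ha : a = a') (hb : b = b') :
    x * (bexp a h * (y * bexp b h)) = x * (bexp a' h * (y * bexp b' h)) := by rw [ha, hb]

theorem word_congr₃ {a a' b b' c c' : ℝ} (h x y z : B) (ha : a = a') (hb : b = b') (hc : c = c') :
    x * (bexp a h * (y * (bexp b h * (z * bexp c h)))) =
      x * (bexp a' h * (y * (bexp b' h * (z * bexp c' h)))) := by rw [ha, hb, hc]

variable {G : Type*} [NormedAddCommGroup G] [NormedSpace ℝ G] [CompleteSpace G] (τ : B →L[ℝ] G)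
  (hτ : ∀ a b, τ (a * b) = τ (b * a)) (j : ℝ)

/-- A trace of an expression linear in `bcalc H h y z`, as an integral of traces. -/
theorem ExpRep.map_bcalc (hH : ExpRep μ q H) (h y z b c : B) :
    τ (b * bcalc H h y z * c) =
      ∫ o, (q o).1 • τ (b * (modAut (q o).2.1 h y * modAut (q o).2.2 h z) * c) ∂μ := by
  let L : B →L[ℝ] G := τ.comp
    (((ContinuousLinearMap.mul ℝ B).flip c).comp (ContinuousLinearMap.mul ℝ B b))
  have h1 := L.integral_comp_comm (hH.integrable_bcalc h y z)
  rw [hH.bcalc_eq]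
  refine h1.symm.trans (integral_congr_ae (.of_forall fun o => ?_))
  simp only [map_smul]
  rfl

include hτ in
theorem IsExp.trace_bcalc_one (hW : IsExp fun s _ => W s) (h y : B) :
    τ (bexp (-2 * j) h * bcalc (fun s _ => W s) h y 1) = W 0 • τ (bexp (-2 * j) h * y) := by
  obtain ⟨μ, hμ⟩ := hW
  have h1 := hμ.map_bcalc τ h y 1 (bexp (-2 * j) h) 1
  rw [mul_one] at h1
  rw [h1, hμ.eq 0 0, ← integral_smul_const]
  refine integral_congr_ae (.of_forall fun r => ?_)
  simp only [modAut_one, mul_one, mul_zero, add_zero, Real.exp_zero]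
  congr 1
  simp only [modAut, mul_assoc, bexp_mul_bexp_mul]
  rw [hτ, mul_assoc, bexp_mul_bexp_of_eq h (by ring : 2 * (id r).2.1 + (-2 * j + -2 * (id r).2.1)
    = -2 * j), hτ]

include hτ in
theorem IsExp.trace_bcalc (hH : IsExp H) (h y z : B) :
    τ (bexp (-2 * j) h * bcalc H h y z) =
      τ (bexp (-2 * j) h * bcalc (fun s _ => H s (-s)) h y 1 * z) := by
  obtain ⟨μ, hμ⟩ := hH
  have h2 : ExpRep μ _ (fun s _ => H s (-s)) :=
    hμ.comp (κ := fun r => (r.1, r.2.1 - r.2.2, 0)) (by fun_prop) fun s t => by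
      simp only [hμ.eq, id]
      congr! 4
      ring
  have h1 := hμ.map_bcalc τ h y z (bexp (-2 * j) h) 1
  rw [mul_one] at h1
  rw [h1, h2.map_bcalc]
  refine integral_congr_ae (.of_forall fun r => ?_)
  simp only [Function.comp_apply, id, modAut_one, mul_one]
  congr 1
  simp only [modAut, mul_assoc, bexp_mul_bexp_mul]
  rw [hτ (bexp _ h), hτ (bexp _ h)]
  simp only [mul_assoc, ← bexp_add]
  exact congrArg τ (word_congr _ _ _ (by ring) (by ring))

include hτ in
/-- Rotation of a trace: the left slot is made the outermost factor. -/
theorem IsExp.trace_rotate_left (hH : IsExp H) (h a y z : B) :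
    τ (bexp (-2 * j) h * bcalc H h a y * z) = τ (a * (bexp (-2 * j) h *
      bcalc (fun s t => Real.exp (-j * (s + t)) * H (-(s + t)) s) h y z)) := by
  obtain ⟨μ, hμ⟩ := hH
  have h2 : ExpRep μ _ (fun s t => Real.exp (-j * (s + t)) * H (-(s + t)) s) :=
    hμ.comp (κ := fun r => (r.1, -j - r.2.1 + r.2.2, -j - r.2.1)) (by fun_prop) fun s t => by
      simp only [hμ.eq, id, ← integral_const_mul]
      refine integral_congr_ae (.of_forall fun r => ?_)
      simp only
      rw [mul_left_comm, ← Real.exp_add]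
      congr 2
      ring
  have h1 := h2.map_bcalc τ h y z (a * bexp (-2 * j) h) 1
  rw [mul_one, mul_assoc] at h1
  rw [h1, hμ.map_bcalc]
  refine integral_congr_ae (.of_forall fun r => ?_)
  simp only [Function.comp_apply, id, mul_one]
  congr 1
  simp only [modAut, mul_assoc, bexp_mul_bexp_mul]
  rw [hτ (bexp _ h)]
  simp only [mul_assoc]
  exact congrArg τ (word_congr₃ _ _ _ _ (by ring) (by ring) (by ring))

include hτ in
/-- Rotation of a trace: the right slot is made the outermost factor. -/
theorem IsExp.trace_rotate_right (hH : IsExp H) (h a y z : B) :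
    τ (bexp (-2 * j) h * bcalc H h y a * z) = τ (a * (bexp (-2 * j) h *
      bcalc (fun s t => Real.exp (-j * s) * H t (-(s + t))) h z y)) := by
  obtain ⟨μ, hμ⟩ := hH
  have h2 : ExpRep μ _ (fun s t => Real.exp (-j * s) * H t (-(s + t))) :=
    hμ.comp (κ := fun r => (r.1, -j - r.2.2, r.2.1 - r.2.2)) (by fun_prop) fun s t => by
      simp only [hμ.eq, id, ← integral_const_mul]
      refine integral_congr_ae (.of_forall fun r => ?_)
      simp only
      rw [mul_left_comm, ← Real.exp_add]
      congr 2
      ring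
  have h1 := h2.map_bcalc τ h z y (a * bexp (-2 * j) h) 1
  rw [mul_one, mul_assoc] at h1
  rw [h1, hμ.map_bcalc]
  refine integral_congr_ae (.of_forall fun r => ?_)
  simp only [Function.comp_apply, id, mul_one]
  congr 1
  simp only [modAut, mul_assoc, bexp_mul_bexp_mul]
  rw [hτ (bexp _ h)]
  simp only [mul_assoc]
  rw [hτ y]
  simp only [mul_assoc]
  rw [hτ (bexp _ h)]
  simp only [mul_assoc]
  exact congrArg τ (word_congr₃ _ _ _ _ (by ring) (by ring) (by ring))

include hτ in
/-- The one-variable calculus is symmetric under a trace, up to `W(s) ↦ W(-s) e^{-js}`. -/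
theorem IsExp.trace_symm (hW : IsExp fun s _ => W s) (h b z : B) :
    τ (bexp (-2 * j) h * bcalc (fun s _ => W s) h b 1 * z) = τ (b * (bexp (-2 * j) h *
      bcalc (fun s _ => W (-s) * Real.exp (-j * s)) h z 1)) := by
  obtain ⟨μ, hμ⟩ := hW
  have h2 : ExpRep μ _ (fun s _ => W (-s) * Real.exp (-j * s)) :=
    hμ.comp (κ := fun r => (r.1, -j - r.2.1, 0)) (by fun_prop) fun s t => by
      rw [hμ.eq (-s) 0, ← integral_mul_const]
      refine integral_congr_ae (.of_forall fun r => ?_)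
      simp only [id]
      rw [mul_assoc, ← Real.exp_add]
      congr 2
      ring
  have h1 := h2.map_bcalc τ h z 1 (b * bexp (-2 * j) h) 1
  rw [mul_one, mul_assoc] at h1
  rw [h1, hμ.map_bcalc]
  refine integral_congr_ae (.of_forall fun r => ?_)
  simp only [Function.comp_apply, id, modAut_one, mul_one]
  congr 1
  simp only [modAut, mul_assoc, bexp_mul_bexp_mul]
  rw [hτ (bexp _ h)]
  simp only [mul_assoc]
  exact congrArg τ (word_congr _ _ _ (by ring) (by ring))

end BanachCalculus

/-! ### The derivative of the functional calculus -/

section BanachCalculus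

variable {B : Type*} [NormedRing B] [NormedAlgebra ℝ B] [CompleteSpace B] {W : ℝ → ℝ}

/-- The operator `y ↦ e^{-2jh} W(∇̸)(y)`. -/
def modOp (j : ℝ) (W : ℝ → ℝ) (h y : B) : B := bexp (-2 * j) h * bcalc (fun s _ => W s) h y 1

theorem modOp_add_right (hW : IsExp fun s _ => W s) (j : ℝ) (h y z : B) :
    modOp j W h (y + z) = modOp j W h y + modOp j W h z := by
  rw [modOp, hW.bcalc_add_left, mul_add]
  rfl

theorem modOp_smul (hW : IsExp fun s _ => W s) (j c : ℝ) (h y : B) :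
    modOp j W h (c • y) = c • modOp j W h y := by
  rw [modOp, hW.bcalc_smul_left, mul_smul_comm]
  rfl

theorem contDiff_modOp (hW : IsExp fun s _ => W s) (j : ℝ) :
    ContDiff ℝ ∞ fun p : B × B => modOp j W p.1 p.2 := by
  have h1 : ContDiff ℝ ∞ fun p : B × B => bcalc (fun s _ => W s) p.1 p.2 1 :=
    ContDiff.comp (f := fun p : B × B => (p.1, p.2, (1 : B))) hW.contDiff_bcalc (by fun_prop)
  have h2 : ContDiff ℝ ∞ fun p : B × B => bexp (-2 * j) p.1 :=
    contDiff_const.bexp le_rfl contDiff_fst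
  exact h2.mul h1

/-- The derivative of `h ↦ e^{-2jh} W(∇̸)(y)` produces two difference quotients of the symbol, one
for each of the two slots on either side of `y`. -/
theorem hasDerivAt_modOp_line (hW : IsExp fun s _ => W s) (j : ℝ) (h a y : B) :
    HasDerivAt (fun ε : ℝ => modOp j W (h + ε • a) y)
      (bexp (-2 * j) h * (bcalc (leftSymbol j W) h a y + bcalc (rightSymbol W) h y a)) 0 := by
  obtain ⟨μ, hμ⟩ := hW
  have hL := hμ.comp_prod (H' := leftSymbol j W) (κ := fun p => (p.1.1 * (-2 * j - 2 * p.1.2.1),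
    p.1.2.1 + (1 - p.2) * (-j - p.1.2.1), p.1.2.1)) (by fun_prop) (hμ.leftSymbol_rep j)
  have hR := hμ.comp_prod (H' := rightSymbol W) (κ := fun p => (p.1.1 * (2 * p.1.2.1),
    p.1.2.1, (1 - p.2) * p.1.2.1)) (by fun_prop) hμ.rightSymbol_rep
  have eL := hμ.integral_comp_prod (κ := fun p => (p.1.1 * (-2 * j - 2 * p.1.2.1),
    p.1.2.1 + (1 - p.2) * (-j - p.1.2.1), p.1.2.1)) (by fun_prop)
    (g := fun r => r.1 • (modAut r.2.1 h a * modAut r.2.2 h y)) (by fun_prop)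
  have eR := hμ.integral_comp_prod (κ := fun p => (p.1.1 * (2 * p.1.2.1),
    p.1.2.1, (1 - p.2) * p.1.2.1)) (by fun_prop)
    (g := fun r => r.1 • (modAut r.2.1 h y * modAut r.2.2 h a)) (by fun_prop)
  rw [hL.bcalc_eq, hR.bcalc_eq, eL, eR]
  obtain ⟨C, hC⟩ := hμ.bdd
  have := hμ.finite
  -- `g r ε` is the integrand of `e^{-2jh} W(∇̸)(y)` at `h + εa`.
  let g : (ℝ × ℝ × ℝ) × ℝ → B := fun p => p.1.1 • (bexp (-2 * j - 2 * p.1.2.1) (h + p.2 • a) * y *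
    bexp (2 * p.1.2.1) (h + p.2 • a))
  have hg : ContDiff ℝ 1 g := by
    have e1 : ContDiff ℝ 1 fun p : (ℝ × ℝ × ℝ) × ℝ => bexp (-2 * j - 2 * p.1.2.1) (h + p.2 • a) :=
      ContDiff.bexp (by simp) (by fun_prop) (by fun_prop)
    have e2 : ContDiff ℝ 1 fun p : (ℝ × ℝ × ℝ) × ℝ => bexp (2 * p.1.2.1) (h + p.2 • a) :=
      ContDiff.bexp (by simp) (by fun_prop) (by fun_prop)
    fun_prop
  have hV : (fun ε : ℝ => modOp j W (h + ε • a) y) = fun ε => ∫ r, g (id r, ε) ∂μ := by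
    funext ε
    let L : B →L[ℝ] B := ContinuousLinearMap.mul ℝ B (bexp (-2 * j) (h + ε • a))
    have h1 := L.integral_comp_comm (hμ.integrable_bcalc (h + ε • a) y 1)
    rw [modOp, hμ.bcalc_eq]
    refine h1.symm.trans (integral_congr_ae (.of_forall fun r => ?_))
    simp only [id, L, ContinuousLinearMap.mul_apply', g, modAut_one, mul_one, mul_smul_comm]
    rw [modAut, ← mul_assoc, ← mul_assoc, ← bexp_add]
    congr 4
    ring
  rw [hV]
  have hd := hasDerivAt_parametric_integral (μ := μ) hg (q := id) aestronglyMeasurable_id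
    (isCompact_closedBall _ _) hC (s := 0) (g' := fun r => r.1 •
      ((∫ u in (0 : ℝ)..1, (-2 * j - 2 * r.2.1) • (bexp (u * (-2 * j - 2 * r.2.1)) h * a *
        bexp ((1 - u) * (-2 * j - 2 * r.2.1)) h)) * y * bexp (2 * r.2.1) h +
      bexp (-2 * j - 2 * r.2.1) h * y * (∫ u in (0 : ℝ)..1, (2 * r.2.1) • (bexp (u * (2 * r.2.1)) h *
        a * bexp ((1 - u) * (2 * r.2.1)) h)))) (fun r => by
      have h1 := ((hasDerivAt_bexp_line (-2 * j - 2 * r.2.1) h a).mul_const y).mul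
        (hasDerivAt_bexp_line (2 * r.2.1) h a)
      have h2 := h1.const_smul r.1
      simp only [zero_smul, add_zero] at h2
      exact h2)
  refine hd.congr_deriv ?_
  let M : B →L[ℝ] B := ContinuousLinearMap.mul ℝ B (bexp (-2 * j) h)
  have cont : ∀ (f : (ℝ × ℝ × ℝ) × ℝ → B), Continuous f → Integrable
      (fun r => ∫ u in (0 : ℝ)..1, f (r, u)) μ := fun f hf =>
    hμ.integrable (g := fun r => ∫ u in (0 : ℝ)..1, f (r, u))
      (intervalIntegral.continuous_parametric_intervalIntegral_of_continuous' (by fun_prop) 0 1)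
  have iL := cont (fun p => (p.1.1 * (-2 * j - 2 * p.1.2.1)) •
    (modAut (p.1.2.1 + (1 - p.2) * (-j - p.1.2.1)) h a * modAut p.1.2.1 h y)) (by fun_prop)
  have iR := cont (fun p => (p.1.1 * (2 * p.1.2.1)) •
    (modAut p.1.2.1 h y * modAut ((1 - p.2) * p.1.2.1) h a)) (by fun_prop)
  refine Eq.trans ?_ ((M.integral_comp_comm (iL.add iR)).trans
    (congrArg M (integral_add iL iR)))
  refine integral_congr_ae (.of_forall fun r => ?_)
  simp only [id, Pi.add_apply]
  set α := r.2.1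
  rw [smul_add, map_add]
  congr 1
  · let N : B →L[ℝ] B := r.1 • ((ContinuousLinearMap.mul ℝ B).flip (bexp (2 * α) h)).comp
      ((ContinuousLinearMap.mul ℝ B).flip y)
    have i1 := N.intervalIntegral_comp_comm (show IntervalIntegrable (fun u : ℝ =>
      (-2 * j - 2 * α) • (bexp (u * (-2 * j - 2 * α)) h * a * bexp ((1 - u) * (-2 * j - 2 * α)) h))
      volume 0 1 from Continuous.intervalIntegrable (by fun_prop) _ _)
    have i2 := M.intervalIntegral_comp_comm (show IntervalIntegrable (fun u : ℝ =>
      (r.1 * (-2 * j - 2 * α)) • (modAut (α + (1 - u) * (-j - α)) h a * modAut α h y))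
      volume 0 1 from Continuous.intervalIntegrable (by fun_prop) _ _)
    refine i1.symm.trans (Eq.trans ?_ i2)
    refine intervalIntegral.integral_congr fun u _ => ?_
    simp only [N, M, smul_apply, ContinuousLinearMap.comp_apply, ContinuousLinearMap.flip_apply,
      ContinuousLinearMap.mul_apply', smul_mul_assoc, mul_smul_comm, smul_smul, modAut, mul_assoc,
      bexp_mul_bexp_mul]
    congr 1
    rw [show -2 * j + -2 * (α + (1 - u) * (-j - α)) = u * (-2 * j - 2 * α) by ring,
      show 2 * (α + (1 - u) * (-j - α)) + -2 * α = (1 - u) * (-2 * j - 2 * α) by ring]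
  · let N : B →L[ℝ] B := r.1 • ContinuousLinearMap.mul ℝ B (bexp (-2 * j - 2 * α) h * y)
    have i1 := N.intervalIntegral_comp_comm (show IntervalIntegrable (fun u : ℝ =>
      (2 * α) • (bexp (u * (2 * α)) h * a * bexp ((1 - u) * (2 * α)) h))
      volume 0 1 from Continuous.intervalIntegrable (by fun_prop) _ _)
    have i2 := M.intervalIntegral_comp_comm (show IntervalIntegrable (fun u : ℝ =>
      (r.1 * (2 * α)) • (modAut α h y * modAut ((1 - u) * α) h a))
      volume 0 1 from Continuous.intervalIntegrable (by fun_prop) _ _)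
    refine i1.symm.trans (Eq.trans ?_ i2)
    refine intervalIntegral.integral_congr fun u _ => ?_
    simp only [N, M, smul_apply, ContinuousLinearMap.mul_apply', mul_smul_comm,
      smul_smul, modAut, mul_assoc, bexp_mul_bexp_mul]
    congr 1
    rw [show -2 * j + -2 * α = -2 * j - 2 * α by ring,
      show 2 * α + -2 * ((1 - u) * α) = u * (2 * α) by ring,
      show 2 * ((1 - u) * α) = (1 - u) * (2 * α) by ring]

theorem fderiv_modOp (hW : IsExp fun s _ => W s) (j : ℝ) (h y a b : B) :
    fderiv ℝ (fun p : B × B => modOp j W p.1 p.2) (h, y) (a, b) =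
      bexp (-2 * j) h * (bcalc (leftSymbol j W) h a y + bcalc (rightSymbol W) h y a)
        + modOp j W h b := by
  have hd := ((contDiff_modOp hW j).differentiable (by simp) (h, y)).hasFDerivAt
  have h1 : HasDerivAt (fun ε : ℝ => modOp j W (h + ε • a) y)
      (fderiv ℝ (fun p : B × B => modOp j W p.1 p.2) (h, y) (a, 0)) 0 := by
    have hl : HasDerivAt (fun ε : ℝ => ((h + ε • a, y) : B × B)) (a, 0) 0 := by
      have := ((hasDerivAt_id (0 : ℝ)).smul_const a).const_add h
      exact (by simpa using this : HasDerivAt (fun ε : ℝ => h + ε • a) a 0).prodMk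
        (hasDerivAt_const _ _)
    exact HasFDerivAt.comp_hasDerivAt (x := (0 : ℝ)) (f := fun ε : ℝ => ((h + ε • a, y) : B × B))
      (by simpa using hd) hl
  have h2 : HasDerivAt (fun ε : ℝ => modOp j W h (y + ε • b))
      (fderiv ℝ (fun p : B × B => modOp j W p.1 p.2) (h, y) (0, b)) 0 := by
    have hl : HasDerivAt (fun ε : ℝ => ((h, y + ε • b) : B × B)) (0, b) 0 := by
      have := ((hasDerivAt_id (0 : ℝ)).smul_const b).const_add y
      exact (hasDerivAt_const _ _).prodMk
        (by simpa using this : HasDerivAt (fun ε : ℝ => y + ε • b) b 0)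
    exact HasFDerivAt.comp_hasDerivAt (x := (0 : ℝ)) (f := fun ε : ℝ => ((h, y + ε • b) : B × B))
      (by simpa using hd) hl
  have h3 : HasDerivAt (fun ε : ℝ => modOp j W h (y + ε • b)) (modOp j W h b) 0 := by
    have := ((hasDerivAt_id (0 : ℝ)).smul_const (modOp j W h b)).const_add (modOp j W h y)
    simpa [modOp_add_right hW, modOp_smul hW] using this
  have h4 : ((a, b) : B × B) = (a, 0) + (0, b) := by simp
  rw [h4, map_add, h1.unique (hasDerivAt_modOp_line hW j h a y), h2.unique h3]

end BanachCalculus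

/-! ### The curvature functions -/

section CurvatureFunctions

/-- The jets at `u = 0` of `u ↦ f(u,s,t)` are integrals of exponentials in `(s,t)`. -/
def JetExp (f : ℝ → ℝ → ℝ → ℝ) : Prop :=
  (∀ s t, ContDiffAt ℝ ∞ (fun u => f u s t) 0) ∧
    ∀ k, IsExp fun s t => iteratedDeriv k (fun u => f u s t) 0

theorem JetExp.congr {f f' : ℝ → ℝ → ℝ → ℝ} (hf : JetExp f) (he : ∀ u s t, f' u s t = f u s t) :
    JetExp f' := by
  have : f' = f := by
    funext u s t
    exact he u s t
  rwa [this]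

theorem IsExp.jetExp {H : ℝ → ℝ → ℝ} (hH : IsExp H) : JetExp fun _ s t => H s t := by
  refine ⟨fun s t => contDiffAt_const, fun k => ?_⟩
  rcases Nat.eq_zero_or_pos k with rfl | hk
  · simpa using hH
  · exact (isExp_const 0).congr fun s t => by simp [iteratedDeriv_const, hk.ne']

theorem jetExp_const (c : ℝ) : JetExp fun _ _ _ => c := (isExp_const c).jetExp

theorem jetExp_id : JetExp fun u _ _ => u := by
  refine ⟨fun s t => contDiffAt_id, fun k => isExp_const _⟩

theorem JetExp.add {f f' : ℝ → ℝ → ℝ → ℝ} (hf : JetExp f) (hf' : JetExp f') :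
    JetExp fun u s t => f u s t + f' u s t := by
  refine ⟨fun s t => (hf.1 s t).add (hf'.1 s t), fun k => ?_⟩
  refine ((hf.2 k).add (hf'.2 k)).congr fun s t => ?_
  exact iteratedDeriv_fun_add ((hf.1 s t).of_le (by exact_mod_cast le_top))
    ((hf'.1 s t).of_le (by exact_mod_cast le_top))

/-- The Leibniz rule for jets. -/
theorem JetExp.mul {f f' : ℝ → ℝ → ℝ → ℝ} (hf : JetExp f) (hf' : JetExp f') :
    JetExp fun u s t => f u s t * f' u s t := by
  refine ⟨fun s t => (hf.1 s t).mul (hf'.1 s t), fun k => ?_⟩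
  refine (IsExp.sum (Finset.range (k + 1)) (H := fun i s t => (k.choose i : ℝ) *
    (iteratedDeriv i (fun u => f u s t) 0 * iteratedDeriv (k - i) (fun u => f' u s t) 0))
    fun i => ((hf.2 i).mul (hf'.2 (k - i))).const_mul _).congr fun s t => ?_
  rw [iteratedDeriv_fun_mul ((hf.1 s t).of_le (by exact_mod_cast le_top))
    ((hf'.1 s t).of_le (by exact_mod_cast le_top))]
  simp only [mul_assoc]

theorem JetExp.sub {f f' : ℝ → ℝ → ℝ → ℝ} (hf : JetExp f) (hf' : JetExp f') :
    JetExp fun u s t => f u s t - f' u s t :=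
  (hf.add ((jetExp_const (-1)).mul hf')).congr fun u s t => by ring

theorem JetExp.pow {f : ℝ → ℝ → ℝ → ℝ} (hf : JetExp f) (n : ℕ) :
    JetExp fun u s t => f u s t ^ n := by
  induction n with
  | zero => simpa using jetExp_const 1
  | succ n ih => simpa [pow_succ] using ih.mul hf

/-- The inverses of the factors `u - 1`, `u - s` and `u - st` of the denominators, with
exponentials in place of `s` and `t`; these factors do not vanish at `u = 0`. -/
theorem jetExp_inv (a b : ℝ) : JetExp fun u s t => (u - Real.exp (a * s + b * t))⁻¹ := by
  refine ⟨fun s t => ?_, fun k => ?_⟩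
  · exact (contDiffAt_id.sub contDiffAt_const).inv (by simp [(Real.exp_pos _).ne'])
  · refine ((isExp_exp ((-1 - k) * a) ((-1 - k) * b)).const_mul
      ((-1) ^ k * k ! * (-1) ^ (-1 - k : ℤ))).congr fun s t => ?_
    have h1 := congrFun (iter_deriv_inv_linear_sub k (1 : ℝ) (Real.exp (a * s + b * t))) 0
    rw [iteratedDeriv_eq_iterate]
    simp only [one_mul, one_pow, mul_one, mul_zero, zero_sub] at h1
    rw [h1, neg_eq_neg_one_mul (Real.exp _), mul_zpow, ← Real.rpow_intCast (Real.exp _),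
      ← Real.exp_mul]
    push_cast
    ring_nf

theorem jetExp_exp (a b : ℝ) : JetExp fun _ s t => Real.exp (a * s + b * t) :=
  (isExp_exp a b).jetExp

/-- After the substitution `s ↦ eˢ` the square root `√s` becomes `e^{s/2}`. -/
theorem isExp_KDelta (m : ℕ) : IsExp fun s _ => KDelta m (Real.exp s) := by
  have h : JetExp fun u s _ => Ftot m u (Real.exp s) := by
    have e1 := jetExp_exp (1 / 2) 0
    have i1 := jetExp_inv 0 0
    have i2 := jetExp_inv 1 0
    have hm := jetExp_const (m : ℝ)
    have h1 := jetExp_const 1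
    have h2 := jetExp_const 2
    have hu := jetExp_id
    refine (((((hm.mul (e1.add h1)).mul (hu.sub h1)).add (h2.mul (((h2.mul e1).add hu).add h1))).mul
      (((jetExp_const (m : ℝ)⁻¹).mul (i1.pow 3)).mul i2))).congr fun u s t => ?_
    simp only [Ftot, ← Real.exp_half, one_mul, zero_mul, add_zero, Real.exp_zero, div_eq_mul_inv,
      mul_inv, inv_pow, mul_comm s]
  exact h.2 _

theorem isExp_HDelta (m : ℕ) : IsExp fun s t => HDelta m (Real.exp s) (Real.exp t) := by
  have h : JetExp fun u s t => Gtot m u (Real.exp s) (Real.exp t) := by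
    have x := jetExp_exp (1 / 2) 0
    have y := jetExp_exp 0 (1 / 2)
    have s := jetExp_exp 1 0
    have i1 := jetExp_inv 0 0
    have i2 := jetExp_inv 1 0
    have i3 := jetExp_inv 1 1
    have hm := jetExp_const (m : ℝ)
    have h1 := jetExp_const 1
    have h2 := jetExp_const 2
    have h3 := jetExp_const 3
    have h4 := jetExp_const 4
    have h6 := jetExp_const 6
    have h10 := jetExp_const 10
    have u := jetExp_id
    have n1 := (x.pow 3).mul ((hm.mul ((((h2.mul x).add h1).mul y).add h2)).sub
      (h4.mul ((((h2.mul x).add h1).mul y).add h1)))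
    have n2 := (u.pow 2).mul (((h2.mul ((s.add (h2.mul x)).add h3)).mul ((x.mul y).add h1)).sub
      (hm.mul (((((x.pow 3).mul y).sub ((h2.mul s).mul (y.sub h1))).sub (h2.mul x)).add h2)))
    have n3 := (u.mul x).mul ((((s.mul ((h6.mul y).add h4)).add (x.mul (h10.sub (h4.mul y)))).sub
      (h2.mul (y.add h1))).add (hm.mul ((((((h2.mul (x.pow 3)).mul y).add
        ((h2.mul x).mul (y.sub h1))).add (h2.mul s)).add y).add h2)))
    have n4 := (u.pow 3).mul (((((hm.mul x).mul y).add (h2.mul hm)).add (h2.mul x)).add h2)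
    refine ((((n1.add n2).sub n3).add n4).mul ((((jetExp_const (m : ℝ)⁻¹).mul (i1.pow 3)).mul
      (i2.pow 2)).mul i3)).congr fun u s t => ?_
    simp only [Gtot, ← Real.exp_half, one_mul, zero_mul, add_zero, zero_add, Real.exp_zero,
      div_eq_mul_inv, mul_inv, inv_pow, mul_comm s, mul_comm t, Real.exp_add]
  exact h.2 _

theorem isExp_g₂ : IsExp g₂ :=
  (isExp_f₁.dslope.subst 0 1 1 0).congr fun s t => by simp [g₂, add_comm]

theorem isExp_KD (m : ℕ) : IsExp fun s _ => KD m s :=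
  (((isExp_exp (1 / 4) 0).mul (isExp_KDelta m)).mul (isExp_f₁.subst (1 / 2) 0 0 0)).congr
    fun s t => by
      simp only [KD]
      ring_nf

theorem isExp_HD (m : ℕ) : IsExp (HD m) := by
  have h1 := (((isExp_exp (1 / 2) 0).mul (isExp_HDelta m)).mul (isExp_f₁.subst (1 / 2) 0 0 0)).mul
    (isExp_f₁.subst 0 (1 / 2) 0 0)
  have h2 := ((isExp_g₂.subst (1 / 2) 0 0 (1 / 2)).const_mul 2).mul ((isExp_KDelta m).subst 1 1 0 0)
  refine (((isExp_exp (1 / 4) 0).mul (isExp_exp 0 (1 / 4))).mul (h1.add h2)).congr fun s t => ?_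
  simp only [HD]
  ring_nf

theorem isExp_T (m : ℕ) : IsExp fun s _ => T m s :=
  (((isExp_f₁.subst (-j₀ m) 0 0 0).const_mul (2 * j₀ m * KD m 0)).add
    ((isExp_HD m).subst 1 0 (-1) 0)).congr fun s t => by
      simp only [T]
      ring_nf

theorem IsExp.tilde {W : ℝ → ℝ} (hW : IsExp fun s _ => W s) (j : ℝ) :
    IsExp fun s _ => W (-s) * Real.exp (-j * s) :=
  ((hW.subst (-1) 0 0 0).mul (isExp_exp (-j) 0)).congr fun s t => by ring_nf

theorem isExp_Ttilde (m : ℕ) : IsExp fun s _ => Ttilde m s := (isExp_T m).tilde (j₀ m)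

theorem isExp_leftSymbol {W : ℝ → ℝ} (hW : IsExp fun s _ => W s) (j : ℝ) :
    IsExp (leftSymbol j W) :=
  ((((isExp_f₁.subst (-j) 0 0 0).mul (hW.subst 0 1 0 0)).const_mul (-2 * j)).add
    (hW.dslope.const_mul (-2))).congr fun s t => by
      simp only [leftSymbol]
      ring_nf

theorem isExp_rightSymbol {W : ℝ → ℝ} (hW : IsExp fun s _ => W s) : IsExp (rightSymbol W) :=
  ((hW.dslope.subst 0 1 1 0).const_mul 2).congr fun s t => by
    simp only [rightSymbol]
    ring_nf

/-- The functions `P` and `Q` are the sum of the two difference quotients which appear in the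
derivative of `T(∇̸)` and of `T̃(∇̸)`. -/
theorem PQ_eq_add (m : ℕ) (W : ℝ → ℝ) (s t : ℝ) :
    PQ m W s t = leftSymbol (j₀ m) W s t + rightSymbol W s t := by
  simp only [PQ, leftSymbol, rightSymbol]

theorem isExp_PQ (m : ℕ) {W : ℝ → ℝ} (hW : IsExp fun s _ => W s) : IsExp (PQ m W) :=
  ((isExp_leftSymbol hW (j₀ m)).add (isExp_rightSymbol hW)).congr (PQ_eq_add m W)

theorem dslope_comm (W : ℝ → ℝ) (a b : ℝ) : dslope W a b = dslope W b a := by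
  rcases eq_or_ne a b with rfl | h
  · rfl
  · rw [dslope_of_ne _ h.symm, dslope_of_ne _ h, slope_comm]

theorem exp_neg_mul_f₁ (x : ℝ) : Real.exp (-x) * f₁ x = f₁ (-x) := by
  rcases eq_or_ne x 0 with rfl | hx
  · simp
  · refine mul_left_cancel₀ hx ?_
    have h1 := mul_f₁ x
    have h2 := mul_f₁ (-x)
    have h3 : Real.exp (-x) * Real.exp x = 1 := by rw [← Real.exp_add]; simp
    linear_combination Real.exp (-x) * h1 + h2 + h3

/-- The symbol of the left slot after rotation of the trace. -/
def rotLeft (j : ℝ) (H : ℝ → ℝ → ℝ) (s t : ℝ) : ℝ := Real.exp (-j * (s + t)) * H (-(s + t)) s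

/-- The symbol of the right slot after rotation of the trace. -/
def rotRight (j : ℝ) (H : ℝ → ℝ → ℝ) (s t : ℝ) : ℝ := Real.exp (-j * s) * H t (-(s + t))

theorem IsExp.rotLeft {H : ℝ → ℝ → ℝ} (hH : IsExp H) (j : ℝ) : IsExp (rotLeft j H) :=
  ((isExp_exp (-j) (-j)).mul (hH.subst (-1) (-1) 1 0)).congr fun s t => by
    simp only [ConnesLandi.rotLeft]
    ring_nf

theorem IsExp.rotRight {H : ℝ → ℝ → ℝ} (hH : IsExp H) (j : ℝ) : IsExp (rotRight j H) :=
  ((isExp_exp (-j) 0).mul (hH.subst 0 1 (-1) (-1))).congr fun s t => by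
    simp only [ConnesLandi.rotRight]
    ring_nf

/-- The functions `L` and `M` together are the contribution of the derivative of `T(∇̸)`, its two
difference quotients having been rotated under the trace. -/
theorem Lfun_add_Mfun (m : ℕ) (s t : ℝ) : Lfun m s t + Mfun m s t =
    rotLeft (j₀ m) (leftSymbol (j₀ m) (T m)) s t + rotRight (j₀ m) (rightSymbol (T m)) s t := by
  have h1 := exp_neg_mul_f₁ (j₀ m * (s + t))
  have h2 : Real.exp (-j₀ m * (s + t)) * Real.exp (j₀ m * t) = Real.exp (-j₀ m * s) := by
    rw [← Real.exp_add]
    ring_nf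
  simp only [Lfun, Mfun, rotLeft, rotRight, leftSymbol, rightSymbol]
  rw [show -(s + t) + s = -t by ring, show t + -(s + t) = -s by ring, dslope_comm (T m) s (-t),
    dslope_comm (T m) t (-s), show -j₀ m * -(s + t) = j₀ m * (s + t) by ring, ← h2]
  rw [← neg_mul] at h1
  linear_combination (2 * j₀ m * T m s) * h1

theorem HEH_eq (m : ℕ) (s t : ℝ) : HEH m s t =
    rotLeft (j₀ m) (leftSymbol (j₀ m) (T m)) s t + rotRight (j₀ m) (rightSymbol (T m)) s t
      - (PQ m (T m) s t + PQ m (Ttilde m) s t) := by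
  rw [← Lfun_add_Mfun, HEH, Pfun, Qfun]
  ring

theorem isExp_KEH (m : ℕ) : IsExp fun s _ => KEH m s :=
  (((isExp_T m).add (isExp_Ttilde m)).const_mul (-1)).congr fun s t => by
    simp only [KEH]
    ring

theorem isExp_HEH (m : ℕ) : IsExp (HEH m) :=
  ((((isExp_leftSymbol (isExp_T m) (j₀ m)).rotLeft (j₀ m)).add
    ((isExp_rightSymbol (isExp_T m)).rotRight (j₀ m))).sub
      ((isExp_PQ m (isExp_T m)).add (isExp_PQ m (isExp_Ttilde m)))).congr (HEH_eq m)

end CurvatureFunctions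

/-! ### Bilinear forms and their contractions -/

section LocalGeometry

variable {m : ℕ} {V : Type*} [NormedAddCommGroup V] [NormedSpace ℝ V]

theorem e_apply (i j : Fin m) : (e i : Eu m) j = if j = i then 1 else 0 := by
  simp [e]

theorem sum_smul_e (u : Eu m) : ∑ i, u i • e i = u := by
  ext j; simp [e_apply]

theorem clm_ext_e {f f' : Eu m →L[ℝ] V} (h : ∀ i, f (e i) = f' (e i)) : f = f' := by
  ext u
  rw [← sum_smul_e u]
  simp [h]

theorem clm_ext_e₂ {f f' : Eu m →L[ℝ] Eu m →L[ℝ] V}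
    (h : ∀ i j, f (e i) (e j) = f' (e i) (e j)) : f = f' :=
  clm_ext_e fun i => clm_ext_e fun j => h i j

theorem trace_eq_sum_e (L : Eu m →ₗ[ℝ] Eu m) : LinearMap.trace ℝ (Eu m) L = ∑ i, L (e i) i := by
  rw [LinearMap.trace_eq_matrix_trace ℝ (EuclideanSpace.basisFun (Fin m) ℝ).toBasis,
    Matrix.trace]
  refine Finset.sum_congr rfl fun i _ => ?_
  simp [LinearMap.toMatrix_apply, e]

/-- The Gram matrix of a bilinear form in the standard basis. -/
def gram (b : Eu m →L[ℝ] Eu m →L[ℝ] ℝ) : Matrix (Fin m) (Fin m) ℝ :=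
  Matrix.of fun i j => b (e i) (e j)

/-- The contraction `∑ G⁻¹ᵢⱼ b(eᵢ, eⱼ)` of a bilinear map with the inverse of a matrix. -/
def gcontr (G : Matrix (Fin m) (Fin m) ℝ) (b : Eu m →L[ℝ] Eu m →L[ℝ] V) : V :=
  ∑ i, ∑ j, G⁻¹ i j • b (e i) (e j)

theorem gcontr_comp {W : Type*} [NormedAddCommGroup W] [NormedSpace ℝ W] (L : V →L[ℝ] W)
    (G : Matrix (Fin m) (Fin m) ℝ) (b : Eu m →L[ℝ] Eu m →L[ℝ] V)
    (b' : Eu m →L[ℝ] Eu m →L[ℝ] W) (h : ∀ u v, b' u v = L (b u v)) :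
    gcontr G b' = L (gcontr G b) := by
  simp [gcontr, map_sum, h]

theorem gcontr_add (G : Matrix (Fin m) (Fin m) ℝ) (b b' : Eu m →L[ℝ] Eu m →L[ℝ] V) :
    gcontr G (b + b') = gcontr G b + gcontr G b' := by
  simp [gcontr, Finset.sum_add_distrib]

/-- The matrix of an endomorphism in the standard basis. -/
def matE (J : Eu m →L[ℝ] Eu m) : Matrix (Fin m) (Fin m) ℝ := Matrix.of fun i j => J (e j) i

theorem apply_e (J : Eu m →L[ℝ] Eu m) (j : Fin m) : J (e j) = ∑ i, matE J i j • e i :=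
  (sum_smul_e _).symm

theorem det_matE (J : Eu m →L[ℝ] Eu m) : (matE J).det = J.det := by
  rw [ContinuousLinearMap.det, ← LinearMap.det_toMatrix (EuclideanSpace.basisFun (Fin m) ℝ).toBasis]
  congr 1

theorem gram_pullback {b b' : Eu m →L[ℝ] Eu m →L[ℝ] ℝ} {J : Eu m →L[ℝ] Eu m}
    (h : ∀ u v, b u v = b' (J u) (J v)) : gram b = (matE J).transpose * gram b' * matE J := by
  ext i j
  simp only [gram, Matrix.of_apply, h, apply_e J, map_sum, map_smul, sum_apply,
    smul_apply, smul_eq_mul, Matrix.mul_apply, Matrix.transpose_apply,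
    Finset.sum_mul, Finset.mul_sum]
  refine Finset.sum_congr rfl fun a _ => Finset.sum_congr rfl fun c _ => by ring

theorem sum_reverse₄ {ι X : Type*} [Fintype ι] [AddCommMonoid X] (F : ι → ι → ι → ι → X) :
    ∑ i, ∑ j, ∑ b, ∑ a, F i j b a = ∑ a, ∑ b, ∑ j, ∑ i, F i j b a := by
  have h3 : ∀ f : ι → ι → ι → X, ∑ i, ∑ j, ∑ b, f i j b = ∑ b, ∑ j, ∑ i, f i j b := fun f => by
    rw [Finset.sum_comm, Finset.sum_congr rfl fun j _ =>
      Finset.sum_comm (f := fun i b => f i j b), Finset.sum_comm]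
  calc _ = ∑ i, ∑ a, ∑ b, ∑ j, F i j b a := Finset.sum_congr rfl fun i _ => h3 _
    _ = ∑ a, ∑ i, ∑ b, ∑ j, F i j b a := Finset.sum_comm
    _ = ∑ a, ∑ b, ∑ i, ∑ j, F i j b a := Finset.sum_congr rfl fun a _ => Finset.sum_comm
    _ = _ := Finset.sum_congr rfl fun a _ => Finset.sum_congr rfl fun b _ => Finset.sum_comm

/-- The contraction of a bilinear map with the inverse metric does not depend on coordinates. -/
theorem gcontr_pullback {b₀ b₁ : Eu m →L[ℝ] Eu m →L[ℝ] ℝ} {J : Eu m →L[ℝ] Eu m}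
    (hJ : Function.Injective J) (h : ∀ u v, b₀ u v = b₁ (J u) (J v))
    {b b' : Eu m →L[ℝ] Eu m →L[ℝ] V} (hb : ∀ u v, b u v = b' (J u) (J v)) :
    gcontr (gram b₀) b = gcontr (gram b₁) b' := by
  have hu : IsUnit (matE J).det := by
    rw [det_matE, ContinuousLinearMap.det]
    exact (LinearMap.isUnit_iff_ker_eq_bot (J : Eu m →ₗ[ℝ] Eu m)).2
      (LinearMap.ker_eq_bot.2 hJ) |>.map LinearMap.det
  have hu' : IsUnit (matE J).transpose.det := by rwa [Matrix.det_transpose]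
  have h1 : (gram b₁)⁻¹ = matE J * (gram b₀)⁻¹ * (matE J).transpose := by
    rw [gram_pullback h, Matrix.mul_inv_rev, Matrix.mul_inv_rev, ← mul_assoc, ← mul_assoc,
      Matrix.mul_nonsing_inv _ hu, one_mul, mul_assoc, Matrix.nonsing_inv_mul _ hu', mul_one]
  unfold gcontr
  simp only [h1, hb, apply_e J, map_sum, map_smul, sum_apply,
    smul_apply, Matrix.mul_apply, Matrix.transpose_apply, Finset.sum_mul,
    Finset.smul_sum, Finset.sum_smul, smul_smul]
  rw [sum_reverse₄]
  refine Finset.sum_congr rfl fun a _ => Finset.sum_congr rfl fun b _ =>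
    Finset.sum_congr rfl fun j _ => Finset.sum_congr rfl fun i _ => ?_
  ring_nf

/-! ### Christoffel symbols and curvature in coordinates -/

/-- A Riemannian metric on an open subset of `ℝᵐ`. -/
structure IsMetricOn (g : Eu m → Eu m →L[ℝ] Eu m →L[ℝ] ℝ) (U : Set (Eu m)) : Prop where
  isOpen : IsOpen U
  smooth : ContDiffOn ℝ ∞ g U
  symm : ∀ y ∈ U, ∀ u v, g y u v = g y v u
  pos : ∀ y ∈ U, ∀ u, u ≠ 0 → 0 < g y u u

variable {g g' : Eu m → Eu m →L[ℝ] Eu m →L[ℝ] ℝ} {U U' : Set (Eu m)}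

theorem posDef_gram {b : Eu m →L[ℝ] Eu m →L[ℝ] ℝ} (hs : ∀ u v, b u v = b v u)
    (hp : ∀ u, u ≠ 0 → 0 < b u u) : (gram b).PosDef := by
  refine Matrix.PosDef.of_dotProduct_mulVec_pos ?_ fun x hx => ?_
  · ext i j
    simp [gram, hs]
  · have h0 : (WithLp.toLp 2 x : Eu m) ≠ 0 := fun h => hx (by
      funext i
      exact congrArg (fun z : Eu m => z i) h)
    have := hp _ h0
    rw [← sum_smul_e (WithLp.toLp 2 x)] at this
    simp only [map_sum, map_smul, sum_apply, smul_apply, smul_eq_mul] at this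
    refine this.trans_eq (Finset.sum_congr rfl fun i _ => ?_)
    simp only [Matrix.mulVec, dotProduct, gram, Matrix.of_apply, star_trivial, Pi.star_apply]
    exact congrArg _ (Finset.sum_congr rfl fun j _ => by rw [hs, mul_comm])

theorem IsMetricOn.posDef (h : IsMetricOn g U) {y : Eu m} (hy : y ∈ U) : (gram (g y)).PosDef :=
  posDef_gram (h.symm y hy) (h.pos y hy)

theorem IsMetricOn.isUnit_det (h : IsMetricOn g U) {y : Eu m} (hy : y ∈ U) :
    IsUnit (gram (g y)).det := (h.posDef hy).det_pos.ne'.isUnit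

theorem contDiffOn_det {ι : Type*} [Fintype ι] [DecidableEq ι] {E : Type*} [NormedAddCommGroup E] [NormedSpace ℝ E] {A : E → Matrix ι ι ℝ}
    {s : Set E} {k : WithTop ℕ∞} (h : ∀ i j, ContDiffOn ℝ k (fun y => A y i j) s) :
    ContDiffOn ℝ k (fun y => (A y).det) s := by
  simp only [Matrix.det_apply]
  exact ContDiffOn.sum fun σ _ => (contDiffOn_prod fun i _ => h _ _).const_smul _

theorem contDiffOn_inv_matrix {E : Type*} [NormedAddCommGroup E] [NormedSpace ℝ E] {A : E → Matrix (Fin m) (Fin m) ℝ}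
    {s : Set E} {k : WithTop ℕ∞} (h : ∀ i j, ContDiffOn ℝ k (fun y => A y i j) s)
    (h0 : ∀ y ∈ s, IsUnit (A y).det) (i j : Fin m) :
    ContDiffOn ℝ k (fun y => (A y)⁻¹ i j) s := by
  simp only [Matrix.inv_def, Matrix.smul_apply, Matrix.adjugate_apply, Ring.inverse_eq_inv',
    smul_eq_mul]
  refine ((contDiffOn_det h).inv fun y hy => (h0 y hy).ne_zero).mul (contDiffOn_det fun a b => ?_)
  by_cases ha : a = j
  · subst ha
    simpa using contDiffOn_const
  · simpa [Matrix.updateRow_ne ha] using h a b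

theorem IsMetricOn.contDiffOn_gram (h : IsMetricOn g U) (i j : Fin m) :
    ContDiffOn ℝ ∞ (fun y => gram (g y) i j) U :=
  (h.smooth.clm_apply contDiffOn_const).clm_apply contDiffOn_const

theorem IsMetricOn.contDiffOn_gram_inv (h : IsMetricOn g U) (i j : Fin m) :
    ContDiffOn ℝ ∞ (fun y => (gram (g y))⁻¹ i j) U :=
  contDiffOn_inv_matrix h.contDiffOn_gram (fun _ hy => h.isUnit_det hy) i j

/-- The Christoffel symbol `Γᵏᵢⱼ` of a matrix valued function. -/
def chr (G : Eu m → Matrix (Fin m) (Fin m) ℝ) (k i j : Fin m) (y : Eu m) : ℝ :=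
  1 / 2 * ∑ l, (G y)⁻¹ k l * (fderiv ℝ (fun z => G z j l) y (e i)
    + fderiv ℝ (fun z => G z i l) y (e j) - fderiv ℝ (fun z => G z i j) y (e l))

theorem IsMetricOn.contDiffOn_chr (h : IsMetricOn g U) (k i j : Fin m) :
    ContDiffOn ℝ ∞ (chr (fun y => gram (g y)) k i j) U := by
  have h1 : ∀ a b c, ContDiffOn ℝ ∞ (fun y => fderiv ℝ (fun z => gram (g z) a b) y (e c)) U :=
    fun a b c => ((h.contDiffOn_gram a b).fderiv_of_isOpen h.isOpen (by norm_cast)).clm_apply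
      contDiffOn_const
  exact contDiffOn_const.mul (ContDiffOn.sum fun l _ => (h.contDiffOn_gram_inv k l).mul
    (((h1 _ _ _).add (h1 _ _ _)).sub (h1 _ _ _)))

/-- The coordinate covector `dxⁱ`. -/
def cov (i : Fin m) : Eu m →L[ℝ] ℝ := EuclideanSpace.proj i

theorem cov_apply (i : Fin m) (u : Eu m) : cov i u = u i := rfl

/-- The Christoffel symbols as a vector valued bilinear map. -/
def christ (G : Eu m → Matrix (Fin m) (Fin m) ℝ) (y : Eu m) : Eu m →L[ℝ] Eu m →L[ℝ] Eu m :=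
  ∑ k, ∑ i, ∑ j, chr G k i j y • (cov i).smulRight ((cov j).smulRight (e k))

theorem christ_e (G : Eu m → Matrix (Fin m) (Fin m) ℝ) (y : Eu m) (i j : Fin m) :
    christ G y (e i) (e j) = ∑ k, chr G k i j y • e k := by
  simp [christ, cov_apply, e_apply, sum_apply]

theorem christ_apply (G : Eu m → Matrix (Fin m) (Fin m) ℝ) (y : Eu m) (i j k : Fin m) :
    christ G y (e i) (e j) k = chr G k i j y := by
  simp [christ_e, e_apply]

theorem IsMetricOn.contDiffOn_christ (h : IsMetricOn g U) :
    ContDiffOn ℝ ∞ (christ fun y => gram (g y)) U := by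
  unfold christ
  exact ContDiffOn.sum fun k _ => ContDiffOn.sum fun i _ => ContDiffOn.sum fun j _ =>
    (h.contDiffOn_chr k i j).smul
      (contDiffOn_const (c := (cov i).smulRight ((cov j).smulRight (e k : Eu m))))

theorem IsMetricOn.fderiv_gram (h : IsMetricOn g U) {y : Eu m} (hy : y ∈ U) (i j : Fin m)
    (u : Eu m) : fderiv ℝ (fun z => gram (g z) i j) y u = fderiv ℝ g y u (e i) (e j) := by
  have h1 : HasFDerivAt g (fderiv ℝ g y) y :=
    ((h.smooth.contDiffAt (h.isOpen.mem_nhds hy)).differentiableAt (by simp)).hasFDerivAt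
  have h2 := (h1.clm_apply (hasFDerivAt_const (e i) y)).clm_apply (hasFDerivAt_const (e j) y)
  rw [show (fun z => gram (g z) i j) = fun z => g z (e i) (e j) from rfl, h2.fderiv]
  simp

/-- The Koszul formula. -/
theorem IsMetricOn.koszul (h : IsMetricOn g U) {y : Eu m} (hy : y ∈ U) (u v w : Eu m) :
    2 * g y (christ (fun y => gram (g y)) y u v) w
      = fderiv ℝ g y u v w + fderiv ℝ g y v u w - fderiv ℝ g y w u v := by
  set D := fderiv ℝ g y with hD
  set Γ := christ (fun y => gram (g y)) y with hΓ
  have key : (2 : ℝ) • (ContinuousLinearMap.compL ℝ (Eu m) (Eu m) (Eu m →L[ℝ] ℝ) (g y)).comp Γ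
      = D + D.flip - (ContinuousLinearMap.flipₗᵢ ℝ (Eu m) (Eu m)
          ℝ).toContinuousLinearEquiv.toContinuousLinearMap.comp D.flip := by
    refine clm_ext_e₂ fun i j => clm_ext_e fun l => ?_
    have hsum : ∑ k, gram (g y) l k * (∑ l', (gram (g y))⁻¹ k l' *
        (D (e i) (e j) (e l') + D (e j) (e i) (e l') - D (e l') (e i) (e j)))
        = D (e i) (e j) (e l) + D (e j) (e i) (e l) - D (e l) (e i) (e j) := by
      have := congrFun (Matrix.mulVec_mulVec (fun l' => D (e i) (e j) (e l') + D (e j) (e i) (e l')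
        - D (e l') (e i) (e j)) (gram (g y)) (gram (g y))⁻¹) l
      rw [Matrix.mul_nonsing_inv _ (h.isUnit_det hy), Matrix.one_mulVec] at this
      exact this
    simp only [smul_apply, add_apply, sub_apply, ContinuousLinearMap.comp_apply,
      ContinuousLinearMap.compL_apply, ContinuousLinearMap.flip_apply]
    rw [hΓ, christ_e, map_sum]
    simp only [map_smul, sum_apply, smul_apply, smul_eq_mul, chr, h.fderiv_gram hy]
    rw [Finset.mul_sum]
    refine Eq.trans (Finset.sum_congr rfl fun k _ => ?_) hsum
    rw [show gram (g y) l k = g y (e k) (e l) from h.symm y hy _ _]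
    ring
  have := congrArg (fun T => T u v w) key
  simpa using this

end LocalGeometry

/-! ### Behaviour of curvature and Hessian under isometries -/

section LocalGeometry

variable {m : ℕ} {V : Type*} [NormedAddCommGroup V] [NormedSpace ℝ V]
variable {g g' : Eu m → Eu m →L[ℝ] Eu m →L[ℝ] ℝ} {U U' : Set (Eu m)}

theorem two_le_infty : (2 : WithTop ℕ∞) ≤ ∞ := WithTop.coe_le_coe.2 (le_top : (2 : ℕ∞) ≤ ⊤)

/-- `Φ` is a smooth map which pulls the metric `g'` back to `g`. -/
structure IsIsometryOn (g g' : Eu m → Eu m →L[ℝ] Eu m →L[ℝ] ℝ) (U U' : Set (Eu m))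
    (Φ : Eu m → Eu m) : Prop where
  source : IsMetricOn g U
  target : IsMetricOn g' U'
  mapsTo : Set.MapsTo Φ U U'
  smooth : ContDiffOn ℝ ∞ Φ U
  pullback : ∀ y ∈ U, ∀ u v, g y u v = g' (Φ y) (fderiv ℝ Φ y u) (fderiv ℝ Φ y v)

/-- The Christoffel symbols of a metric, as a bilinear map. -/
def Gam (g : Eu m → Eu m →L[ℝ] Eu m →L[ℝ] ℝ) : Eu m → Eu m →L[ℝ] Eu m →L[ℝ] Eu m :=
  christ fun y => gram (g y)

namespace IsIsometryOn

variable {Φ : Eu m → Eu m} (h : IsIsometryOn g g' U U' Φ) {y : Eu m} (hy : y ∈ U)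
include h hy

theorem injective : Function.Injective (fderiv ℝ Φ y) := by
  refine (injective_iff_map_eq_zero _).2 fun u hu => ?_
  by_contra h0
  have := h.source.pos y hy u h0
  rw [h.pullback y hy, hu] at this
  simp at this

theorem contDiffAt : ContDiffAt ℝ ∞ Φ y := h.smooth.contDiffAt (h.source.isOpen.mem_nhds hy)

theorem hasFDerivAt : HasFDerivAt Φ (fderiv ℝ Φ y) y :=
  ((h.contDiffAt hy).differentiableAt (by simp)).hasFDerivAt

theorem hasFDerivAt_fderiv : HasFDerivAt (fderiv ℝ Φ) (fderiv ℝ (fderiv ℝ Φ) y) y :=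
  (((h.contDiffAt hy).fderiv_right (m := ∞) (by norm_cast)).differentiableAt
    (by simp)).hasFDerivAt

theorem fderiv_fderiv_symm (u v : Eu m) :
    fderiv ℝ (fderiv ℝ Φ) y u v = fderiv ℝ (fderiv ℝ Φ) y v u :=
  ((h.contDiffAt hy).isSymmSndFDerivAt (by simpa using two_le_infty)) u v

theorem fderiv_metric (u v w : Eu m) : fderiv ℝ g y u v w
    = fderiv ℝ g' (Φ y) (fderiv ℝ Φ y u) (fderiv ℝ Φ y v) (fderiv ℝ Φ y w)
      + g' (Φ y) (fderiv ℝ (fderiv ℝ Φ) y u v) (fderiv ℝ Φ y w)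
      + g' (Φ y) (fderiv ℝ Φ y v) (fderiv ℝ (fderiv ℝ Φ) y u w) := by
  have hg : HasFDerivAt g (fderiv ℝ g y) y := ((h.source.smooth.contDiffAt
    (h.source.isOpen.mem_nhds hy)).differentiableAt (by simp)).hasFDerivAt
  have hg' : HasFDerivAt g' (fderiv ℝ g' (Φ y)) (Φ y) := ((h.target.smooth.contDiffAt
    (h.target.isOpen.mem_nhds (h.mapsTo hy))).differentiableAt (by simp)).hasFDerivAt
  have h1 := (hg.clm_apply (hasFDerivAt_const v y)).clm_apply (hasFDerivAt_const w y)
  have h2 := ((hg'.comp y (h.hasFDerivAt hy)).clm_apply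
    ((h.hasFDerivAt_fderiv hy).clm_apply (hasFDerivAt_const v y))).clm_apply
    ((h.hasFDerivAt_fderiv hy).clm_apply (hasFDerivAt_const w y))
  have h3 := h1.congr_of_eventuallyEq (f₁ := fun z => g' (Φ z) (fderiv ℝ Φ z v) (fderiv ℝ Φ z w))
    (by filter_upwards [h.source.isOpen.mem_nhds hy] with z hz using (h.pullback z hz v w).symm)
  have := congrArg (fun T : Eu m →L[ℝ] ℝ => T u) (h3.unique h2)
  simp at this
  linarith

/-- The transformation law of the Christoffel symbols. -/
theorem map_Gam (u v : Eu m) : fderiv ℝ Φ y (Gam g y u v)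
    = Gam g' (Φ y) (fderiv ℝ Φ y u) (fderiv ℝ Φ y v) + fderiv ℝ (fderiv ℝ Φ) y u v := by
  set J := fderiv ℝ Φ y
  have hy' := h.mapsTo hy
  have hsurj : Function.Surjective J :=
    (LinearMap.injective_iff_surjective (f := (J : Eu m →ₗ[ℝ] Eu m))).1 (h.injective hy)
  set d := J (Gam g y u v)
    - (Gam g' (Φ y) (J u) (J v) + fderiv ℝ (fderiv ℝ Φ) y u v) with hd
  have key : ∀ w, g' (Φ y) d (J w) = 0 := fun w => by
    have k1 := h.source.koszul hy u v w
    have k2 := h.target.koszul hy' (J u) (J v) (J w)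
    rw [h.fderiv_metric hy, h.fderiv_metric hy, h.fderiv_metric hy, h.pullback y hy] at k1
    rw [h.fderiv_fderiv_symm hy v u, h.fderiv_fderiv_symm hy w u, h.fderiv_fderiv_symm hy w v,
      h.target.symm _ hy' (J v) (fderiv ℝ (fderiv ℝ Φ) y u w),
      h.target.symm _ hy' (J u) (fderiv ℝ (fderiv ℝ Φ) y v w)] at k1
    simp only [hd, map_sub, map_add, sub_apply, add_apply, Gam]
    linarith
  by_contra hne
  have h0 : d ≠ 0 := sub_ne_zero.2 hne
  obtain ⟨w, hw⟩ := hsurj d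
  exact (h.target.pos _ hy' d h0).ne' (by simpa only [hw] using key w)

end IsIsometryOn

/-- The curvature endomorphism
`R(u,v)w = (∂ᵤΓ)(v,w) - (∂ᵥΓ)(u,w) + Γ(u,Γ(v,w)) - Γ(v,Γ(u,w))`. -/
def curv (Γ : Eu m → Eu m →L[ℝ] Eu m →L[ℝ] Eu m) (y : Eu m) :
    Eu m →L[ℝ] Eu m →L[ℝ] Eu m →L[ℝ] Eu m :=
  fderiv ℝ Γ y - (fderiv ℝ Γ y).flip
    + ((ContinuousLinearMap.compL ℝ (Eu m) (Eu m) (Eu m)).bilinearComp (Γ y) (Γ y)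
      - ((ContinuousLinearMap.compL ℝ (Eu m) (Eu m) (Eu m)).bilinearComp (Γ y) (Γ y)).flip)

theorem curv_apply (Γ : Eu m → Eu m →L[ℝ] Eu m →L[ℝ] Eu m) (y u v w : Eu m) :
    curv Γ y u v w = fderiv ℝ Γ y u v w - fderiv ℝ Γ y v u w
      + (Γ y u (Γ y v w) - Γ y v (Γ y u w)) := by
  simp [curv]

/-- The Ricci form `(v, w) ↦ tr (u ↦ R(u,v)w)`. -/
def ric (Γ : Eu m → Eu m →L[ℝ] Eu m →L[ℝ] Eu m) (y : Eu m) : Eu m →L[ℝ] Eu m →L[ℝ] ℝ :=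
  ∑ i, (ContinuousLinearMap.compL ℝ (Eu m) (Eu m) ℝ (cov i)).comp (curv Γ y (e i))

theorem ric_eq_trace (Γ : Eu m → Eu m →L[ℝ] Eu m →L[ℝ] Eu m) (y v w : Eu m) :
    ric Γ y v w = LinearMap.trace ℝ (Eu m) (((curv Γ y).flip v).flip w : Eu m →L[ℝ] Eu m) := by
  rw [trace_eq_sum_e]
  simp [ric, cov_apply, sum_apply]

theorem IsMetricOn.contDiffOn_Gam (h : IsMetricOn g U) : ContDiffOn ℝ ∞ (Gam g) U :=
  h.contDiffOn_christ

theorem IsMetricOn.hasFDerivAt_Gam (h : IsMetricOn g U) {y : Eu m} (hy : y ∈ U) :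
    HasFDerivAt (Gam g) (fderiv ℝ (Gam g) y) y :=
  ((h.contDiffOn_Gam.contDiffAt (h.isOpen.mem_nhds hy)).differentiableAt (by simp)).hasFDerivAt

theorem IsMetricOn.contDiffOn_ric (h : IsMetricOn g U) : ContDiffOn ℝ ∞ (ric (Gam g)) U := by
  have h1 := h.contDiffOn_Gam
  have h2 : ContDiffOn ℝ ∞ (fderiv ℝ (Gam g)) U := h1.fderiv_of_isOpen h.isOpen (by norm_cast)
  have h3 : ContDiffOn ℝ ∞ (curv (Gam g)) U := by
    have h4 : ContDiffOn ℝ ∞ (fun y => (ContinuousLinearMap.compL ℝ (Eu m) (Eu m)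
      (Eu m)).bilinearComp (Gam g y) (Gam g y)) U := by
      have hf := fun {X : Type} [NormedAddCommGroup X] [NormedSpace ℝ X] =>
        (ContinuousLinearMap.flipₗᵢ ℝ (Eu m) X (Eu m →L[ℝ] Eu m)).contDiff (n := ∞)
      have h5 := hf.comp_contDiffOn ((contDiffOn_const
        (c := ContinuousLinearMap.compL ℝ (Eu m) (Eu m) (Eu m))).clm_comp h1)
      exact (ContinuousLinearMap.flipₗᵢ ℝ (Eu m) (Eu m) (Eu m →L[ℝ] Eu m)).contDiff.comp_contDiffOn
        (h5.clm_comp h1)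
    have hf := (ContinuousLinearMap.flipₗᵢ ℝ (Eu m) (Eu m) (Eu m →L[ℝ] Eu m)).contDiff (n := ∞)
    exact (h2.sub (hf.comp_contDiffOn h2)).add (h4.sub (hf.comp_contDiffOn h4))
  unfold ric
  exact ContDiffOn.sum fun i _ => contDiffOn_const.clm_comp (h3.clm_apply contDiffOn_const)

namespace IsIsometryOn

variable {Φ : Eu m → Eu m} (h : IsIsometryOn g g' U U' Φ) {y : Eu m} (hy : y ∈ U)
include h hy

/-- The curvature endomorphism is a tensor: the transformation law of the Christoffel symbols is
differentiated, and the second and third derivatives of `Φ` cancel by symmetry. -/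
theorem map_curv (u v w : Eu m) : fderiv ℝ Φ y (curv (Gam g) y u v w)
    = curv (Gam g') (Φ y) (fderiv ℝ Φ y u) (fderiv ℝ Φ y v) (fderiv ℝ Φ y w) := by
  set J := fderiv ℝ Φ y with hJ
  set D2 := fderiv ℝ (fderiv ℝ Φ) with hD2
  have hy' := h.mapsTo hy
  have hΦ2 := h.hasFDerivAt_fderiv hy
  have hΦ3 : HasFDerivAt D2 (fderiv ℝ D2 y) y :=
    ((((h.contDiffAt hy).fderiv_right (m := ∞) (by norm_cast)).fderiv_right (m := ∞)
      (by norm_cast)).differentiableAt (by simp)).hasFDerivAt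
  have hG := h.source.hasFDerivAt_Gam hy
  have hG' := (h.target.hasFDerivAt_Gam hy').comp y (h.hasFDerivAt hy)
  have law : ∀ u v w, D2 y u (Gam g y v w) + J (fderiv ℝ (Gam g) y u v w)
      = fderiv ℝ (Gam g') (Φ y) (J u) (J v) (J w) + Gam g' (Φ y) (D2 y u v) (J w)
        + Gam g' (Φ y) (J v) (D2 y u w) + fderiv ℝ D2 y u v w := fun u v w => by
    have c := fun z : Eu m => hasFDerivAt_const (𝕜 := ℝ) z y
    have h1 := hΦ2.clm_apply ((hG.clm_apply (c v)).clm_apply (c w))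
    have h2 := ((hG'.clm_apply (hΦ2.clm_apply (c v))).clm_apply (hΦ2.clm_apply (c w))).add
      ((hΦ3.clm_apply (c v)).clm_apply (c w))
    have h3 := h1.congr_of_eventuallyEq (f₁ := fun z => Gam g' (Φ z) (fderiv ℝ Φ z v)
      (fderiv ℝ Φ z w) + D2 z v w) (by
        filter_upwards [h.source.isOpen.mem_nhds hy] with z hz using (h.map_Gam hz v w).symm)
    have := congrArg (fun T : Eu m →L[ℝ] Eu m => T u) (h3.unique h2)
    simp at this
    rw [add_comm]
    refine Eq.trans ?_ (this.trans ?_)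
    · abel
    · abel
  have h3s : fderiv ℝ D2 y u v w = fderiv ℝ D2 y v u w :=
    congrArg (fun T : Eu m →L[ℝ] Eu m => T w)
      ((((h.contDiffAt hy).fderiv_right (m := ∞) (by norm_cast)).isSymmSndFDerivAt (by simpa using two_le_infty)) u v)
  have l1 := law u v w
  have l2 := law v u w
  rw [curv_apply, curv_apply, map_add, map_sub, map_sub, h.map_Gam hy, h.map_Gam hy,
    h.map_Gam hy, h.map_Gam hy, map_add, map_add, eq_sub_iff_add_eq'.2 l1,
    eq_sub_iff_add_eq'.2 l2, h3s, hD2, h.fderiv_fderiv_symm hy v u]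
  abel

theorem ric_pullback (v w : Eu m) : ric (Gam g) y v w
    = ric (Gam g') (Φ y) (fderiv ℝ Φ y v) (fderiv ℝ Φ y w) := by
  set J := fderiv ℝ Φ y with hJ
  rw [ric_eq_trace, ric_eq_trace]
  let Je := LinearEquiv.ofInjectiveEndo (J : Eu m →ₗ[ℝ] Eu m) (h.injective hy)
  have hJe : ∀ x, Je x = J x := fun x => rfl
  rw [← LinearMap.trace_conj' _ Je]
  congr 1
  ext1 x
  obtain ⟨x, rfl⟩ := Je.surjective x
  rw [LinearEquiv.conj_apply_apply, LinearEquiv.symm_apply_apply, hJe, hJe]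
  exact h.map_curv hy x v w

/-- The scalar curvature is invariant under isometries. -/
theorem scal_eq : gcontr (gram (g y)) (ric (Gam g) y)
    = gcontr (gram (g' (Φ y))) (ric (Gam g') (Φ y)) :=
  gcontr_pullback (h.injective hy) (h.pullback y hy) (h.ric_pullback hy)

end IsIsometryOn

/-- The Hessian `∂²F - ∂F ∘ Γ` in coordinates. -/
def hessE (g : Eu m → Eu m →L[ℝ] Eu m →L[ℝ] ℝ) (F : Eu m → V) (y : Eu m) :
    Eu m →L[ℝ] Eu m →L[ℝ] V :=
  fderiv ℝ (fderiv ℝ F) y - (ContinuousLinearMap.compL ℝ (Eu m) (Eu m) V (fderiv ℝ F y)).comp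
    (Gam g y)

theorem hessE_apply (F : Eu m → V) (y u v : Eu m) : hessE g F y u v
    = fderiv ℝ (fderiv ℝ F) y u v - fderiv ℝ F y (Gam g y u v) := rfl

/-- The Hessian is a tensor. -/
theorem IsIsometryOn.hessE_pullback {Φ : Eu m → Eu m} (h : IsIsometryOn g g' U U' Φ) {y : Eu m}
    (hy : y ∈ U) {F F' : Eu m → V} (hF' : ContDiffOn ℝ ∞ F' U') (hF : ∀ z ∈ U, F z = F' (Φ z))
    (u v : Eu m) : hessE g F y u v
      = hessE g' F' (Φ y) (fderiv ℝ Φ y u) (fderiv ℝ Φ y v) := by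
  have hd : ∀ z ∈ U, HasFDerivAt F ((fderiv ℝ F' (Φ z)).comp (fderiv ℝ Φ z)) z := fun z hz =>
    ((((hF'.contDiffAt (h.target.isOpen.mem_nhds (h.mapsTo hz))).differentiableAt
      (by simp)).hasFDerivAt).comp z (h.hasFDerivAt hz)).congr_of_eventuallyEq
      (by filter_upwards [h.source.isOpen.mem_nhds hz] with a ha using hF a ha)
  have hd' : HasFDerivAt (fderiv ℝ F') (fderiv ℝ (fderiv ℝ F') (Φ y)) (Φ y) :=
    (((hF'.contDiffAt (h.target.isOpen.mem_nhds (h.mapsTo hy))).fderiv_right (m := ∞)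
      (by norm_cast)).differentiableAt (by simp)).hasFDerivAt
  have h2 := ((hd'.comp y (h.hasFDerivAt hy)).clm_comp (h.hasFDerivAt_fderiv hy)).congr_of_eventuallyEq
    (f₁ := fderiv ℝ F)
    (by filter_upwards [h.source.isOpen.mem_nhds hy] with a ha using (hd a ha).fderiv)
  rw [hessE_apply, hessE_apply, h2.fderiv, (hd y hy).fderiv]
  simp [h.map_Gam hy]
  abel

end LocalGeometry

/-! ### The metric and the action in charts -/

section Charts

variable {m n : ℕ} {M : Type*} [TopologicalSpace M] [ChartedSpace (Eu m) M]
  [IsManifold (𝓡 m) ∞ M] (A : ToricManifold m n M)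
  {V : Type*} [NormedAddCommGroup V] [NormedSpace ℝ V]

/-- The derivative of the inverse of the chart centred at `p`. -/
def dsymm (p : M) (y : Eu m) : Eu m →L[ℝ] Eu m :=
  mfderiv 𝓘(ℝ, Eu m) (𝓡 m) (extChartAt (𝓡 m) p).symm y

theorem mdifferentiableAt_symm {p : M} {y : Eu m} (hy : y ∈ (extChartAt (𝓡 m) p).target) :
    MDifferentiableAt 𝓘(ℝ, Eu m) (𝓡 m) (extChartAt (𝓡 m) p).symm y :=
  ((contMDiffOn_extChartAt_symm (n := ∞) p).contMDiffAt
    ((isOpen_extChartAt_target p).mem_nhds hy)).mdifferentiableAt (by simp)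

theorem dsymm_injective {p : M} {y : Eu m} (hy : y ∈ (extChartAt (𝓡 m) p).target) :
    Function.Injective (dsymm p y) := by
  have h1 := mfderiv_extChartAt_comp_mfderivWithin_extChartAt_symm (I := 𝓡 m) hy
  rw [ModelWithCorners.range_eq_univ, mfderivWithin_univ] at h1
  intro u v huv
  have := congrArg (fun T : Eu m →L[ℝ] Eu m => T u) h1
  have h2 := congrArg (fun T : Eu m →L[ℝ] Eu m => T v) h1
  exact this.symm.trans ((congrArg (mfderiv (𝓡 m) 𝓘(ℝ, Eu m) (extChartAt (𝓡 m) p)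
    ((extChartAt (𝓡 m) p).symm y)) huv).trans h2)

/-- The tangent space at `x` is identified with `ℝᵐ` through the chart centred at `x`. -/
theorem dsymm_center (x : M) : dsymm x (extChartAt (𝓡 m) x x) = ContinuousLinearMap.id ℝ (Eu m) := by
  have := mfderivWithin_range_extChartAt_symm (I := 𝓡 m) (x := x)
  rwa [ModelWithCorners.range_eq_univ, mfderivWithin_univ] at this

theorem contDiffOn_comp_symm {F : M → V} (hF : ContMDiff (𝓡 m) 𝓘(ℝ, V) ∞ F) (p : M) :
    ContDiffOn ℝ ∞ (F ∘ (extChartAt (𝓡 m) p).symm) (extChartAt (𝓡 m) p).target :=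
  contMDiffOn_iff_contDiffOn.1 (hF.comp_contMDiffOn (contMDiffOn_extChartAt_symm p))

theorem contMDiff_of_charts {F : M → V}
    (hF : ∀ p : M, ∃ F' : Eu m → V, ContDiffOn ℝ ∞ F' (extChartAt (𝓡 m) p).target ∧
      ∀ x ∈ (extChartAt (𝓡 m) p).source, F x = F' (extChartAt (𝓡 m) p x)) :
    ContMDiff (𝓡 m) 𝓘(ℝ, V) ∞ F := by
  intro p
  obtain ⟨F', h1, h2⟩ := hF p
  have h3 : ContMDiffAt (𝓡 m) 𝓘(ℝ, V) ∞ (F' ∘ extChartAt (𝓡 m) p) p :=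
    ((h1.contDiffAt ((isOpen_extChartAt_target p).mem_nhds
      (mem_extChartAt_target p))).contMDiffAt).comp p contMDiffAt_extChartAt
  exact h3.congr_of_eventuallyEq (by
    filter_upwards [extChartAt_source_mem_nhds (I := 𝓡 m) p] with x hx using h2 x hx)

namespace ToricManifold

/-- The metric at `x`, as a bilinear form on `ℝᵐ`. -/
def ginn (x : M) : Eu m →L[ℝ] Eu m →L[ℝ] ℝ := A.g.inner x

/-- The metric in the chart centred at `p`. -/
def gForm (p : M) (y : Eu m) : Eu m →L[ℝ] Eu m →L[ℝ] ℝ :=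
  (A.ginn ((extChartAt (𝓡 m) p).symm y)).bilinearComp (dsymm p y) (dsymm p y)

theorem gMat_eq (p : M) : A.gMat p = fun y => gram (A.gForm p y) := rfl

theorem gForm_apply (p : M) (y u v : Eu m) :
    A.gForm p y u v = A.ginn ((extChartAt (𝓡 m) p).symm y) (dsymm p y u) (dsymm p y v) := rfl

theorem gForm_center (x : M) : A.gForm x (extChartAt (𝓡 m) x x) = A.ginn x := by
  unfold gForm
  rw [dsymm_center, extChartAt_to_inv]
  rfl

/-- Smoothness of the metric as a section of the bundle of bilinear forms, read in a chart. -/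
theorem contDiffOn_gForm (p : M) : ContDiffOn ℝ ∞ (A.gForm p) (extChartAt (𝓡 m) p).target := by
  refine contDiffOn_clm_apply.2 fun u => contDiffOn_clm_apply.2 fun v => ?_
  rw [← contMDiffOn_iff_contDiffOn]
  have hs : ContMDiffOn 𝓘(ℝ, Eu m) (𝓡 m) ∞ (extChartAt (𝓡 m) p).symm
      (extChartAt (𝓡 m) p).target := contMDiffOn_extChartAt_symm p
  have hsec : ∀ u : Eu m, ContMDiffOn 𝓘(ℝ, Eu m) ((𝓡 m).prod 𝓘(ℝ, Eu m)) ∞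
      (fun y => (⟨(extChartAt (𝓡 m) p).symm y, dsymm p y u⟩ :
        TangentBundle (𝓡 m) M)) (extChartAt (𝓡 m) p).target := by
    intro u
    have h1 := hs.contMDiffOn_tangentMapWithin (m := ∞) (by norm_cast)
      (isOpen_extChartAt_target p).uniqueMDiffOn
    have h2 : ContMDiff 𝓘(ℝ, Eu m) (𝓘(ℝ, Eu m).prod 𝓘(ℝ, Eu m)) ∞
        (fun y : Eu m => (⟨y, u⟩ : TangentBundle 𝓘(ℝ, Eu m) (Eu m))) := by
      exact contMDiff_vectorSpace_iff_contDiff.2 contDiff_const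
    refine (h1.comp h2.contMDiffOn fun y hy => hy).congr fun y hy => ?_
    simp only [Function.comp, tangentMapWithin]
    rw [mfderivWithin_of_isOpen (isOpen_extChartAt_target p) hy]
    rfl
  intro y hy
  have key : ContMDiffWithinAt 𝓘(ℝ, Eu m) ((𝓡 m).prod 𝓘(ℝ)) ∞
      (fun y ↦ Bundle.TotalSpace.mk' ℝ (E := Bundle.Trivial M ℝ) ((extChartAt (𝓡 m) p).symm y)
        (A.gForm p y u v)) (extChartAt (𝓡 m) p).target y := by
    apply ContMDiffWithinAt.clm_bundle_apply₂ (F₁ := Eu m) (F₂ := Eu m)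
    · exact ContMDiffAt.comp_contMDiffWithinAt y A.g.contMDiff.contMDiffAt (hs y hy)
    · exact hsec u y hy
    · exact hsec v y hy
  rw [Bundle.contMDiffWithinAt_totalSpace] at key
  exact key.2

theorem isMetricOn_gForm (p : M) : IsMetricOn (A.gForm p) (extChartAt (𝓡 m) p).target where
  isOpen := isOpen_extChartAt_target p
  smooth := A.contDiffOn_gForm p
  symm y _ u v := A.g.symm ((extChartAt (𝓡 m) p).symm y) (dsymm p y u) (dsymm p y v)
  pos y hy u hu := by
    have h0 : dsymm p y u ≠ 0 := fun h => hu (dsymm_injective hy (h.trans (map_zero _).symm))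
    exact A.g.pos ((extChartAt (𝓡 m) p).symm y) (dsymm p y u) h0

/-- The map `act t` read in the charts centred at `p` and `q`. -/
def chartMap (t : Fin n → ℝ) (p q : M) : Eu m → Eu m :=
  extChartAt (𝓡 m) q ∘ A.act t ∘ (extChartAt (𝓡 m) p).symm

/-- The part of the chart centred at `p` which `act t` maps into the chart centred at `q`. -/
def chartDom (t : Fin n → ℝ) (p q : M) : Set (Eu m) :=
  (extChartAt (𝓡 m) p).target ∩
    (extChartAt (𝓡 m) p).symm ⁻¹' (A.act t ⁻¹' (extChartAt (𝓡 m) q).source)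

theorem contMDiff_act (t : Fin n → ℝ) : ContMDiff (𝓡 m) (𝓡 m) ∞ (A.act t) :=
  A.act_smooth.comp (contMDiff_const.prodMk contMDiff_id)

theorem mem_chartDom {t : Fin n → ℝ} {p q x : M} (hp : x ∈ (extChartAt (𝓡 m) p).source)
    (hq : A.act t x ∈ (extChartAt (𝓡 m) q).source) :
    extChartAt (𝓡 m) p x ∈ A.chartDom t p q :=
  ⟨(extChartAt (𝓡 m) p).map_source hp, by
    simpa only [Set.mem_preimage, (extChartAt (𝓡 m) p).left_inv hp] using hq⟩

/-- For `t = 0` this is the compatibility of the expressions of the metric in two charts. -/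
theorem isIsometryOn_chartMap (t : Fin n → ℝ) (p q : M) :
    IsIsometryOn (A.gForm p) (A.gForm q) (A.chartDom t p q) (extChartAt (𝓡 m) q).target
      (A.chartMap t p q) := by
  have hopen : IsOpen (A.chartDom t p q) :=
    (continuousOn_extChartAt_symm p).isOpen_inter_preimage (isOpen_extChartAt_target p)
      ((isOpen_extChartAt_source q).preimage (A.contMDiff_act t).continuous)
  have hsm : ContDiffOn ℝ ∞ (A.chartMap t p q) (A.chartDom t p q) := by
    rw [← contMDiffOn_iff_contDiffOn]
    refine (contMDiffOn_extChartAt (I := 𝓡 m) (x := q)).comp ((A.contMDiff_act t).comp_contMDiffOn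
      ((contMDiffOn_extChartAt_symm p).mono Set.inter_subset_left)) fun y hy => ?_
    simpa [extChartAt_source] using hy.2
  have hm : Set.MapsTo (A.chartMap t p q) (A.chartDom t p q) (extChartAt (𝓡 m) q).target :=
    fun y hy => (extChartAt (𝓡 m) q).map_source hy.2
  refine ⟨⟨hopen, (A.contDiffOn_gForm p).mono Set.inter_subset_left,
    fun y hy => (A.isMetricOn_gForm p).symm y hy.1, fun y hy => (A.isMetricOn_gForm p).pos y hy.1⟩,
    A.isMetricOn_gForm q, hm, hsm, fun y hy u v => ?_⟩
  have heq : ∀ z ∈ A.chartDom t p q, (extChartAt (𝓡 m) q).symm (A.chartMap t p q z)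
      = A.act t ((extChartAt (𝓡 m) p).symm z) := fun z hz => (extChartAt (𝓡 m) q).left_inv hz.2
  have h1 : MDifferentiableAt 𝓘(ℝ, Eu m) 𝓘(ℝ, Eu m) (A.chartMap t p q) y :=
    ((hsm.contDiffAt (hopen.mem_nhds hy)).differentiableAt (by simp)).mdifferentiableAt
  have h2 := ((mdifferentiableAt_symm (hm hy)).hasMFDerivAt.comp y h1.hasMFDerivAt)
  have h3 := (((A.contMDiff_act t).mdifferentiable (by simp)
    ((extChartAt (𝓡 m) p).symm y)).hasMFDerivAt).comp y (mdifferentiableAt_symm hy.1).hasMFDerivAt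
  have h4 := h3.congr_of_eventuallyEq (f₁ := (extChartAt (𝓡 m) q).symm ∘ A.chartMap t p q)
    (by filter_upwards [hopen.mem_nhds hy] with z hz using heq z hz)
  have hJ : ∀ w : Eu m, dsymm q (A.chartMap t p q y) (fderiv ℝ (A.chartMap t p q) y w)
      = mfderiv (𝓡 m) (𝓡 m) (A.act t) ((extChartAt (𝓡 m) p).symm y) (dsymm p y w) := fun w => by
    have := congrArg (fun T : Eu m →L[ℝ] Eu m => T w) (hasMFDerivAt_unique h2 h4)
    rw [mfderiv_eq_fderiv] at this
    exact this
  rw [gForm_apply, gForm_apply, hJ, hJ, heq y hy]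
  exact (A.act_isometry t _ _ _).symm

end ToricManifold
end Charts

/-! ### Differential, Hessian and contraction on the manifold -/

section Charts

variable {m n : ℕ} {V : Type*} [NormedAddCommGroup V] [NormedSpace ℝ V]

theorem contDiffOn_gcontr {E : Type*} [NormedAddCommGroup E] [NormedSpace ℝ E]
    {G : E → Matrix (Fin m) (Fin m) ℝ} {b : E → Eu m →L[ℝ] Eu m →L[ℝ] V} {s : Set E}
    {k : WithTop ℕ∞} (hG : ∀ i j, ContDiffOn ℝ k (fun y => (G y)⁻¹ i j) s)
    (hb : ContDiffOn ℝ k b s) : ContDiffOn ℝ k (fun y => gcontr (G y) (b y)) s :=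
  ContDiffOn.sum fun i _ => ContDiffOn.sum fun j _ =>
    (hG i j).smul ((hb.clm_apply contDiffOn_const).clm_apply contDiffOn_const)

theorem IsMetricOn.contDiffOn_hessE {g : Eu m → Eu m →L[ℝ] Eu m →L[ℝ] ℝ} {U : Set (Eu m)}
    (h : IsMetricOn g U) {F : Eu m → V} (hF : ContDiffOn ℝ ∞ F U) :
    ContDiffOn ℝ ∞ (hessE g F) U := by
  have h1 : ContDiffOn ℝ ∞ (fderiv ℝ F) U := hF.fderiv_of_isOpen h.isOpen (by norm_cast)
  have h2 : ContDiffOn ℝ ∞ (fderiv ℝ (fderiv ℝ F)) U := h1.fderiv_of_isOpen h.isOpen (by norm_cast)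
  exact h2.sub (((ContinuousLinearMap.compL ℝ (Eu m) (Eu m)
    V).contDiff.comp_contDiffOn h1).clm_comp h.contDiffOn_Gam)

variable {M : Type*} [TopologicalSpace M] [ChartedSpace (Eu m) M] [IsManifold (𝓡 m) ∞ M]

/-- The differential of a vector valued function. -/
def dM (F : M → V) (x : M) : Eu m →L[ℝ] V :=
  fderiv ℝ (F ∘ (extChartAt (𝓡 m) x).symm) (extChartAt (𝓡 m) x x)

theorem dM_eq_mfderiv {F : M → V} {x : M} (hF : MDifferentiableAt (𝓡 m) 𝓘(ℝ, V) F x) :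
    dM F x = (mfderiv (𝓡 m) 𝓘(ℝ, V) F x : Eu m →L[ℝ] V) := by
  have h : fderivWithin ℝ (writtenInExtChartAt (𝓡 m) 𝓘(ℝ, V) x F) (Set.range (𝓡 m))
      (extChartAt (𝓡 m) x x) = dM F x := by
    rw [ModelWithCorners.range_eq_univ, fderivWithin_univ]
    rfl
  exact h.symm.trans hF.mfderiv.symm

namespace ToricManifold

variable (A : ToricManifold m n M)

/-- The covariant Hessian of a vector valued function. -/
def hessM (F : M → V) (x : M) : Eu m →L[ℝ] Eu m →L[ℝ] V :=
  hessE (A.gForm x) (F ∘ (extChartAt (𝓡 m) x).symm) (extChartAt (𝓡 m) x x)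

/-- Contraction of a vector valued two-tensor with the inverse metric. -/
def contrM (b : M → Eu m →L[ℝ] Eu m →L[ℝ] V) (x : M) : V := gcontr (gram (A.ginn x)) (b x)

/-- The derivative of the change of charts from the chart centred at `p` to the one centred
at `x`. -/
def jac (p x : M) : Eu m →L[ℝ] Eu m := fderiv ℝ (A.chartMap 0 p x) (extChartAt (𝓡 m) p x)

/-- The derivative of the action. -/
def dact (t : Fin n → ℝ) (x : M) : Eu m →L[ℝ] Eu m := mfderiv (𝓡 m) (𝓡 m) (A.act t) x

theorem dact_eq (t : Fin n → ℝ) (x : M) :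
    A.dact t x = fderiv ℝ (A.chartMap t x (A.act t x)) (extChartAt (𝓡 m) x x) := by
  have h : fderivWithin ℝ (writtenInExtChartAt (𝓡 m) (𝓡 m) x (A.act t)) (Set.range (𝓡 m))
      (extChartAt (𝓡 m) x x) = fderiv ℝ (A.chartMap t x (A.act t x)) (extChartAt (𝓡 m) x x) := by
    rw [ModelWithCorners.range_eq_univ, fderivWithin_univ]
    rfl
  exact ((A.contMDiff_act t).mdifferentiable (by simp) x).mfderiv.trans h

theorem act_zero' : A.act 0 = id := funext A.act_zero

theorem chartMap_apply {t : Fin n → ℝ} {p q x : M} (hp : x ∈ (extChartAt (𝓡 m) p).source) :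
    A.chartMap t p q (extChartAt (𝓡 m) p x) = extChartAt (𝓡 m) q (A.act t x) := by
  simp only [chartMap, Function.comp, (extChartAt (𝓡 m) p).left_inv hp]

section Transfer

variable {p x : M} (hx : x ∈ (extChartAt (𝓡 m) p).source)
include hx

theorem mem_chartDom_zero : extChartAt (𝓡 m) p x ∈ A.chartDom 0 p x :=
  A.mem_chartDom hx (by rw [A.act_zero]; exact mem_extChartAt_source x)

theorem chartMap_zero_apply : A.chartMap 0 p x (extChartAt (𝓡 m) p x) = extChartAt (𝓡 m) x x := by
  rw [A.chartMap_apply hx, A.act_zero]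

theorem jac_injective : Function.Injective (A.jac p x) :=
  (A.isIsometryOn_chartMap 0 p x).injective (A.mem_chartDom_zero hx)

theorem gForm_transfer (u v : Eu m) : A.gForm p (extChartAt (𝓡 m) p x) u v
    = A.ginn x (A.jac p x u) (A.jac p x v) := by
  rw [(A.isIsometryOn_chartMap 0 p x).pullback _ (A.mem_chartDom_zero hx),
    A.chartMap_zero_apply hx, gForm_center]
  rfl

theorem gcontr_transfer {b b' : Eu m →L[ℝ] Eu m →L[ℝ] V}
    (hb : ∀ u v, b' u v = b (A.jac p x u) (A.jac p x v)) :
    gcontr (gram (A.gForm p (extChartAt (𝓡 m) p x))) b' = gcontr (gram (A.ginn x)) b :=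
  gcontr_pullback (A.jac_injective hx) (A.gForm_transfer hx) hb

theorem hessE_transfer {F : M → V} (hF : ContMDiff (𝓡 m) 𝓘(ℝ, V) ∞ F) (u v : Eu m) :
    hessE (A.gForm p) (F ∘ (extChartAt (𝓡 m) p).symm) (extChartAt (𝓡 m) p x) u v
      = A.hessM F x (A.jac p x u) (A.jac p x v) := by
  rw [(A.isIsometryOn_chartMap 0 p x).hessE_pullback (A.mem_chartDom_zero hx)
    (contDiffOn_comp_symm hF x) (fun z hz => ?_), A.chartMap_zero_apply hx]
  · rfl
  · have h2 := hz.2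
    rw [A.act_zero'] at h2
    simp only [Function.comp, chartMap, act_zero', id]
    rw [(extChartAt (𝓡 m) x).left_inv h2]

theorem fderiv_transfer {F : M → V} (hF : ContMDiff (𝓡 m) 𝓘(ℝ, V) ∞ F) (u : Eu m) :
    fderiv ℝ (F ∘ (extChartAt (𝓡 m) p).symm) (extChartAt (𝓡 m) p x) u
      = dM F x (A.jac p x u) := by
  have h := A.isIsometryOn_chartMap 0 p x
  have hy := A.mem_chartDom_zero hx
  have h1 : HasFDerivAt (F ∘ (extChartAt (𝓡 m) x).symm) (dM F x)
      (A.chartMap 0 p x (extChartAt (𝓡 m) p x)) := by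
    rw [A.chartMap_zero_apply hx]
    exact (((contDiffOn_comp_symm hF x).contDiffAt ((isOpen_extChartAt_target x).mem_nhds
      (mem_extChartAt_target x))).differentiableAt (by simp)).hasFDerivAt
  have h2 := (h1.comp _ (h.hasFDerivAt hy)).congr_of_eventuallyEq
    (f₁ := F ∘ (extChartAt (𝓡 m) p).symm) (by
      filter_upwards [h.source.isOpen.mem_nhds hy] with z hz
      have h2 := hz.2
      rw [A.act_zero'] at h2
      simp only [Function.comp, chartMap, act_zero', id]
      rw [(extChartAt (𝓡 m) x).left_inv h2])
  rw [h2.fderiv]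
  rfl

end Transfer

section Naturality

variable (t : Fin n → ℝ) (x : M)

theorem mem_chartDom_self : extChartAt (𝓡 m) x x ∈ A.chartDom t x (A.act t x) :=
  A.mem_chartDom (mem_extChartAt_source x) (mem_extChartAt_source _)

theorem dact_injective : Function.Injective (A.dact t x) := by
  rw [A.dact_eq]
  exact (A.isIsometryOn_chartMap t x _).injective (A.mem_chartDom_self t x)

theorem ginn_act (u v : Eu m) :
    A.ginn x u v = A.ginn (A.act t x) (A.dact t x u) (A.dact t x v) :=
  (A.act_isometry t x u v).symm

theorem gcontr_act {b b' : Eu m →L[ℝ] Eu m →L[ℝ] V}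
    (hb : ∀ u v, b u v = b' (A.dact t x u) (A.dact t x v)) :
    gcontr (gram (A.ginn x)) b = gcontr (gram (A.ginn (A.act t x))) b' :=
  gcontr_pullback (A.dact_injective t x) (A.ginn_act t x) hb

theorem hessM_act {F : M → V} (hF : ContMDiff (𝓡 m) 𝓘(ℝ, V) ∞ F) (u v : Eu m) :
    A.hessM (F ∘ A.act t) x u v = A.hessM F (A.act t x) (A.dact t x u) (A.dact t x v) := by
  rw [hessM, (A.isIsometryOn_chartMap t x (A.act t x)).hessE_pullback (A.mem_chartDom_self t x)
    (contDiffOn_comp_symm hF _) (fun z hz => ?_), A.chartMap_apply (mem_extChartAt_source x),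
    ← A.dact_eq]
  · rfl
  · simp only [Function.comp, chartMap]
    rw [(extChartAt (𝓡 m) (A.act t x)).left_inv hz.2]

theorem dM_act {F : M → V} (hF : ContMDiff (𝓡 m) 𝓘(ℝ, V) ∞ F) (u : Eu m) :
    dM (F ∘ A.act t) x u = dM F (A.act t x) (A.dact t x u) := by
  have h1 := hF.mdifferentiable (by simp) (A.act t x)
  have h2 := (A.contMDiff_act t).mdifferentiable (by simp) x
  rw [dM_eq_mfderiv (h1.comp x h2), mfderiv_comp x h1 h2, dM_eq_mfderiv h1]
  rfl

end Naturality

theorem gcontr_gForm_ric {p x : M} (hx : x ∈ (extChartAt (𝓡 m) p).source) :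
    gcontr (gram (A.gForm p (extChartAt (𝓡 m) p x)))
      (ric (Gam (A.gForm p)) (extChartAt (𝓡 m) p x)) = gcontr (gram (A.ginn x))
      (ric (Gam (A.gForm x)) (extChartAt (𝓡 m) x x)) := by
  rw [(A.isIsometryOn_chartMap 0 p x).scal_eq (A.mem_chartDom_zero hx), A.chartMap_zero_apply hx,
    gForm_center]

theorem christoffel_eq (p : M) (k i j : Fin m) :
    A.christoffel p k i j = chr (fun y => gram (A.gForm p y)) k i j := rfl

/-- The classical formula for the Ricci tensor is the trace of the curvature endomorphism. -/
theorem ricci_eq (p : M) {y : Eu m} (hy : y ∈ (extChartAt (𝓡 m) p).target) (j k : Fin m) :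
    A.ricci p y j k = ric (Gam (A.gForm p)) y (e j) (e k) := by
  have hΓ : ∀ i j, Gam (A.gForm p) y (e i) (e j) = ∑ k, A.christoffel p k i j y • e k :=
    fun i j => christ_e _ _ _ _
  have hd : ∀ l i j k, fderiv ℝ (Gam (A.gForm p)) y (e l) (e i) (e j) k
      = fderiv ℝ (A.christoffel p k i j) y (e l) := fun l i j k => by
    have c := fun z : Eu m => hasFDerivAt_const (𝕜 := ℝ) z y
    have h1 := (((cov k).hasFDerivAt (x := Gam (A.gForm p) y (e i) (e j))).comp y
      ((((A.isMetricOn_gForm p).hasFDerivAt_Gam hy).clm_apply (c (e i))).clm_apply (c (e j))))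
    have h2 : A.christoffel p k i j = fun y => cov k (Gam (A.gForm p) y (e i) (e j)) := by
      funext z
      exact (christ_apply _ _ _ _ _).symm
    rw [h2]
    refine Eq.trans ?_ (congrArg (fun T : Eu m →L[ℝ] ℝ => T (e l)) h1.fderiv.symm)
    simp [cov_apply]
  simp only [ric, sum_apply, ContinuousLinearMap.comp_apply, ContinuousLinearMap.compL_apply,
    cov_apply, curv_apply]
  rw [ricci, ← Finset.sum_add_distrib]
  refine Finset.sum_congr rfl fun i _ => ?_
  simp only [PiLp.add_apply, PiLp.sub_apply, hd, hΓ, map_sum, map_smul]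
  congr 1
  rw [Finset.sum_sub_distrib]
  congr 1
  · simp [e_apply, mul_comm]
  · simp [e_apply, mul_comm]

theorem scalarCurvature_eq (x : M) : A.scalarCurvature x = gcontr (gram (A.ginn x))
    (ric (Gam (A.gForm x)) (extChartAt (𝓡 m) x x)) := by
  rw [scalarCurvature, gcontr, ← gForm_center]
  simp only [A.ricci_eq x (mem_extChartAt_target x), smul_eq_mul]
  rfl

theorem contMDiff_scalarCurvature : ContMDiff (𝓡 m) 𝓘(ℝ, ℝ) ∞ A.scalarCurvature := by
  refine contMDiff_of_charts fun p => ⟨_, contDiffOn_gcontr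
    (A.isMetricOn_gForm p).contDiffOn_gram_inv (A.isMetricOn_gForm p).contDiffOn_ric,
    fun x hx => ?_⟩
  rw [scalarCurvature_eq, A.gcontr_gForm_ric hx]

theorem scalarCurvature_act (t : Fin n → ℝ) (x : M) :
    A.scalarCurvature (A.act t x) = A.scalarCurvature x := by
  rw [scalarCurvature_eq, scalarCurvature_eq, ← gForm_center, ← gForm_center,
    (A.isIsometryOn_chartMap t x (A.act t x)).scal_eq (A.mem_chartDom_self t x),
    A.chartMap_apply (mem_extChartAt_source x)]

theorem contract_eq (b : M → CTensor m) : A.contract b = A.contrM b := by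
  funext x
  simp only [contract, contrM, gcontr, Complex.real_smul]
  rfl

theorem hess_eq (f : M → ℂ) : A.hess f = A.hessM f := by
  funext x
  refine clm_ext_e₂ fun a b => ?_
  rw [hessM, hessE_apply, Gam, christ_e, map_sum]
  simp only [hess, sub_apply, sum_apply, smul_apply, tens, ContinuousLinearMap.smulRight_apply]
  congr 1
  have hdx : ∀ (i : Fin m) (u : Eu m), dx i u = ((u i : ℝ) : ℂ) := fun i u => rfl
  simp [hdx, e_apply, christoffel_eq, apply_ite]

/-- A contraction is smooth if the two-tensor is given in each chart by a smooth family; the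
two-tensor itself, as a map into a fixed space, need not be continuous because the chart centred
at `x` varies with `x`. -/
theorem contMDiff_contrM {b : M → Eu m →L[ℝ] Eu m →L[ℝ] V}
    (b' : M → Eu m → Eu m →L[ℝ] Eu m →L[ℝ] V)
    (hb' : ∀ p, ContDiffOn ℝ ∞ (b' p) (extChartAt (𝓡 m) p).target)
    (h : ∀ p, ∀ x ∈ (extChartAt (𝓡 m) p).source, ∀ u v,
      b' p (extChartAt (𝓡 m) p x) u v = b x (A.jac p x u) (A.jac p x v)) :
    ContMDiff (𝓡 m) 𝓘(ℝ, V) ∞ (A.contrM b) :=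
  contMDiff_of_charts fun p => ⟨_, contDiffOn_gcontr
    (A.isMetricOn_gForm p).contDiffOn_gram_inv (hb' p),
    fun x hx => (A.gcontr_transfer hx (h p x hx)).symm⟩

end ToricManifold
end Charts

namespace ToricManifold

/-! ### The Riemannian volume -/

section Integral

variable {m n : ℕ} {M : Type*} [TopologicalSpace M] [ChartedSpace (Eu m) M]
  [IsManifold (𝓡 m) ∞ M] (A : ToricManifold m n M)
  {G : Type*} [NormedAddCommGroup G] [NormedSpace ℝ G]

/-- The integral over the chart centred at `p` against the Riemannian volume. -/
def chartInt (p : M) (ψ : M → G) : G :=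
  ∫ y in (extChartAt (𝓡 m) p).target, √(A.gMat p y).det • ψ ((extChartAt (𝓡 m) p).symm y)

theorem det_gMat_pos {p : M} {y : Eu m} (hy : y ∈ (extChartAt (𝓡 m) p).target) :
    0 < (A.gMat p y).det := ((A.isMetricOn_gForm p).posDef hy).det_pos

theorem contDiffOn_det_gMat (p : M) :
    ContDiffOn ℝ ∞ (fun y => (A.gMat p y).det) (extChartAt (𝓡 m) p).target :=
  contDiffOn_det (A.isMetricOn_gForm p).contDiffOn_gram

theorem contDiffOn_sqrt_det (p : M) :
    ContDiffOn ℝ ∞ (fun y => √(A.gMat p y).det) (extChartAt (𝓡 m) p).target :=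
  (A.contDiffOn_det_gMat p).sqrt fun _ hy => (A.det_gMat_pos hy).ne'

theorem isCompact_image_tsupport [CompactSpace M] {p : M} {ψ : M → G}
    (h : tsupport ψ ⊆ (chartAt (Eu m) p).source) :
    IsCompact (extChartAt (𝓡 m) p '' tsupport ψ) :=
  (isClosed_tsupport ψ).isCompact.image_of_continuousOn
    ((continuousOn_extChartAt p).mono (by rwa [extChartAt_source]))

theorem mem_image_tsupport {p : M} {ψ : M → G} {y : Eu m} (hy : y ∈ (extChartAt (𝓡 m) p).target)
    (h : ψ ((extChartAt (𝓡 m) p).symm y) ≠ 0) : y ∈ extChartAt (𝓡 m) p '' tsupport ψ :=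
  ⟨_, subset_tsupport _ h, (extChartAt (𝓡 m) p).right_inv hy⟩

theorem integrableOn_chart [CompactSpace M] {p : M} {ψ : M → G} (hψ : Continuous ψ)
    (h : tsupport ψ ⊆ (chartAt (Eu m) p).source) :
    IntegrableOn (fun y => √(A.gMat p y).det • ψ ((extChartAt (𝓡 m) p).symm y))
      (extChartAt (𝓡 m) p).target := by
  have hK := isCompact_image_tsupport h
  have hsub : extChartAt (𝓡 m) p '' tsupport ψ ⊆ (extChartAt (𝓡 m) p).target := by
    rintro _ ⟨x, hx, rfl⟩
    exact (extChartAt (𝓡 m) p).map_source (by rw [extChartAt_source]; exact h hx)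
  have hc : ContinuousOn (fun y => √(A.gMat p y).det • ψ ((extChartAt (𝓡 m) p).symm y))
      (extChartAt (𝓡 m) p).target :=
    (A.contDiffOn_sqrt_det p).continuousOn.smul
      (hψ.comp_continuousOn (continuousOn_extChartAt_symm p))
  refine ((hc.mono hsub).integrableOn_compact hK).of_forall_sdiff_eq_zero
    (isOpen_extChartAt_target p).measurableSet fun y hy => ?_
  by_contra h0
  exact hy.2 (mem_image_tsupport hy.1 fun h => h0 (by rw [h, smul_zero]))

/-- Change of variables: the torus acts by isometries, hence preserves the volume. -/
theorem chartInt_act (t : Fin n → ℝ) {p q : M} {ψ : M → G}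
    (h1 : ∀ x, ψ x ≠ 0 → x ∈ (chartAt (Eu m) q).source)
    (h2 : ∀ x, ψ (A.act t x) ≠ 0 → x ∈ (chartAt (Eu m) p).source) :
    A.chartInt p (ψ ∘ A.act t) = A.chartInt q ψ := by
  have hiso := A.isIsometryOn_chartMap t p q
  set Φ := A.chartMap t p q with hΦ
  have hact : ∀ x, A.act (-t) (A.act t x) = x := fun x => by
    rw [← A.act_add, neg_add_cancel, A.act_zero]
  have hact' : ∀ x, A.act t (A.act (-t) x) = x := fun x => by
    rw [← A.act_add, add_neg_cancel, A.act_zero]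
  have hinv : ∀ y ∈ A.chartDom t p q, (extChartAt (𝓡 m) p)
      (A.act (-t) ((extChartAt (𝓡 m) q).symm (Φ y))) = y := fun y hy => by
    have : (extChartAt (𝓡 m) q).symm (Φ y) = A.act t ((extChartAt (𝓡 m) p).symm y) :=
      (extChartAt (𝓡 m) q).left_inv hy.2
    rw [this, hact, (extChartAt (𝓡 m) p).right_inv hy.1]
  have hinj : Set.InjOn Φ (A.chartDom t p q) := fun y hy z hz hyz => by
    rw [← hinv y hy, ← hinv z hz, hyz]
  have himg : Φ '' A.chartDom t p q ⊆ (extChartAt (𝓡 m) q).target := by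
    rintro _ ⟨y, hy, rfl⟩
    exact hiso.mapsTo hy
  have hU : IsOpen (A.chartDom t p q) := hiso.source.isOpen
  have key := integral_image_eq_integral_abs_det_fderiv_smul volume hU.measurableSet
    (fun y hy => (hiso.hasFDerivAt hy).hasFDerivWithinAt) hinj
    (fun z => √(A.gMat q z).det • ψ ((extChartAt (𝓡 m) q).symm z))
  have e1 : A.chartInt q ψ = ∫ z in Φ '' A.chartDom t p q,
      √(A.gMat q z).det • ψ ((extChartAt (𝓡 m) q).symm z) := by
    refine setIntegral_eq_of_subset_of_forall_sdiff_eq_zero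
      (isOpen_extChartAt_target q).measurableSet himg fun z hz => ?_
    by_contra h0
    refine hz.2 ⟨extChartAt (𝓡 m) p (A.act (-t) ((extChartAt (𝓡 m) q).symm z)), ?_, ?_⟩
    all_goals
      have h3 : ψ ((extChartAt (𝓡 m) q).symm z) ≠ 0 := fun h => h0 (by rw [h, smul_zero])
      have h4 : A.act (-t) ((extChartAt (𝓡 m) q).symm z) ∈ (extChartAt (𝓡 m) p).source := by
        rw [extChartAt_source]
        exact h2 _ (by rwa [hact'])
      have h5 : A.act t (A.act (-t) ((extChartAt (𝓡 m) q).symm z)) ∈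
          (extChartAt (𝓡 m) q).source := by
        rw [hact']
        exact (extChartAt (𝓡 m) q).map_target hz.1
    · exact A.mem_chartDom h4 h5
    · rw [hΦ, A.chartMap_apply h4, hact', (extChartAt (𝓡 m) q).right_inv hz.1]
  have e2 : A.chartInt p (ψ ∘ A.act t) = ∫ y in A.chartDom t p q,
      √(A.gMat p y).det • ψ (A.act t ((extChartAt (𝓡 m) p).symm y)) := by
    refine setIntegral_eq_of_subset_of_forall_sdiff_eq_zero
      (isOpen_extChartAt_target p).measurableSet Set.inter_subset_left fun y hy => ?_
    by_contra h0
    refine hy.2 ⟨hy.1, ?_⟩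
    rw [Set.mem_preimage, Set.mem_preimage, extChartAt_source]
    exact h1 _ fun h => h0 (by simp only [Function.comp]; rw [h, smul_zero])
  rw [e1, e2, key]
  refine setIntegral_congr_fun hU.measurableSet fun y hy => ?_
  have h3 : (extChartAt (𝓡 m) q).symm (Φ y) = A.act t ((extChartAt (𝓡 m) p).symm y) :=
    (extChartAt (𝓡 m) q).left_inv hy.2
  have h4 : (A.gMat p y).det = (fderiv ℝ Φ y).det ^ 2 * (A.gMat q (Φ y)).det := by
    rw [A.gMat_eq, A.gMat_eq]
    simp only
    rw [gram_pullback (hiso.pullback y hy), Matrix.det_mul, Matrix.det_mul,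
      Matrix.det_transpose, det_matE]
    ring
  rw [h3, smul_smul, h4, Real.sqrt_mul (sq_nonneg _), Real.sqrt_sq_eq_abs]

variable [T2Space M] [CompactSpace M]

/-- The partition of unity which defines the integral. -/
def pou (m : ℕ) (M : Type*) [TopologicalSpace M] [ChartedSpace (Eu m) M]
    [IsManifold (𝓡 m) ∞ M] [T2Space M] [CompactSpace M] :
    SmoothPartitionOfUnity M (𝓡 m) M Set.univ :=
  (SmoothPartitionOfUnity.exists_isSubordinate_chartAt_source (𝓡 m) M).choose

theorem tsupport_pou (p : M) : tsupport (pou m M p) ⊆ (chartAt (Eu m) p).source :=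
  (SmoothPartitionOfUnity.exists_isSubordinate_chartAt_source (𝓡 m) M).choose_spec p

theorem continuous_pou (p : M) : Continuous (pou m M p) := (pou m M p).contMDiff.continuous

theorem finite_pou (m : ℕ) (M : Type*) [TopologicalSpace M] [ChartedSpace (Eu m) M]
    [IsManifold (𝓡 m) ∞ M] [T2Space M] [CompactSpace M] :
    {p : M | (Function.support (pou m M p)).Nonempty}.Finite :=
  (pou m M).locallyFinite.finite_nonempty_of_compact

/-- The finitely many indices at which the partition of unity does not vanish. -/
def pouIdx (m : ℕ) (M : Type*) [TopologicalSpace M] [ChartedSpace (Eu m) M]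
    [IsManifold (𝓡 m) ∞ M] [T2Space M] [CompactSpace M] : Finset M := (finite_pou m M).toFinset

theorem pou_eq_zero {p : M} (hp : p ∉ pouIdx m M) : (pou m M p : M → ℝ) = 0 := by
  simpa [pouIdx, Set.not_nonempty_iff_eq_empty, Function.support_eq_empty_iff] using hp

theorem sum_pou (x : M) : ∑ p ∈ pouIdx m M, pou m M p x = 1 := by
  rw [← (pou m M).sum_eq_one (Set.mem_univ x)]
  refine (finsum_eq_sum_of_support_subset _ fun p hp => ?_).symm
  by_contra h
  exact hp (congrFun (pou_eq_zero h) x)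

theorem sum_pou_smul (f : M → G) (x : M) : ∑ p ∈ pouIdx m M, pou m M p x • f x = f x := by
  rw [← Finset.sum_smul, sum_pou, one_smul]

theorem tsupport_pou_smul (p : M) (f : M → G) :
    tsupport (fun x => pou m M p x • f x) ⊆ (chartAt (Eu m) p).source :=
  (tsupport_smul_subset_left _ _).trans (tsupport_pou p)

variable [MeasurableSpace M] [BorelSpace M]

/-- The density of the volume weighted by the partition of unity. -/
def wt (p : M) (y : Eu m) : ℝ :=
  √(A.gMat p y).det • pou m M p ((extChartAt (𝓡 m) p).symm y)

theorem wt_nonneg (p : M) (y : Eu m) : 0 ≤ A.wt p y :=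
  mul_nonneg (Real.sqrt_nonneg _) ((pou m M).nonneg _ _)

theorem integrable_wt (p : M) :
    Integrable (A.wt p) (volume.restrict (extChartAt (𝓡 m) p).target) :=
  A.integrableOn_chart (continuous_pou p) (tsupport_pou p)

/-- The Riemannian volume. -/
def volM : Measure M := ∑ p ∈ pouIdx m M,
  ((volume.restrict (extChartAt (𝓡 m) p).target).withDensity
    fun y => ENNReal.ofReal (A.wt p y)).map (extChartAt (𝓡 m) p).symm

instance : IsFiniteMeasure A.volM := by
  have : ∀ p, IsFiniteMeasure (((volume.restrict (extChartAt (𝓡 m) p).target).withDensity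
    fun y => ENNReal.ofReal (A.wt p y)).map (extChartAt (𝓡 m) p).symm) := fun p => by
    have := isFiniteMeasure_withDensity_ofReal (A.integrable_wt p).2
    infer_instance
  unfold volM
  infer_instance

theorem integrable_volM {f : M → G} (hf : Continuous f) : Integrable f A.volM := by
  have := ChartedSpace.secondCountable_of_sigmaCompact (Eu m) M
  obtain ⟨C, hC⟩ := (isCompact_univ (X := M)).exists_bound_of_continuousOn hf.continuousOn
  exact Integrable.of_bound hf.aestronglyMeasurable C (.of_forall fun x => hC x trivial)

theorem integral_volM {f : M → G} (hf : Continuous f) :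
    ∫ x, f x ∂A.volM = ∑ p ∈ pouIdx m M, A.chartInt p fun x => pou m M p x • f x := by
  have := ChartedSpace.secondCountable_of_sigmaCompact (Eu m) M
  have hint := A.integrable_volM hf
  unfold volM at hint ⊢
  rw [integrable_finsetSum_measure] at hint
  rw [integral_finsetSum_measure hint]
  refine Finset.sum_congr rfl fun p _ => ?_
  have hs : AEMeasurable (extChartAt (𝓡 m) p).symm
      ((volume.restrict (extChartAt (𝓡 m) p).target).withDensity
        fun y => ENNReal.ofReal (A.wt p y)) :=
    ((continuousOn_extChartAt_symm p).aemeasurable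
      (isOpen_extChartAt_target p).measurableSet).mono_ac (withDensity_absolutelyContinuous _ _)
  rw [integral_map hs hf.aestronglyMeasurable,
    integral_withDensity_eq_integral_toReal_smul₀
      (A.integrable_wt p).aestronglyMeasurable.aemeasurable.ennreal_ofReal (by simp)]
  refine integral_congr_ae (.of_forall fun y => ?_)
  simp only [ENNReal.toReal_ofReal (A.wt_nonneg p y)]
  rw [wt, smul_smul, smul_eq_mul]

theorem integral_act_of_tsupport (t : Fin n → ℝ) {q : M} {ψ : M → G} (hψ : Continuous ψ)
    (h : tsupport ψ ⊆ (chartAt (Eu m) q).source) :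
    ∫ x, ψ (A.act t x) ∂A.volM = A.chartInt q ψ := by
  have hact : ∀ x, A.act (-t) (A.act t x) = x := fun x => by
    rw [← A.act_add, neg_add_cancel, A.act_zero]
  rw [A.integral_volM (f := fun x => ψ (A.act t x)) (hψ.comp (A.contMDiff_act t).continuous)]
  have h1 : ∀ p : M, A.chartInt p (fun x => pou m M p x • ψ (A.act t x))
      = A.chartInt q fun x => pou m M p (A.act (-t) x) • ψ x := fun p => by
    rw [← A.chartInt_act t (p := p) (q := q)
      (ψ := fun x => pou m M p (A.act (-t) x) • ψ x)]
    · simp only [Function.comp_def, hact]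
    · exact fun x hx => h (subset_tsupport _ fun h0 => hx (by rw [h0, smul_zero]))
    · exact fun x hx => tsupport_pou p (subset_tsupport _ fun h0 => hx (by
        rw [hact, h0, zero_smul]))
  simp only [h1]
  unfold chartInt
  rw [← integral_finsetSum]
  · refine integral_congr_ae (.of_forall fun y => ?_)
    simp only
    rw [← Finset.smul_sum, ← Finset.sum_smul, sum_pou, one_smul]
  · intro p _
    refine A.integrableOn_chart (ψ := fun x => pou m M p (A.act (-t) x) • ψ x)
      (((continuous_pou p).comp (A.contMDiff_act (-t)).continuous).smul hψ) ?_
    exact (tsupport_smul_subset_right _ _).trans h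

theorem integral_of_tsupport {q : M} {ψ : M → G} (hψ : Continuous ψ)
    (h : tsupport ψ ⊆ (chartAt (Eu m) q).source) :
    ∫ x, ψ x ∂A.volM = A.chartInt q ψ := by
  rw [← A.integral_act_of_tsupport 0 hψ h]
  simp only [A.act_zero]

theorem integral_eq_sum_pou {f : M → G} (hf : Continuous f) :
    ∫ x, f x ∂A.volM = ∑ p ∈ pouIdx m M, ∫ x, pou m M p x • f x ∂A.volM := by
  rw [← integral_finsetSum]
  · simp only [sum_pou_smul]
  · exact fun p _ => A.integrable_volM ((continuous_pou p).smul hf)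

theorem integral_act (t : Fin n → ℝ) {f : M → G} (hf : Continuous f) :
    ∫ x, f (A.act t x) ∂A.volM = ∫ x, f x ∂A.volM := by
  have hc : ∀ p : M, Continuous fun x => pou m M p x • f x := fun p => (continuous_pou p).smul hf
  rw [A.integral_eq_sum_pou hf, ← Finset.sum_congr rfl fun p _ =>
    (A.integral_act_of_tsupport t (hc p) (tsupport_pou_smul p f)).trans
      (A.integral_of_tsupport (hc p) (tsupport_pou_smul p f)).symm, ← integral_finsetSum]
  · simp only [sum_pou_smul]
  · exact fun p _ => A.integrable_volM ((hc p).comp (A.contMDiff_act t).continuous)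

theorem integral_eq {f : M → ℂ} (hf : Continuous f) : A.integral f = ∫ x, f x ∂A.volM := by
  rw [A.integral_volM hf, integral]
  have h1 : ∀ p : M, (∫ y in (extChartAt (𝓡 m) p).target,
      ((pou m M p ((extChartAt (𝓡 m) p).symm y) * √(A.gMat p y).det : ℝ) : ℂ)
      * f ((extChartAt (𝓡 m) p).symm y)) = A.chartInt p fun x => pou m M p x • f x := fun p => by
    refine integral_congr_ae (.of_forall fun y => ?_)
    simp only [Complex.real_smul]
    push_cast
    ring
  refine (finsum_congr h1).trans (finsum_eq_sum_of_support_subset _ fun p hp => ?_)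
  by_contra h
  refine hp ?_
  simp [chartInt, pou_eq_zero h]

/-- The volume charges every non-empty open set. -/
theorem eq_zero_of_integral_eq_zero {f : M → ℝ} (hf : Continuous f) (h0 : ∀ x, 0 ≤ f x)
    (h : ∫ x, f x ∂A.volM = 0) (x : M) : f x = 0 := by
  by_contra hx
  obtain ⟨p, hp, hpx⟩ : ∃ p ∈ pouIdx m M, pou m M p x ≠ 0 := by
    by_contra! hn
    have := sum_pou (m := m) x
    rw [Finset.sum_eq_zero hn] at this
    exact zero_ne_one this
  have hc : Continuous fun x => pou m M p x • f x := (continuous_pou p).smul hf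
  have hle : ∫ x, pou m M p x • f x ∂A.volM ≤ 0 := by
    rw [← h]
    refine integral_mono (A.integrable_volM hc) (A.integrable_volM hf) fun z => ?_
    simpa using mul_le_mul_of_nonneg_right ((pou m M).le_one p z) (h0 z)
  rw [A.integral_of_tsupport hc (tsupport_pou_smul p f), chartInt] at hle
  have hxs : x ∈ (extChartAt (𝓡 m) p).source := by
    rw [extChartAt_source]
    exact tsupport_pou p (subset_tsupport _ hpx)
  have hco : ContinuousOn (fun y => √(A.gMat p y).det •
      (pou m M p ((extChartAt (𝓡 m) p).symm y) • f ((extChartAt (𝓡 m) p).symm y)))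
      (extChartAt (𝓡 m) p).target :=
    (A.contDiffOn_sqrt_det p).continuousOn.smul
      (hc.comp_continuousOn (continuousOn_extChartAt_symm p))
  have hnn : ∀ y, 0 ≤ √(A.gMat p y).det •
      (pou m M p ((extChartAt (𝓡 m) p).symm y) • f ((extChartAt (𝓡 m) p).symm y)) := fun y =>
    mul_nonneg (Real.sqrt_nonneg _) (mul_nonneg ((pou m M).nonneg _ _) (h0 _))
  refine absurd hle (not_le.2 ?_)
  rw [setIntegral_pos_iff_support_of_nonneg_ae (.of_forall hnn)
    (A.integrableOn_chart hc (tsupport_pou_smul p f))]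
  have hopen : IsOpen ((extChartAt (𝓡 m) p).target ∩ (fun y => √(A.gMat p y).det •
      (pou m M p ((extChartAt (𝓡 m) p).symm y) • f ((extChartAt (𝓡 m) p).symm y))) ⁻¹' {0}ᶜ) :=
    hco.isOpen_inter_preimage (isOpen_extChartAt_target p) isOpen_compl_singleton
  have hmem := (extChartAt (𝓡 m) p).map_source hxs
  refine (hopen.measure_pos volume ⟨extChartAt (𝓡 m) p x, hmem, ?_⟩).trans_le
    (measure_mono fun y hy => ⟨hy.2, hy.1⟩)
  simp only [Set.mem_preimage, Set.mem_compl_iff, Set.mem_singleton_iff, smul_eq_mul,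
    (extChartAt (𝓡 m) p).left_inv hxs]
  exact mul_ne_zero (Real.sqrt_pos.2 (A.det_gMat_pos hmem)).ne' (mul_ne_zero hpx hx)

end Integral
end ToricManifold

/-! ### The divergence theorem in a chart -/

section Divergence

variable {m : ℕ} {G : Type*} [NormedAddCommGroup G] [NormedSpace ℝ G]

/-- Jacobi's formula. -/
theorem hasFDerivAt_det {ι E : Type*} [Fintype ι] [DecidableEq ι] [NormedAddCommGroup E]
    [NormedSpace ℝ E] {A : E → Matrix ι ι ℝ} {A' : ι → ι → E →L[ℝ] ℝ} {y : E}
    (h : ∀ i j, HasFDerivAt (fun z => A z i j) (A' i j) y) :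
    HasFDerivAt (fun z => (A z).det) (∑ i, ∑ j, (A y).adjugate j i • A' i j) y := by
  let D : ContinuousMultilinearMap ℝ (fun _ : ι => ι → ℝ) ℝ :=
    { (Matrix.detRowAlternating (R := ℝ) (n := ι)).toMultilinearMap with
      cont := (continuous_id (X := Matrix ι ι ℝ)).matrix_det }
  have hA : HasFDerivAt (fun z i j => A z i j)
      (ContinuousLinearMap.pi fun i => ContinuousLinearMap.pi fun j => A' i j) y :=
    hasFDerivAt_pi.2 fun i => hasFDerivAt_pi.2 fun j => h i j
  refine ((D.hasFDerivAt (fun i j => A y i j)).comp y hA).congr_fderiv ?_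
  ext u
  rw [ContinuousLinearMap.comp_apply, ContinuousMultilinearMap.linearDeriv_apply]
  simp only [sum_apply, smul_apply, smul_eq_mul]
  refine Finset.sum_congr rfl fun i _ => ?_
  have h1 := Matrix.cramer_transpose_apply (A y) (fun j => A' i j u) i
  rw [Matrix.cramer_eq_adjugate_mulVec, ← Matrix.adjugate_transpose] at h1
  exact h1.symm

variable {g : Eu m → Eu m →L[ℝ] Eu m →L[ℝ] ℝ} {U : Set (Eu m)}

theorem IsMetricOn.hasFDerivAt_gram (h : IsMetricOn g U) {y : Eu m} (hy : y ∈ U) (i j : Fin m) :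
    HasFDerivAt (fun z => gram (g z) i j) (fderiv ℝ (fun z => gram (g z) i j) y) y :=
  (((h.contDiffOn_gram i j).contDiffAt (h.isOpen.mem_nhds hy)).differentiableAt
    (by simp)).hasFDerivAt

theorem IsMetricOn.hasFDerivAt_gram_inv (h : IsMetricOn g U) {y : Eu m} (hy : y ∈ U)
    (i j : Fin m) : HasFDerivAt (fun z => (gram (g z))⁻¹ i j)
      (fderiv ℝ (fun z => (gram (g z))⁻¹ i j) y) y :=
  (((h.contDiffOn_gram_inv i j).contDiffAt (h.isOpen.mem_nhds hy)).differentiableAt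
    (by simp)).hasFDerivAt

/-- The matrix `∂ᵤ gᵢⱼ`. -/
def dgram (g : Eu m → Eu m →L[ℝ] Eu m →L[ℝ] ℝ) (y u : Eu m) : Matrix (Fin m) (Fin m) ℝ :=
  Matrix.of fun i j => fderiv ℝ (fun z => gram (g z) i j) y u

theorem IsMetricOn.fderiv_gram_inv (h : IsMetricOn g U) {y : Eu m} (hy : y ∈ U) (i j : Fin m)
    (u : Eu m) : fderiv ℝ (fun z => (gram (g z))⁻¹ i j) y u
      = -((gram (g y))⁻¹ * dgram g y u * (gram (g y))⁻¹) i j := by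
  have hu := h.isUnit_det hy
  set N' : Matrix (Fin m) (Fin m) ℝ :=
    Matrix.of fun i j => fderiv ℝ (fun z => (gram (g z))⁻¹ i j) y u with hN'
  have h1 : gram (g y) * N' + dgram g y u * (gram (g y))⁻¹ = 0 := by
    ext a b
    have h2 := HasFDerivAt.fun_sum (u := Finset.univ) fun (c : Fin m) _ =>
      (h.hasFDerivAt_gram hy a c).fun_mul (h.hasFDerivAt_gram_inv hy c b)
    have h3 : HasFDerivAt (fun z => ∑ c, gram (g z) a c * (gram (g z))⁻¹ c b)
        (0 : Eu m →L[ℝ] ℝ) y := by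
      refine (hasFDerivAt_const ((1 : Matrix (Fin m) (Fin m) ℝ) a b) y).congr_of_eventuallyEq ?_
      filter_upwards [h.isOpen.mem_nhds hy] with z hz
      rw [← Matrix.mul_nonsing_inv _ (h.isUnit_det hz), Matrix.mul_apply]
    have h4 := congrArg (fun T : Eu m →L[ℝ] ℝ => T u) (h2.unique h3)
    simp only [sum_apply, add_apply, smul_apply, smul_eq_mul, Finset.sum_add_distrib,
      zero_apply] at h4
    simp only [Matrix.add_apply, Matrix.mul_apply, Matrix.zero_apply, hN', dgram, Matrix.of_apply]
    rw [← h4]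
    congr 1
    exact Finset.sum_congr rfl fun c _ => mul_comm _ _
  have h2 : N' = -((gram (g y))⁻¹ * dgram g y u * (gram (g y))⁻¹) := by
    have h3 := congrArg (fun X => (gram (g y))⁻¹ * X) (eq_neg_of_add_eq_zero_left h1)
    simp only [← mul_assoc, Matrix.nonsing_inv_mul _ hu, one_mul, mul_neg] at h3
    exact h3
  exact congrFun (congrFun h2 i) j

/-- The volume density `√det g`. -/
def sdet (g : Eu m → Eu m →L[ℝ] Eu m →L[ℝ] ℝ) (y : Eu m) : ℝ := √(gram (g y)).det

theorem IsMetricOn.hasFDerivAt_sdet (h : IsMetricOn g U) {y : Eu m} (hy : y ∈ U) :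
    HasFDerivAt (sdet g) (fderiv ℝ (sdet g) y) y ∧ ∀ u, fderiv ℝ (sdet g) y u
      = 1 / 2 * sdet g y * ∑ a, ∑ b, (gram (g y))⁻¹ a b * dgram g y u a b := by
  have hpos := (h.posDef hy).det_pos
  have h1 := (hasFDerivAt_det (h.hasFDerivAt_gram hy)).sqrt hpos.ne'
  have h2 : HasFDerivAt (sdet g) _ y := h1
  refine ⟨h2.differentiableAt.hasFDerivAt, fun u => ?_⟩
  rw [h2.fderiv]
  have hs : (gram (g y)).IsSymm := by
    ext i j
    exact h.symm y hy _ _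
  have h3 : ∀ a b, (gram (g y)).adjugate b a = (gram (g y)).det * (gram (g y))⁻¹ a b := by
    intro a b
    have h4 : (gram (g y))⁻¹ a b = (gram (g y))⁻¹ b a := by
      conv_lhs => rw [← hs.eq, ← Matrix.transpose_nonsing_inv]
      rfl
    rw [h4, Matrix.inv_def, Matrix.smul_apply, Ring.inverse_eq_inv', smul_eq_mul,
      mul_inv_cancel_left₀ hpos.ne']
  simp only [smul_apply, sum_apply, smul_eq_mul, h3, mul_assoc, ← Finset.mul_sum]
  have h5 : sdet g y * sdet g y = (gram (g y)).det := Real.mul_self_sqrt hpos.le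
  have h6 : sdet g y ≠ 0 := (Real.sqrt_pos.2 hpos).ne'
  change 1 / (2 * sdet g y) * _ = _
  rw [← h5]
  field_simp
  rfl

/-- `∂ᵢ(√g gⁱʲ) = -√g gⁱᵏ Γʲᵢₖ`. -/
theorem IsMetricOn.div_gram_inv (h : IsMetricOn g U) {y : Eu m} (hy : y ∈ U) (j : Fin m) :
    ∑ i, fderiv ℝ (fun z => sdet g z * (gram (g z))⁻¹ i j) y (e i)
      = -(sdet g y * ∑ i, ∑ k, (gram (g y))⁻¹ i k * chr (fun z => gram (g z)) j i k y) := by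
  obtain ⟨hs1, hs2⟩ := h.hasFDerivAt_sdet hy
  have hsymm : (gram (g y)).IsSymm := by
    ext i j
    exact h.symm y hy _ _
  set N := (gram (g y))⁻¹ with hN
  have hNs : ∀ a b, N a b = N b a := fun a b => by
    conv_lhs => rw [hN, ← hsymm.eq, ← Matrix.transpose_nonsing_inv]
    rfl
  set D := fun l => dgram g y (e l) with hD
  set S1 := ∑ i, ∑ a, ∑ b, N i a * D i a b * N b j with hS1
  set S2 := ∑ l, ∑ a, ∑ b, N a b * D l a b * N l j with hS2
  have hL : ∑ i, fderiv ℝ (fun z => sdet g z * (gram (g z))⁻¹ i j) y (e i)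
      = sdet g y * (1 / 2 * S2 - S1) := by
    have h1 : ∀ i, fderiv ℝ (fun z => sdet g z * (gram (g z))⁻¹ i j) y (e i)
        = sdet g y * (1 / 2 * (∑ a, ∑ b, N a b * D i a b * N i j)
          - ∑ a, ∑ b, N i a * D i a b * N b j) := fun i => by
      rw [(hs1.fun_mul (h.hasFDerivAt_gram_inv hy i j)).fderiv]
      simp only [add_apply, smul_apply, smul_eq_mul, hs2, h.fderiv_gram_inv hy]
      have h2 : ∑ a, ∑ b, N i a * D i a b * N b j = (N * D i * N) i j := by
        rw [Matrix.mul_apply, Finset.sum_comm]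
        simp only [Matrix.mul_apply, Finset.sum_mul]
      rw [h2]
      simp only [← Finset.sum_mul]
      ring
    rw [Finset.sum_congr rfl fun i _ => h1 i, ← Finset.mul_sum, Finset.sum_sub_distrib,
      ← Finset.mul_sum]
  rw [hL]
  have hR : ∑ i, ∑ k, N i k * chr (fun z => gram (g z)) j i k y = 1 / 2 * (S1 + S1 - S2) := by
    have e1 : ∑ i, ∑ k, ∑ l, N i k * (N j l * D i k l) = S1 :=
      Finset.sum_congr rfl fun i _ => Finset.sum_congr rfl fun k _ => Finset.sum_congr rfl
        fun l _ => by rw [hNs j l]; ring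
    have e2 : ∑ i, ∑ k, ∑ l, N i k * (N j l * D k i l) = S1 := by
      rw [Finset.sum_comm]
      exact Finset.sum_congr rfl fun i _ => Finset.sum_congr rfl fun k _ => Finset.sum_congr rfl
        fun l _ => by rw [hNs j l, hNs k i]; ring
    have e3 : ∑ i, ∑ k, ∑ l, N i k * (N j l * D l i k) = S2 := by
      rw [hS2, Finset.sum_congr rfl fun i _ => Finset.sum_comm, Finset.sum_comm]
      exact Finset.sum_congr rfl fun l _ => Finset.sum_congr rfl fun i _ => Finset.sum_congr rfl
        fun k _ => by rw [hNs j l]; ring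
    rw [← e3]
    nth_rw 1 [← e1]
    rw [← e2]
    simp only [← Finset.sum_add_distrib, ← Finset.sum_sub_distrib, Finset.mul_sum]
    refine Finset.sum_congr rfl fun i _ => Finset.sum_congr rfl fun k _ => ?_
    rw [chr, Finset.mul_sum, Finset.mul_sum]
    refine Finset.sum_congr rfl fun l _ => ?_
    simp only [hD, dgram, Matrix.of_apply]
    ring
  rw [hR]
  ring

/-- Integration by parts for a function on `U` which is supported in a compact subset. -/
theorem integral_fderiv_eq_zero_of_support {f : Eu m → G} (hU : IsOpen U)
    (hf : ContDiffOn ℝ 1 f U) {K : Set (Eu m)} (hK : IsCompact K) (hKU : K ⊆ U)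
    (h0 : ∀ y ∈ U, y ∉ K → f y = 0) (v : Eu m) : ∫ y in U, fderiv ℝ f y v = 0 := by
  set F := U.indicator f with hF
  have hFU : ∀ y ∈ U, F =ᶠ[𝓝 y] f := fun y hy => by
    filter_upwards [hU.mem_nhds hy] with z hz using Set.indicator_of_mem hz f
  have hFK : ∀ y ∉ K, F y = 0 := fun y hy => by
    by_cases h : y ∈ U
    · rw [hF, Set.indicator_of_mem h, h0 y h hy]
    · exact Set.indicator_of_notMem h f
  have hFs : ContDiff ℝ 1 F := contDiff_iff_contDiffAt.2 fun y => by
    by_cases h : y ∈ U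
    · exact (hf.contDiffAt (hU.mem_nhds h)).congr_of_eventuallyEq (hFU y h)
    · refine (contDiffAt_const (c := (0 : G))).congr_of_eventuallyEq ?_
      filter_upwards [hK.isClosed.isOpen_compl.mem_nhds fun h' => h (hKU h')] with z hz
        using hFK z hz
  have hFc : HasCompactSupport F := HasCompactSupport.intro hK hFK
  have hdc : Continuous fun y => fderiv ℝ F y v :=
    (hFs.continuous_fderiv one_ne_zero).clm_apply continuous_const
  have hds : HasCompactSupport fun y => fderiv ℝ F y v := hFc.fderiv_apply ℝ v
  have key := integral_bilinear_fderiv_right_eq_neg_left_of_integrable (μ := (volume : Measure (Eu m)))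
    (f := fun _ => (1 : ℝ)) (g := F) (v := v) (B := ContinuousLinearMap.lsmul ℝ ℝ)
    (by simp) (by simpa using hdc.integrable_of_hasCompactSupport hds)
    (by simpa using hFs.continuous.integrable_of_hasCompactSupport hFc)
    (fun _ _ => differentiableAt_const _)
    (fun y _ => (hFs.differentiable one_ne_zero) y)
  simp at key
  have hc := setIntegral_eq_integral_of_forall_compl_eq_zero (s := U) (μ := volume)
    (f := fun y => fderiv ℝ F y v) fun y hy => by
      have : F =ᶠ[𝓝 y] fun _ => 0 := by
        filter_upwards [hK.isClosed.isOpen_compl.mem_nhds fun h' => hy (hKU h')] with z hz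
          using hFK z hz
      rw [this.fderiv_eq]
      simp
  rw [← key, ← hc]
  exact setIntegral_congr_fun hU.measurableSet fun y hy =>
    congrArg (fun T : Eu m →L[ℝ] G => T v) (hFU y hy).fderiv_eq.symm

/-- The bilinear map `(u, v) ↦ α(u)(β(v))`. -/
def pair {B : Type*} [NormedAddCommGroup B] [NormedSpace ℝ B] (α : Eu m →L[ℝ] B →L[ℝ] G)
    (β : Eu m →L[ℝ] B) : Eu m →L[ℝ] Eu m →L[ℝ] G :=
  ((ContinuousLinearMap.compL ℝ (Eu m) B G).flip β).comp α

theorem pair_apply {B : Type*} [NormedAddCommGroup B] [NormedSpace ℝ B]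
    (α : Eu m →L[ℝ] B →L[ℝ] G) (β : Eu m →L[ℝ] B) (u v : Eu m) : pair α β u v = α u (β v) := rfl

/-- The divergence theorem in coordinates. -/
theorem IsMetricOn.integral_div {B : Type*} [NormedAddCommGroup B] [NormedSpace ℝ B]
    (h : IsMetricOn g U) {l : Eu m → B →L[ℝ] G} {H : Eu m → B} (hl : ContDiffOn ℝ ∞ l U)
    (hH : ContDiffOn ℝ ∞ H U) {K : Set (Eu m)} (hK : IsCompact K) (hKU : K ⊆ U)
    (h0 : ∀ y ∈ U, y ∉ K → l y = 0) :
    ∫ y in U, sdet g y • (gcontr (gram (g y)) (pair (fderiv ℝ l y) (fderiv ℝ H y))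
      + l y (gcontr (gram (g y)) (hessE g H y))) = 0 := by
  -- `X` is the vector field `√g g^{ij} ℓ(∂_j H)`, whose coordinate divergence is the integrand.
  set X : Fin m → Eu m → G := fun i y =>
    ∑ j, (sdet g y * (gram (g y))⁻¹ i j) • l y (fderiv ℝ H y (e j)) with hX
  have hs : ContDiffOn ℝ ∞ (sdet g) U :=
    (contDiffOn_det h.contDiffOn_gram).sqrt fun y hy => (h.posDef hy).det_pos.ne'
  have hdH : ContDiffOn ℝ ∞ (fderiv ℝ H) U := hH.fderiv_of_isOpen h.isOpen (by norm_cast)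
  have hXs : ∀ i, ContDiffOn ℝ ∞ (X i) U := fun i => ContDiffOn.sum fun j _ =>
    (hs.mul (h.contDiffOn_gram_inv i j)).smul (hl.clm_apply (hdH.clm_apply contDiffOn_const))
  have hX0 : ∀ i, ∀ y ∈ U, y ∉ K → X i y = 0 := fun i y hy hyK => by
    simp [hX, h0 y hy hyK]
  have hdiv : ∀ y ∈ U, ∑ i, fderiv ℝ (X i) y (e i)
      = sdet g y • (gcontr (gram (g y)) (pair (fderiv ℝ l y) (fderiv ℝ H y))
        + l y (gcontr (gram (g y)) (hessE g H y))) := by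
    intro y hy
    have dl : HasFDerivAt l (fderiv ℝ l y) y :=
      ((hl.contDiffAt (h.isOpen.mem_nhds hy)).differentiableAt (by simp)).hasFDerivAt
    have dH : HasFDerivAt (fderiv ℝ H) (fderiv ℝ (fderiv ℝ H) y) y :=
      ((hdH.contDiffAt (h.isOpen.mem_nhds hy)).differentiableAt (by simp)).hasFDerivAt
    have d1 : ∀ i, fderiv ℝ (X i) y (e i) = ∑ j,
        ((sdet g y * (gram (g y))⁻¹ i j) • (fderiv ℝ l y (e i) (fderiv ℝ H y (e j))
            + l y (fderiv ℝ (fderiv ℝ H) y (e i) (e j)))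
          + fderiv ℝ (fun z => sdet g z * (gram (g z))⁻¹ i j) y (e i)
            • l y (fderiv ℝ H y (e j))) := fun i => by
      have d2 : ∀ j, HasFDerivAt (fun z => sdet g z * (gram (g z))⁻¹ i j)
          (fderiv ℝ (fun z => sdet g z * (gram (g z))⁻¹ i j) y) y := fun j =>
        (((hs.mul (h.contDiffOn_gram_inv i j)).contDiffAt
          (h.isOpen.mem_nhds hy)).differentiableAt (by simp)).hasFDerivAt
      have d3 : HasFDerivAt (X i) _ y := HasFDerivAt.fun_sum fun j _ =>
        (d2 j).smul (dl.clm_apply (dH.clm_apply (hasFDerivAt_const (e j) y)))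
      rw [d3.fderiv]
      simp [sum_apply, add_comm]
    simp only [d1, Finset.sum_add_distrib]
    rw [Finset.sum_comm (f := fun i j => fderiv ℝ (fun z => sdet g z * (gram (g z))⁻¹ i j) y (e i)
            • l y (fderiv ℝ H y (e j)))]
    simp only [← Finset.sum_smul, h.div_gram_inv hy]
    have e1 : l y (gcontr (gram (g y)) (hessE g H y))
        = ∑ i, ∑ j, (gram (g y))⁻¹ i j • l y (fderiv ℝ (fderiv ℝ H) y (e i) (e j))
          - ∑ k, (∑ i, ∑ j, (gram (g y))⁻¹ i j * chr (fun z => gram (g z)) k i j y)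
            • l y (fderiv ℝ H y (e k)) := by
      simp only [gcontr, hessE_apply, Gam, christ_e, map_sum, map_smul, map_sub, smul_sub,
        Finset.sum_sub_distrib, Finset.smul_sum, smul_smul, Finset.sum_smul]
      congr 1
      rw [Finset.sum_congr rfl fun i _ => Finset.sum_comm, Finset.sum_comm]
    rw [e1, gcontr]
    simp only [pair_apply, smul_add, smul_sub, Finset.smul_sum, smul_smul, neg_smul,
      Finset.sum_add_distrib, Finset.sum_neg_distrib]
    abel
  rw [← setIntegral_congr_fun h.isOpen.measurableSet hdiv, integral_finsetSum]
  · exact Finset.sum_eq_zero fun i _ => integral_fderiv_eq_zero_of_support h.isOpen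
      ((hXs i).of_le (by norm_cast)) hK hKU (hX0 i) (e i)
  · intro i _
    have hc : ContinuousOn (fun y => fderiv ℝ (X i) y (e i)) U :=
      ((hXs i).continuousOn_fderiv_of_isOpen h.isOpen (by norm_cast)).clm_apply continuousOn_const
    refine ((hc.mono hKU).integrableOn_compact hK).of_forall_sdiff_eq_zero
      h.isOpen.measurableSet fun y hy => ?_
    have : X i =ᶠ[𝓝 y] fun _ => 0 := by
      filter_upwards [h.isOpen.mem_nhds hy.1, hK.isClosed.isOpen_compl.mem_nhds hy.2]
        with z hz hz' using hX0 i z hz hz'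
    rw [this.fderiv_eq]
    simp

end Divergence

/-! ### The divergence theorem on the manifold -/

section GlobalDivergence

variable {m n : ℕ} {M : Type*} [TopologicalSpace M] [ChartedSpace (Eu m) M]
  [IsManifold (𝓡 m) ∞ M] (A : ToricManifold m n M)
  {G B : Type*} [NormedAddCommGroup G] [NormedSpace ℝ G] [NormedAddCommGroup B] [NormedSpace ℝ B]

theorem hasFDerivAt_dM {V : Type*} [NormedAddCommGroup V] [NormedSpace ℝ V] {F : M → V}
    (hF : ContMDiff (𝓡 m) 𝓘(ℝ, V) ∞ F) (x : M) :
    HasFDerivAt (F ∘ (extChartAt (𝓡 m) x).symm) (dM F x) (extChartAt (𝓡 m) x x) :=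
  (((contDiffOn_comp_symm hF x).contDiffAt ((isOpen_extChartAt_target x).mem_nhds
    (mem_extChartAt_target x))).differentiableAt (by simp)).hasFDerivAt

theorem dM_add {V : Type*} [NormedAddCommGroup V] [NormedSpace ℝ V] {F F' : M → V}
    (hF : ContMDiff (𝓡 m) 𝓘(ℝ, V) ∞ F) (hF' : ContMDiff (𝓡 m) 𝓘(ℝ, V) ∞ F') (x : M) :
    dM (m := m) (fun x => F x + F' x) x = dM F x + dM F' x :=
  ((hasFDerivAt_dM hF x).add (hasFDerivAt_dM hF' x)).fderiv

theorem dM_eq_zero {V : Type*} [NormedAddCommGroup V] [NormedSpace ℝ V] {F : M → V} {x : M}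
    (hx : x ∉ tsupport F) : dM (m := m) F x = 0 := by
  have h1 : F ∘ (extChartAt (𝓡 m) x).symm =ᶠ[𝓝 (extChartAt (𝓡 m) x x)] fun _ => 0 := by
    have h2 := (continuousAt_extChartAt_symm (I := 𝓡 m) x)
    have h3 : (tsupport F)ᶜ ∈ 𝓝 ((extChartAt (𝓡 m) x).symm (extChartAt (𝓡 m) x x)) := by
      rw [extChartAt_to_inv]
      exact (isClosed_tsupport F).isOpen_compl.mem_nhds hx
    filter_upwards [h2.preimage_mem_nhds h3] with y hy using
      image_eq_zero_of_notMem_tsupport (f := F) hy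
  rw [dM, h1.fderiv_eq]
  simp

namespace ToricManifold

/-- The function `⟨dℓ, dH⟩ + ℓ(ΔH)`, the divergence of the one-form `ℓ(dH)`. -/
def divM (l : M → B →L[ℝ] G) (H : M → B) (x : M) : G :=
  A.contrM (fun x => pair (dM l x) (dM H x)) x + l x (A.contrM (A.hessM H) x)

theorem contMDiff_contrM_hessM {H : M → B} (hH : ContMDiff (𝓡 m) 𝓘(ℝ, B) ∞ H) :
    ContMDiff (𝓡 m) 𝓘(ℝ, B) ∞ (A.contrM (A.hessM H)) :=
  A.contMDiff_contrM (fun p => hessE (A.gForm p) (H ∘ (extChartAt (𝓡 m) p).symm))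
    (fun p => (A.isMetricOn_gForm p).contDiffOn_hessE (contDiffOn_comp_symm hH p))
    fun _ _ hx => A.hessE_transfer hx hH

theorem contDiffOn_pair {E : Type*} [NormedAddCommGroup E] [NormedSpace ℝ E] {s : Set E}
    {k : WithTop ℕ∞} {α : E → Eu m →L[ℝ] B →L[ℝ] G} {β : E → Eu m →L[ℝ] B}
    (hα : ContDiffOn ℝ k α s) (hβ : ContDiffOn ℝ k β s) :
    ContDiffOn ℝ k (fun y => pair (α y) (β y)) s :=
  ((ContinuousLinearMap.compL ℝ (Eu m) B G).flip.contDiff.comp_contDiffOn hβ).clm_comp hα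

theorem contMDiff_contrM_pair {l : M → B →L[ℝ] G} {H : M → B}
    (hl : ContMDiff (𝓡 m) 𝓘(ℝ, B →L[ℝ] G) ∞ l) (hH : ContMDiff (𝓡 m) 𝓘(ℝ, B) ∞ H) :
    ContMDiff (𝓡 m) 𝓘(ℝ, G) ∞ (A.contrM fun x => pair (dM l x) (dM H x)) :=
  A.contMDiff_contrM (fun p y => pair (fderiv ℝ (l ∘ (extChartAt (𝓡 m) p).symm) y)
      (fderiv ℝ (H ∘ (extChartAt (𝓡 m) p).symm) y))
    (fun p => contDiffOn_pair
      ((contDiffOn_comp_symm hl p).fderiv_of_isOpen (isOpen_extChartAt_target p) (by norm_cast))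
      ((contDiffOn_comp_symm hH p).fderiv_of_isOpen (isOpen_extChartAt_target p) (by norm_cast)))
    fun _ _ hx u v => by
      rw [pair_apply, pair_apply, A.fderiv_transfer hx hl, A.fderiv_transfer hx hH]

theorem continuous_divM {l : M → B →L[ℝ] G} {H : M → B}
    (hl : ContMDiff (𝓡 m) 𝓘(ℝ, B →L[ℝ] G) ∞ l) (hH : ContMDiff (𝓡 m) 𝓘(ℝ, B) ∞ H) :
    Continuous (A.divM l H) :=
  (A.contMDiff_contrM_pair hl hH).continuous.add
    (hl.continuous.clm_apply (A.contMDiff_contrM_hessM hH).continuous)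

/-- The divergence computed in any chart, not only in the one centred at the point. -/
theorem divM_eq_chart {l : M → B →L[ℝ] G} {H : M → B}
    (hl : ContMDiff (𝓡 m) 𝓘(ℝ, B →L[ℝ] G) ∞ l) (hH : ContMDiff (𝓡 m) 𝓘(ℝ, B) ∞ H) {p x : M}
    (hx : x ∈ (extChartAt (𝓡 m) p).source) : A.divM l H x
      = gcontr (gram (A.gForm p (extChartAt (𝓡 m) p x)))
          (pair (fderiv ℝ (l ∘ (extChartAt (𝓡 m) p).symm) (extChartAt (𝓡 m) p x))
            (fderiv ℝ (H ∘ (extChartAt (𝓡 m) p).symm) (extChartAt (𝓡 m) p x)))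
        + l x (gcontr (gram (A.gForm p (extChartAt (𝓡 m) p x)))
          (hessE (A.gForm p) (H ∘ (extChartAt (𝓡 m) p).symm) (extChartAt (𝓡 m) p x))) := by
  rw [A.gcontr_transfer hx (A.hessE_transfer hx hH),
    A.gcontr_transfer hx (b := pair (dM l x) (dM H x)) fun u v => by
      rw [pair_apply, pair_apply, A.fderiv_transfer hx hl, A.fderiv_transfer hx hH]]
  rfl

theorem divM_add {l l' : M → B →L[ℝ] G} {H : M → B}
    (hl : ContMDiff (𝓡 m) 𝓘(ℝ, B →L[ℝ] G) ∞ l) (hl' : ContMDiff (𝓡 m) 𝓘(ℝ, B →L[ℝ] G) ∞ l')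
    (x : M) : A.divM (fun x => l x + l' x) H x = A.divM l H x + A.divM l' H x := by
  simp only [divM, contrM, dM_add hl hl', add_apply]
  rw [show pair (dM l x + dM l' x) (dM H x) = pair (dM l x) (dM H x) + pair (dM l' x) (dM H x) by
    ext u v; simp [pair_apply], gcontr_add]
  abel

variable [T2Space M] [CompactSpace M] [MeasurableSpace M] [BorelSpace M]

theorem integral_divM_of_tsupport {l : M → B →L[ℝ] G} {H : M → B}
    (hl : ContMDiff (𝓡 m) 𝓘(ℝ, B →L[ℝ] G) ∞ l) (hH : ContMDiff (𝓡 m) 𝓘(ℝ, B) ∞ H) {p : M}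
    (h : tsupport l ⊆ (chartAt (Eu m) p).source) : ∫ x, A.divM l H x ∂A.volM = 0 := by
  have h1 : tsupport (A.divM l H) ⊆ tsupport l := by
    refine closure_minimal (fun x hx => ?_) (isClosed_tsupport l)
    by_contra h0
    refine hx ?_
    rw [divM, contrM, dM_eq_zero h0, image_eq_zero_of_notMem_tsupport h0]
    simp [gcontr, pair_apply]
  rw [A.integral_of_tsupport (A.continuous_divM hl hH) (h1.trans h), chartInt]
  have hK := isCompact_image_tsupport h
  have hKU : extChartAt (𝓡 m) p '' tsupport l ⊆ (extChartAt (𝓡 m) p).target := by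
    rintro _ ⟨x, hx, rfl⟩
    exact (extChartAt (𝓡 m) p).map_source (by rw [extChartAt_source]; exact h hx)
  rw [← (A.isMetricOn_gForm p).integral_div (contDiffOn_comp_symm hl p)
    (contDiffOn_comp_symm hH p) hK hKU fun y hy hyK => by
      by_contra h0
      exact hyK (mem_image_tsupport hy h0)]
  refine setIntegral_congr_fun (isOpen_extChartAt_target p).measurableSet fun y hy => ?_
  have h2 := A.divM_eq_chart hl hH ((extChartAt (𝓡 m) p).map_target hy)
  rw [(extChartAt (𝓡 m) p).right_inv hy] at h2
  simp only [h2]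
  rfl

/-- The divergence theorem on `M`. -/
theorem integral_divM {l : M → B →L[ℝ] G} {H : M → B}
    (hl : ContMDiff (𝓡 m) 𝓘(ℝ, B →L[ℝ] G) ∞ l) (hH : ContMDiff (𝓡 m) 𝓘(ℝ, B) ∞ H) :
    ∫ x, A.divM l H x ∂A.volM = 0 := by
  have hs : ∀ p : M, ContMDiff (𝓡 m) 𝓘(ℝ, B →L[ℝ] G) ∞ fun x => pou m M p x • l x :=
    fun p => (pou m M p).contMDiff.smul hl
  have key : ∀ s : Finset M, ContMDiff (𝓡 m) 𝓘(ℝ, B →L[ℝ] G) ∞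
      (fun x => ∑ p ∈ s, pou m M p x • l x) ∧
      ∫ x, A.divM (fun x => ∑ p ∈ s, pou m M p x • l x) H x ∂A.volM = 0 := by
    classical
    intro s
    induction s using Finset.induction_on with
    | empty =>
      simp only [Finset.sum_empty]
      have h0 : ContMDiff (𝓡 m) 𝓘(ℝ, B →L[ℝ] G) ∞ fun _ : M => (0 : B →L[ℝ] G) :=
        contMDiff_const
      refine ⟨h0, ?_⟩
      have := A.divM_add (H := H) h0 h0
      simp only [add_zero, left_eq_add] at this
      simp [this]
    | insert p s hp ih =>
      simp only [Finset.sum_insert hp]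
      refine ⟨(hs p).add ih.1, ?_⟩
      simp only [A.divM_add (hs p) ih.1]
      rw [integral_add (A.integrable_volM (A.continuous_divM (hs p) hH))
        (A.integrable_volM (A.continuous_divM ih.1 hH)), ih.2, add_zero]
      exact A.integral_divM_of_tsupport (hs p) hH (tsupport_pou_smul p l)
  have h1 := (key (pouIdx m M)).2
  simpa only [sum_pou_smul] using h1

end ToricManifold
end GlobalDivergence

/-! ### Functional calculus on tensors -/

section TensorCalculus

variable {m : ℕ} {V : Type*} [NormedAddCommGroup V] [NormedSpace ℝ V]

/-- The bilinear map with prescribed values on the standard basis. -/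
def bilinE (f : Fin m → Fin m → V) : Eu m →L[ℝ] Eu m →L[ℝ] V :=
  ∑ i, ∑ j, (cov i).smulRight ((cov j).smulRight (f i j))

theorem bilinE_e (f : Fin m → Fin m → V) (i j : Fin m) : bilinE f (e i) (e j) = f i j := by
  simp [bilinE, cov_apply, e_apply, sum_apply]

theorem bilinE_apply {F : Eu m → Eu m → V} (h₁ : ∀ v, IsLinearMap ℝ fun u => F u v)
    (h₂ : ∀ u, IsLinearMap ℝ (F u)) (u v : Eu m) :
    bilinE (fun i j => F (e i) (e j)) u v = F u v := by
  have e1 : F u v = ∑ i, ∑ j, u i • v j • F (e i) (e j) := by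
    conv_lhs => rw [← sum_smul_e u]
    rw [show F (∑ i, u i • e i) v = (h₁ v).mk' _ (∑ i, u i • e i) from rfl, map_sum]
    refine Finset.sum_congr rfl fun i _ => ?_
    rw [map_smul, ← Finset.smul_sum]
    congr 1
    change F (e i) v = _
    conv_lhs => rw [← sum_smul_e v]
    rw [show F (e i) (∑ j, v j • e j) = (h₂ (e i)).mk' _ (∑ j, v j • e j) from rfl, map_sum]
    exact Finset.sum_congr rfl fun j _ => map_smul _ _ _
  rw [e1]
  simp [bilinE, cov_apply, sum_apply]

theorem contDiffOn_bilinE {E : Type*} [NormedAddCommGroup E] [NormedSpace ℝ E]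
    {f : E → Fin m → Fin m → V} {s : Set E} {k : WithTop ℕ∞}
    (h : ∀ i j, ContDiffOn ℝ k (fun y => f y i j) s) :
    ContDiffOn ℝ k (fun y => bilinE (f y)) s :=
  ContDiffOn.sum fun i _ => ContDiffOn.sum fun j _ =>
    (ContinuousLinearMap.smulRightL ℝ (Eu m) (Eu m →L[ℝ] V) (cov i)).contDiff.comp_contDiffOn
      ((ContinuousLinearMap.smulRightL ℝ (Eu m) V (cov j)).contDiff.comp_contDiffOn (h i j))

variable {B : Type*} [NormedRing B] [NormedAlgebra ℝ B] [CompleteSpace B]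

/-- The two-variable functional calculus on a pair of one-forms. -/
def bcalcT (H : ℝ → ℝ → ℝ) (h : B) (α β : Eu m →L[ℝ] B) : Eu m →L[ℝ] Eu m →L[ℝ] B :=
  bilinE fun i j => bcalc H h (α (e i)) (β (e j))

/-- The one-variable functional calculus on a two-tensor. -/
def kcalcT (W : ℝ → ℝ) (h : B) (b : Eu m →L[ℝ] Eu m →L[ℝ] B) : Eu m →L[ℝ] Eu m →L[ℝ] B :=
  bilinE fun i j => bcalc (fun s _ => W s) h (b (e i) (e j)) 1

theorem bcalcT_apply {H : ℝ → ℝ → ℝ} (hH : IsExp H) (h : B) (α β : Eu m →L[ℝ] B) (u v : Eu m) :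
    bcalcT H h α β u v = bcalc H h (α u) (β v) :=
  bilinE_apply (F := fun u v => bcalc H h (α u) (β v))
    (fun v => ⟨fun x y => by rw [map_add, hH.bcalc_add_left], fun c x => by
      rw [map_smul, hH.bcalc_smul_left]⟩)
    (fun u => ⟨fun x y => by rw [map_add, hH.bcalc_add_right], fun c x => by
      rw [map_smul, hH.bcalc_smul_right]⟩) u v

theorem kcalcT_apply {W : ℝ → ℝ} (hW : IsExp fun s _ => W s) (h : B)
    (b : Eu m →L[ℝ] Eu m →L[ℝ] B) (u v : Eu m) :
    kcalcT W h b u v = bcalc (fun s _ => W s) h (b u v) 1 :=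
  bilinE_apply (F := fun u v => bcalc (fun s _ => W s) h (b u v) 1)
    (fun v => ⟨fun x y => by rw [map_add, add_apply, hW.bcalc_add_left], fun c x => by
      rw [map_smul, smul_apply, hW.bcalc_smul_left]⟩)
    (fun u => ⟨fun x y => by rw [map_add, hW.bcalc_add_left], fun c x => by
      rw [map_smul, hW.bcalc_smul_left]⟩) u v

theorem contDiffOn_bcalc {H : ℝ → ℝ → ℝ} (hH : IsExp H) {E : Type*} [NormedAddCommGroup E]
    [NormedSpace ℝ E] {s : Set E} {h y z : E → B}
    (hh : ContDiffOn ℝ ∞ h s) (hy : ContDiffOn ℝ ∞ y s) (hz : ContDiffOn ℝ ∞ z s) :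
    ContDiffOn ℝ ∞ (fun x => bcalc H (h x) (y x) (z x)) s := by
  have h1 := hH.contDiff_bcalc (B := B)
  generalize hF : (fun p : B × B × B => bcalc H p.1 p.2.1 p.2.2) = F at h1
  have h3 := h1.comp_contDiffOn (hh.prodMk (hy.prodMk hz))
  rw [← hF] at h3
  exact h3

theorem contDiffOn_bcalcT {H : ℝ → ℝ → ℝ} (hH : IsExp H) {E : Type*} [NormedAddCommGroup E]
    [NormedSpace ℝ E] {s : Set E} {h : E → B} {α β : E → Eu m →L[ℝ] B}
    (hh : ContDiffOn ℝ ∞ h s) (hα : ContDiffOn ℝ ∞ α s) (hβ : ContDiffOn ℝ ∞ β s) :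
    ContDiffOn ℝ ∞ (fun y => bcalcT H (h y) (α y) (β y)) s := by
  refine contDiffOn_bilinE (f := fun y i j => bcalc H (h y) (α y (e i)) (β y (e j))) fun i j => ?_
  have h1 : ContDiffOn ℝ ∞ (fun y => α y (e i)) s := hα.clm_apply contDiffOn_const
  have h2 : ContDiffOn ℝ ∞ (fun y => β y (e j)) s := hβ.clm_apply contDiffOn_const
  exact contDiffOn_bcalc hH hh h1 h2

theorem contDiffOn_kcalcT {W : ℝ → ℝ} (hW : IsExp fun s _ => W s) {E : Type*}
    [NormedAddCommGroup E] [NormedSpace ℝ E] {s : Set E} {h : E → B}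
    {b : E → Eu m →L[ℝ] Eu m →L[ℝ] B} (hh : ContDiffOn ℝ ∞ h s) (hb : ContDiffOn ℝ ∞ b s) :
    ContDiffOn ℝ ∞ (fun y => kcalcT W (h y) (b y)) s := by
  refine contDiffOn_bilinE
    (f := fun y i j => bcalc (fun s _ => W s) (h y) (b y (e i) (e j)) 1) fun i j => ?_
  have h1 : ContDiffOn ℝ ∞ (fun y => b y (e i)) s := hb.clm_apply contDiffOn_const
  have h2 : ContDiffOn ℝ ∞ (fun y => b y (e i) (e j)) s := h1.clm_apply contDiffOn_const
  exact contDiffOn_bcalc hW hh h2 contDiffOn_const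

/-- The derivative of `e^{-2jh}`. -/
theorem hasFDerivAt_bexp (j : ℝ) (h : B) :
    HasFDerivAt (fun h : B => bexp (-2 * j) h) (fderiv ℝ (fun h : B => bexp (-2 * j) h) h) h ∧
      ∀ a, fderiv ℝ (fun h : B => bexp (-2 * j) h) h a
        = bexp (-2 * j) h * bcalc (fun s _ => -2 * j * f₁ (-j * s)) h a 1 := by
  have hc : ContDiff ℝ ∞ fun h : B => bexp (-2 * j) h := by
    have := contDiff_bexp (B := B)
    exact this.comp (contDiff_const.prodMk contDiff_id)
  have h1 := (hc.differentiable (by simp) h).hasFDerivAt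
  refine ⟨h1, fun a => ?_⟩
  have hW : IsExp fun _ _ => (1 : ℝ) := isExp_const 1
  have e1 : ∀ k : B, modOp j (fun _ => 1) k 1 = bexp (-2 * j) k := fun k => by
    obtain ⟨μ, hμ⟩ := hW
    rw [modOp, hμ.bcalc_eq]
    simp only [modAut_one, mul_one]
    rw [integral_smul_const]
    have := hμ.eq 0 0
    simp only [mul_zero, add_zero, Real.exp_zero, mul_one] at this
    rw [← this, one_smul, mul_one]
  have h2 := hasDerivAt_modOp_line (B := B) hW j h a 1
  simp only [e1] at h2
  have h3 : HasDerivAt (fun ε : ℝ => h + ε • a) a 0 := by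
    simpa using ((hasDerivAt_id (0 : ℝ)).smul_const a).const_add h
  have h4 := (h1.comp_hasDerivAt_of_eq 0 h3 (by simp)).unique h2
  rw [h4]
  congr 1
  have e2 : bcalc (rightSymbol fun _ => (1 : ℝ)) h 1 a = 0 := by
    have : rightSymbol (fun _ => (1 : ℝ)) = fun s t => 0 * (1 : ℝ) := by
      funext s t
      by_cases ht : s + t = s
      · simp [rightSymbol, ht, dslope_same]
      · simp [rightSymbol, dslope_of_ne _ ht, slope]
    rw [this, hW.bcalc_const_mul, zero_smul]
  rw [e2, add_zero]
  congr 1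
  funext s t
  by_cases ht : s + t = t
  · simp [leftSymbol, ht, dslope_same]
  · simp [leftSymbol, dslope_of_ne _ ht, slope]

theorem hasFDerivAt_modOp {W : ℝ → ℝ} (hW : IsExp fun s _ => W s) (j : ℝ) (p : B × B) :
    HasFDerivAt (fun p : B × B => modOp j W p.1 p.2)
      (fderiv ℝ (fun p : B × B => modOp j W p.1 p.2) p) p :=
  ((contDiff_modOp hW j).differentiable (by simp) p).hasFDerivAt

end TensorCalculus

/-! ### Differentiation of integrals over the manifold -/

section ParametricIntegralManifold

variable {m n : ℕ} {M : Type*} [TopologicalSpace M] [ChartedSpace (Eu m) M]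
  [IsManifold (𝓡 m) ∞ M] (A : ToricManifold m n M) {V : Type*} [NormedAddCommGroup V]
  [NormedSpace ℝ V]
  [T2Space M] [CompactSpace M] [MeasurableSpace M] [BorelSpace M]

/-- Differentiation under the integral over `M`. -/
theorem ToricManifold.hasDerivAt_integral {f : ℝ → M → V} (F : M → ℝ × Eu m → V)
    (hF : ∀ p, ContDiffOn ℝ ∞ (F p) (Set.univ ×ˢ (extChartAt (𝓡 m) p).target))
    (hf : ∀ p, ∀ x ∈ (extChartAt (𝓡 m) p).source, ∀ ε, f ε x = F p (ε, extChartAt (𝓡 m) p x))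
    {f' : M → V} (hf' : ∀ x, HasDerivAt (fun ε => f ε x) (f' x) 0) :
    HasDerivAt (fun ε => ∫ x, f ε x ∂A.volM) (∫ x, f' x ∂A.volM) 0 := by
  have := ChartedSpace.secondCountable_of_sigmaCompact (Eu m) M
  have hopen : ∀ p : M, IsOpen (Set.univ ×ˢ (extChartAt (𝓡 m) p).target : Set (ℝ × Eu m)) :=
    fun p => isOpen_univ.prod (isOpen_extChartAt_target p)
  have hcont : ∀ ε, Continuous (f ε) := fun ε => by
    refine continuous_iff_continuousAt.2 fun p => ?_
    have h1 : ContinuousAt (fun x => F p (ε, extChartAt (𝓡 m) p x)) p :=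
      (((hF p).continuousOn).continuousAt ((hopen p).mem_nhds
        ⟨trivial, mem_extChartAt_target p⟩)).comp (f := fun x => (ε, extChartAt (𝓡 m) p x))
        (continuousAt_const.prodMk (continuousAt_extChartAt p))
    exact h1.congr (by
      filter_upwards [extChartAt_source_mem_nhds (I := 𝓡 m) p] with x hx using (hf p x hx ε).symm)
  have hd : ∀ p, ∀ x ∈ (extChartAt (𝓡 m) p).source, ∀ ε, HasDerivAt (fun ε => f ε x)
      (fderiv ℝ (F p) (ε, extChartAt (𝓡 m) p x) (1, 0)) ε := fun p x hx ε => by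
    have h1 : HasFDerivAt (F p) (fderiv ℝ (F p) (ε, extChartAt (𝓡 m) p x))
        (ε, extChartAt (𝓡 m) p x) :=
      (((hF p).contDiffAt ((hopen p).mem_nhds ⟨trivial,
        (extChartAt (𝓡 m) p).map_source hx⟩)).differentiableAt (by simp)).hasFDerivAt
    simp only [hf p x hx]
    exact h1.comp_hasDerivAt ε ((hasDerivAt_id ε).prodMk (hasDerivAt_const ε _))
  have hd' : ∀ x ε, HasDerivAt (fun ε => f ε x) (deriv (fun ε => f ε x) ε) ε := fun x ε =>
    (hd x x (mem_extChartAt_source x) ε).differentiableAt.hasDerivAt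
  have hc : Continuous fun z : ℝ × M => deriv (fun ε => f ε z.2) z.1 := by
    refine continuous_iff_continuousAt.2 fun ⟨ε, p⟩ => ?_
    have h1 : ContinuousOn (fun z => fderiv ℝ (F p) z (1, 0))
        (Set.univ ×ˢ (extChartAt (𝓡 m) p).target) :=
      ((hF p).continuousOn_fderiv_of_isOpen (hopen p) (by norm_cast)).clm_apply continuousOn_const
    have h2 : ContinuousAt (fun z : ℝ × M =>
        fderiv ℝ (F p) (z.1, extChartAt (𝓡 m) p z.2) (1, 0)) (ε, p) :=
      (h1.continuousAt ((hopen p).mem_nhds ⟨trivial, mem_extChartAt_target p⟩)).comp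
        (f := fun z : ℝ × M => (z.1, extChartAt (𝓡 m) p z.2)) (x := (ε, p))
        (continuousAt_fst.prodMk ((continuousAt_extChartAt (I := 𝓡 m) p).comp
          (f := Prod.snd) (x := (ε, p)) continuousAt_snd))
    refine h2.congr ?_
    filter_upwards [continuousAt_snd.preimage_mem_nhds (x := (ε, p))
      (extChartAt_source_mem_nhds (I := 𝓡 m) p)] with z hz using (hd p z.2 hz z.1).deriv.symm
  obtain ⟨C, hC⟩ := ((isCompact_Icc (a := (-1 : ℝ)) (b := 1)).prod
    (isCompact_univ (X := M))).exists_bound_of_continuousOn hc.continuousOn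
  have key := hasDerivAt_integral_of_dominated_loc_of_deriv_le (μ := A.volM) (F := f)
    (F' := fun ε x => deriv (fun ε => f ε x) ε) (x₀ := (0 : ℝ)) (s := Set.Icc (-1) 1)
    (bound := fun _ => C) (Icc_mem_nhds (by norm_num) (by norm_num))
    (.of_forall fun ε => (hcont ε).aestronglyMeasurable) (A.integrable_volM (hcont 0))
    (hc.comp (f := fun x : M => ((0 : ℝ), x)) (by fun_prop)).aestronglyMeasurable
    (.of_forall fun x ε hε => hC (ε, x) ⟨hε, trivial⟩) (integrable_const C)
    (.of_forall fun x ε _ => hd' x ε)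
  refine key.2.congr_deriv ?_
  exact integral_congr_ae (.of_forall fun x => (hf' x).deriv)

end ParametricIntegralManifold

/-! ### The action as a quadratic form -/

section Variation

variable {m n : ℕ} {M : Type*} [TopologicalSpace M] [ChartedSpace (Eu m) M]
  [IsManifold (𝓡 m) ∞ M] (A : ToricManifold m n M)
  {B : Type*} [NormedRing B] [NormedAlgebra ℝ B] [CompleteSpace B]
  {G : Type*} [NormedAddCommGroup G] [NormedSpace ℝ G] [CompleteSpace G] (τ : B →L[ℝ] G)

theorem hasFDerivAt_comp_symm {V W : Type*} [NormedAddCommGroup V] [NormedSpace ℝ V]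
    [NormedAddCommGroup W] [NormedSpace ℝ W] {F : M → V} {g : V → W} {g' : V →L[ℝ] W} {x : M}
    (hg : HasFDerivAt g g' (F x)) (hF : ContMDiff (𝓡 m) 𝓘(ℝ, V) ∞ F) :
    dM (m := m) (fun x => g (F x)) x = g'.comp (dM F x) := by
  have h1 : (F ∘ (extChartAt (𝓡 m) x).symm) (extChartAt (𝓡 m) x x) = F x := by
    simp only [Function.comp, extChartAt_to_inv]
  exact ((h1 ▸ hg : HasFDerivAt g g' ((F ∘ (extChartAt (𝓡 m) x).symm)
    (extChartAt (𝓡 m) x x))).comp _ (hasFDerivAt_dM hF x)).fderiv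

/-- The bilinear form `(u, v) ↦ τ(α(u) V(β(v)))` with `V = e^{-2jh} W(∇̸)`. -/
def energyForm (j : ℝ) (W : ℝ → ℝ) (h : B) (α β : Eu m →L[ℝ] B) : Eu m →L[ℝ] Eu m →L[ℝ] G :=
  bilinE fun i k => τ (α (e i) * modOp j W h (β (e k)))

theorem energyForm_apply {W : ℝ → ℝ} (hW : IsExp fun s _ => W s) (j : ℝ) (h : B)
    (α β : Eu m →L[ℝ] B) (u v : Eu m) :
    energyForm τ j W h α β u v = τ (α u * modOp j W h (β v)) :=
  bilinE_apply (F := fun u v => τ (α u * modOp j W h (β v)))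
    (fun v => ⟨fun x y => by simp only [map_add, add_mul], fun c x => by
      simp only [map_smul, smul_mul_assoc]⟩)
    (fun u => ⟨fun x y => by rw [map_add, modOp_add_right hW, mul_add, map_add],
      fun c x => by rw [map_smul, modOp_smul hW, mul_smul_comm, map_smul]⟩) u v

theorem ToricManifold.gram_ginn_isSymm (x : M) : (gram (A.ginn x)).IsSymm := by
  ext i k
  exact A.g.symm x _ _

theorem sum_gcontr_flip {V : Type*} [NormedAddCommGroup V] [NormedSpace ℝ V]
    {Q : Matrix (Fin m) (Fin m) ℝ} (hQ : Q.IsSymm) (f : Fin m → Fin m → V) :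
    ∑ i, ∑ k, Q⁻¹ i k • f k i = ∑ i, ∑ k, Q⁻¹ i k • f i k := by
  rw [Finset.sum_comm]
  have h : ∀ i j, Q⁻¹ i j = Q⁻¹ j i := fun i j => by
    conv_lhs => rw [← hQ.eq, ← Matrix.transpose_nonsing_inv]
    rfl
  exact Finset.sum_congr rfl fun i _ => Finset.sum_congr rfl fun k _ => by rw [h]

namespace ToricManifold

/-- The local expression `e^{-2jX}(K(∇̸)(∇²X) + H(∇̸,∇̸)(∇X ∇X))g⁻¹ + c e^{-2jX} S` for a function `X`
with values in a Banach algebra. -/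
def localB (j : ℝ) (K : ℝ → ℝ) (H : ℝ → ℝ → ℝ) (c : ℝ) (X : M → B) (x : M) : B :=
  bexp (-2 * j) (X x) * gcontr (gram (A.ginn x))
      (kcalcT K (X x) (A.hessM X x) + bcalcT H (X x) (dM X x) (dM X x))
    + (c * A.scalarCurvature x) • bexp (-2 * j) (X x)

variable [T2Space M] [CompactSpace M] [MeasurableSpace M] [BorelSpace M]

theorem integral_add_of_integral_eq_zero {Y D : M → G} (hD : Continuous D)
    (h0 : ∫ x, D x ∂A.volM = 0) : ∫ x, (Y x + D x) ∂A.volM = ∫ x, Y x ∂A.volM := by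
  have hi := A.integrable_volM hD
  by_cases hY : Integrable Y A.volM
  · rw [integral_add hY hi, h0, add_zero]
  · rw [integral_undef hY, integral_undef]
    exact fun h => hY ((integrable_add_iff_integrable_left hi).1 h)

end ToricManifold

/-- The functional `b ↦ τ(e^{-2jh} b)`. -/
def expFunctional (j : ℝ) (h : B) : B →L[ℝ] G :=
  τ.comp (ContinuousLinearMap.mul ℝ B (bexp (-2 * j) h))

theorem contDiff_expFunctional (j : ℝ) : ContDiff ℝ ∞ (expFunctional τ j) := by
  have hc : ContDiff ℝ ∞ fun h : B => bexp (-2 * j) h := contDiff_const.bexp le_rfl contDiff_id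
  exact (ContinuousLinearMap.compL ℝ B B G τ).contDiff.comp
    ((ContinuousLinearMap.mul ℝ B).contDiff.comp hc)

theorem fderiv_expFunctional (j : ℝ) (h a b : B) : fderiv ℝ (expFunctional τ j) h a b
    = τ (bexp (-2 * j) h * bcalc (fun s _ => -2 * j * f₁ (-j * s)) h a 1 * b) := by
  have h1 := (hasFDerivAt_bexp j h).1
  have h2 : HasFDerivAt (expFunctional τ j) _ h :=
    ((ContinuousLinearMap.compL ℝ B B G τ).comp (ContinuousLinearMap.mul ℝ B)).hasFDerivAt.comp h h1
  rw [h2.fderiv, ← (hasFDerivAt_bexp j h).2]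
  rfl

/-- The functional `b ↦ τ(a e^{-2jh} W(∇̸)(b))`. -/
def opFunctional (j : ℝ) (W : ℝ → ℝ) (a h : B) : B →L[ℝ] G :=
  τ.comp ((ContinuousLinearMap.mul ℝ B a).comp
    (fderiv ℝ (fun p : B × B => modOp j W p.1 p.2) (h, 0) |>.comp (ContinuousLinearMap.inr ℝ B B)))

theorem opFunctional_apply {W : ℝ → ℝ} (hW : IsExp fun s _ => W s) (j : ℝ) (a h b : B) :
    opFunctional τ j W a h b = τ (a * modOp j W h b) := by
  have hz : ∀ H : ℝ → ℝ → ℝ, IsExp H → ∀ y, bcalc H h 0 y = 0 ∧ bcalc H h y 0 = 0 := fun H hH y =>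
    ⟨by simpa using hH.bcalc_smul_left 0 h 0 y, by simpa using hH.bcalc_smul_right 0 h y 0⟩
  simp only [opFunctional, ContinuousLinearMap.comp_apply, ContinuousLinearMap.inr_apply,
    fderiv_modOp hW, (hz _ (isExp_leftSymbol hW j) _).1, (hz _ (isExp_rightSymbol hW) _).1,
    add_zero, mul_zero, zero_add, ContinuousLinearMap.mul_apply']

theorem contDiff_opFunctional {W : ℝ → ℝ} (hW : IsExp fun s _ => W s) (j : ℝ) :
    ContDiff ℝ ∞ fun p : B × B => opFunctional τ j W p.1 p.2 := by
  have h1 : ContDiff ℝ ∞ (fderiv ℝ fun p : B × B => modOp j W p.1 p.2) :=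
    (contDiff_modOp hW j).fderiv_right (m := ∞) (by norm_cast)
  have h2 : ContDiff ℝ ∞ fun p : B × B => fderiv ℝ (fun p : B × B => modOp j W p.1 p.2) (p.2, 0) :=
    h1.comp (contDiff_snd.prodMk contDiff_const)
  exact contDiff_const.clm_comp (((ContinuousLinearMap.mul ℝ B).contDiff.comp contDiff_fst).clm_comp
    (h2.clm_comp contDiff_const))

/-- The derivative of `(a, h) ↦ τ(a e^{-2jh} W(∇̸)(·))`. -/
theorem fderiv_opFunctional {W : ℝ → ℝ} (hW : IsExp fun s _ => W s) (j : ℝ) (a h a' h' b : B) :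
    fderiv ℝ (fun p : B × B => opFunctional τ j W p.1 p.2) (a, h) (a', h') b
      = τ (a' * modOp j W h b) + τ (a * (bexp (-2 * j) h *
        (bcalc (leftSymbol j W) h h' b + bcalc (rightSymbol W) h b h'))) := by
  have h1 := ((contDiff_opFunctional τ hW j).differentiable (by simp) (a, h)).hasFDerivAt
  have h2 : HasFDerivAt (fun p : B × B => opFunctional τ j W p.1 p.2 b) _ (a, h) :=
    h1.clm_apply (hasFDerivAt_const b (a, h))
  have h3 : HasFDerivAt (fun p : B × B => modOp j W p.2 b) _ (a, h) :=
    HasFDerivAt.comp (g := fun p : B × B => modOp j W p.1 p.2) (f := fun p : B × B => (p.2, b)) (a, h)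
      (hasFDerivAt_modOp hW j (h, b)) ((hasFDerivAt_snd (𝕜 := ℝ) (E := B) (F := B) (p := (a, h))).prodMk (hasFDerivAt_const b (a, h)))
  have h4 : HasFDerivAt (fun p : B × B => τ (p.1 * modOp j W p.2 b)) _ (a, h) :=
    τ.hasFDerivAt.comp (a, h) ((hasFDerivAt_fst (𝕜 := ℝ) (p := (a, h))).mul' h3)
  simp only [opFunctional_apply τ hW] at h2
  have h5 := DFunLike.congr_fun (h2.unique h4) (a', h')
  have h0 : modOp j W h 0 = 0 := by simpa using modOp_smul hW j 0 h (0 : B)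
  simpa [add_apply, fderiv_modOp hW, h0, add_comm] using h5


namespace ToricManifold

variable {j : ℝ} {X Y : M → B}

theorem contMDiff_expFunctional (j : ℝ) (hX : ContMDiff (𝓡 m) 𝓘(ℝ, B) ∞ X) :
    ContMDiff (𝓡 m) 𝓘(ℝ, B →L[ℝ] G) ∞ fun x => expFunctional τ j (X x) :=
  (contDiff_expFunctional τ j).contMDiff.comp hX

theorem contMDiff_opFunctional {W : ℝ → ℝ} (hW : IsExp fun s _ => W s) (j : ℝ)
    (hX : ContMDiff (𝓡 m) 𝓘(ℝ, B) ∞ X) (hY : ContMDiff (𝓡 m) 𝓘(ℝ, B) ∞ Y) :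
    ContMDiff (𝓡 m) 𝓘(ℝ, B →L[ℝ] G) ∞ fun x => opFunctional τ j W (Y x) (X x) :=
  ContMDiff.comp (g := fun p : B × B => opFunctional τ j W p.1 p.2) (f := fun x => (Y x, X x))
    (contDiff_opFunctional τ hW j).contMDiff (hY.prodMk_space hX)

/-- Up to a divergence, the trace of the local expression is a quadratic form in `∇X`. -/
theorem trace_localB (hτ : ∀ a b, τ (a * b) = τ (b * a)) {K W : ℝ → ℝ} {H : ℝ → ℝ → ℝ}
    (hK : IsExp fun s _ => K s) (hH : IsExp H) (hW : IsExp fun s _ => W s) (c : ℝ)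
    (hWe : ∀ s, W s = 2 * j * K 0 * f₁ (-j * s) + H s (-s))
    (hX : ContMDiff (𝓡 m) 𝓘(ℝ, B) ∞ X) (x : M) :
    τ (A.localB j K H c X x) = (gcontr (gram (A.ginn x)) (energyForm τ j W (X x) (dM X x) (dM X x))
      + (c * A.scalarCurvature x) • τ (bexp (-2 * j) (X x)))
      + K 0 • A.divM (fun x => expFunctional τ j (X x)) X x := by
  have hd := hasFDerivAt_comp_symm (x := x)
    ((contDiff_expFunctional τ j).differentiable (by simp) (X x)).hasFDerivAt hX
  have hV : IsExp fun s _ => -2 * j * f₁ (-j * s) :=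
    ((isExp_f₁.subst (-j) 0 0 0).const_mul (-2 * j)).congr fun s t => by ring_nf
  have hHs : IsExp fun s _ => H s (-s) := (hH.subst 1 0 (-1) 0).congr fun s t => by ring_nf
  have hWs : (fun s _ => W s : ℝ → ℝ → ℝ) =
      fun s _ => H s (-s) - K 0 * (-2 * j * f₁ (-j * s)) := by
    funext s _
    rw [hWe]
    ring
  -- The symmetry of the metric and the trace property interchange the two factors.
  have e1 : gcontr (gram (A.ginn x)) (energyForm τ j W (X x) (dM X x) (dM X x)) =
      ∑ i, ∑ k, (gram (A.ginn x))⁻¹ i k • τ (modOp j W (X x) (dM X x (e i)) * dM X x (e k)) := by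
    rw [← sum_gcontr_flip (A.gram_ginn_isSymm x), gcontr]
    refine Finset.sum_congr rfl fun i _ => Finset.sum_congr rfl fun k _ => ?_
    rw [energyForm_apply τ hW, hτ]
  rw [e1, divM, localB, contrM, contrM, hd]
  simp only [gcontr, map_add, map_smul, map_sum, expFunctional, ContinuousLinearMap.comp_apply,
    ContinuousLinearMap.mul_apply', kcalcT_apply hK, bcalcT_apply hH, add_apply, pair_apply,
    Finset.mul_sum, mul_smul_comm, mul_add, smul_add, Finset.smul_sum, hK.trace_bcalc_one τ hτ j,
    hH.trace_bcalc τ hτ j, modOp, hWs, hHs.bcalc_sub (hV.const_mul (K 0)), hV.bcalc_const_mul]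
  simp only [fderiv_expFunctional, mul_sub, sub_mul, map_sub, mul_smul_comm, smul_mul_assoc,
    map_smul, smul_sub, Finset.sum_add_distrib, Finset.sum_sub_distrib, smul_comm (K 0)]
  abel

end ToricManifold
end Variation

/-! ### The first variation -/

section FirstVariation

variable {m n : ℕ} {M : Type*} [TopologicalSpace M] [ChartedSpace (Eu m) M]
  [IsManifold (𝓡 m) ∞ M] (A : ToricManifold m n M)
  {B : Type*} [NormedRing B] [NormedAlgebra ℝ B] [CompleteSpace B]
  {G : Type*} [NormedAddCommGroup G] [NormedSpace ℝ G] [CompleteSpace G] (τ : B →L[ℝ] G)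

theorem contDiffOn_energyForm {W : ℝ → ℝ} (hW : IsExp fun s _ => W s) (j : ℝ) {E : Type*}
    [NormedAddCommGroup E] [NormedSpace ℝ E] {s : Set E} {h : E → B} {α β : E → Eu m →L[ℝ] B}
    (hh : ContDiffOn ℝ ∞ h s) (hα : ContDiffOn ℝ ∞ α s) (hβ : ContDiffOn ℝ ∞ β s) :
    ContDiffOn ℝ ∞ (fun y => energyForm τ j W (h y) (α y) (β y)) s := by
  refine contDiffOn_bilinE (f := fun y i k => τ (α y (e i) * modOp j W (h y) (β y (e k))))
    fun i k => ?_
  have h1 : ContDiffOn ℝ ∞ (fun y => α y (e i)) s := hα.clm_apply contDiffOn_const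
  have h2 : ContDiffOn ℝ ∞ (fun y => β y (e k)) s := hβ.clm_apply contDiffOn_const
  have h3 := contDiff_modOp (B := B) hW j
  generalize hF : (fun p : B × B => modOp j W p.1 p.2) = F at h3
  have h4 := h3.comp_contDiffOn (hh.prodMk h2)
  rw [← hF] at h4
  exact τ.contDiff.comp_contDiffOn (h1.mul h4)

theorem hasDerivAt_gcontr_energyForm {W : ℝ → ℝ} (hW : IsExp fun s _ => W s) (j : ℝ)
    (Q : Matrix (Fin m) (Fin m) ℝ) (h a : B) (α β : Eu m →L[ℝ] B) :
    HasDerivAt (fun ε : ℝ => gcontr Q (energyForm τ j W (h + ε • a) (α + ε • β) (α + ε • β)))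
      (∑ i, ∑ k, Q⁻¹ i k • (τ (β (e i) * modOp j W h (α (e k)))
        + τ (α (e i) * (bexp (-2 * j) h * (bcalc (leftSymbol j W) h a (α (e k))
          + bcalc (rightSymbol W) h (α (e k)) a) + modOp j W h (β (e k)))))) 0 := by
  unfold gcontr
  refine HasDerivAt.fun_sum fun i _ => HasDerivAt.fun_sum fun k _ => HasDerivAt.const_smul _ ?_
  simp only [energyForm_apply τ hW, add_apply, smul_apply]
  have hl : ∀ b c : B, HasDerivAt (fun ε : ℝ => b + ε • c) c 0 := fun b c => by
    simpa using ((hasDerivAt_id (0 : ℝ)).smul_const c).const_add b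
  have h1 := (hasFDerivAt_modOp hW j (h, α (e k))).comp_hasDerivAt_of_eq 0
    ((hl h a).prodMk (hl (α (e k)) (β (e k)))) (by simp)
  rw [fderiv_modOp hW] at h1
  have h2 := τ.hasFDerivAt.comp_hasDerivAt 0 ((hl (α (e i)) (β (e i))).mul h1)
  refine h2.congr_deriv ?_
  simp [Function.comp]

/-- The derivative of the quadratic form, with the variation `a` of `h` moved to the left by the
rotation rules of the trace. -/
theorem sum_energy_rotate (hτ : ∀ a b, τ (a * b) = τ (b * a)) {W : ℝ → ℝ}
    (hW : IsExp fun s _ => W s) (j : ℝ)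
    {Q : Matrix (Fin m) (Fin m) ℝ} (hQ : Q.IsSymm) (h a : B) (α β : Eu m →L[ℝ] B) :
    ∑ i, ∑ k, Q⁻¹ i k • (τ (β (e i) * modOp j W h (α (e k)))
        + τ (α (e i) * (bexp (-2 * j) h * (bcalc (leftSymbol j W) h a (α (e k))
          + bcalc (rightSymbol W) h (α (e k)) a) + modOp j W h (β (e k)))))
      = ∑ i, ∑ k, Q⁻¹ i k • τ (β (e i) * modOp j W h (α (e k)))
        + ∑ i, ∑ k, Q⁻¹ i k •
          τ (β (e i) * modOp j (fun s => W (-s) * Real.exp (-j * s)) h (α (e k)))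
        + ∑ i, ∑ k, Q⁻¹ i k • τ (a * (bexp (-2 * j) h *
          (bcalc (rotLeft j (leftSymbol j W)) h (α (e i)) (α (e k))
            + bcalc (rotRight j (rightSymbol W)) h (α (e i)) (α (e k))))) := by
  have e1 : ∀ y z, τ (z * (bexp (-2 * j) h * bcalc (leftSymbol j W) h a y)) =
      τ (a * (bexp (-2 * j) h * bcalc (rotLeft j (leftSymbol j W)) h y z)) := fun y z => by
    rw [hτ, (isExp_leftSymbol hW j).trace_rotate_left τ hτ j]
    rfl
  have e2 : ∀ y z, τ (z * (bexp (-2 * j) h * bcalc (rightSymbol W) h y a)) =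
      τ (a * (bexp (-2 * j) h * bcalc (rotRight j (rightSymbol W)) h z y)) := fun y z => by
    rw [hτ, (isExp_rightSymbol hW).trace_rotate_right τ hτ j]
    rfl
  have e3 : ∀ b z, τ (z * modOp j W h b) =
      τ (b * modOp j (fun s => W (-s) * Real.exp (-j * s)) h z) := fun b z => by
    rw [hτ, modOp, hW.trace_symm τ hτ j, modOp]
  simp only [mul_add, map_add, e1, e2, smul_add, Finset.sum_add_distrib]
  rw [← sum_gcontr_flip hQ fun i k => τ (β (e i) *
      modOp j (fun s => W (-s) * Real.exp (-j * s)) h (α (e k))),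
    ← sum_gcontr_flip hQ fun i k => τ (a * (bexp (-2 * j) h *
      bcalc (rotLeft j (leftSymbol j W)) h (α (e i)) (α (e k))))]
  simp only [fun i k => e3 (β (e i)) (α (e k))]
  abel

namespace ToricManifold

variable {j : ℝ} {X Y : M → B}

/-- The divergence of the one-form `τ(Y V(∇X))` with `V = e^{-2jX} W(∇̸)`. -/
theorem divM_opFunctional {W : ℝ → ℝ} (hW : IsExp fun s _ => W s) (j : ℝ)
    (hX : ContMDiff (𝓡 m) 𝓘(ℝ, B) ∞ X) (hY : ContMDiff (𝓡 m) 𝓘(ℝ, B) ∞ Y) (x : M) :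
    A.divM (fun x => opFunctional τ j W (Y x) (X x)) X x =
      ∑ i, ∑ k, (gram (A.ginn x))⁻¹ i k • τ (dM Y x (e i) * modOp j W (X x) (dM X x (e k)))
      + ∑ i, ∑ k, (gram (A.ginn x))⁻¹ i k • τ (Y x * (bexp (-2 * j) (X x) *
        (bcalc (leftSymbol j W) (X x) (dM X x (e i)) (dM X x (e k))
          + bcalc (rightSymbol W) (X x) (dM X x (e i)) (dM X x (e k))
          + bcalc (fun s _ => W s) (X x) (A.hessM X x (e i) (e k)) 1))) := by
  have hp : ContMDiff (𝓡 m) 𝓘(ℝ, B × B) ∞ fun x => (Y x, X x) := hY.prodMk_space hX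
  have hd := hasFDerivAt_comp_symm (F := fun x => (Y x, X x)) (x := x)
    (((contDiff_opFunctional τ hW j).differentiable (by simp) (Y x, X x)).hasFDerivAt) hp
  have hd2 : dM (m := m) (fun x => (Y x, X x)) x = (dM Y x).prod (dM X x) :=
    ((hasFDerivAt_dM hY x).prodMk (hasFDerivAt_dM hX x)).fderiv
  simp only at hd
  rw [divM, contrM, contrM, hd, hd2, opFunctional_apply τ hW]
  simp only [gcontr, pair_apply, ContinuousLinearMap.comp_apply,
    ContinuousLinearMap.prod_apply, fderiv_opFunctional τ hW]
  have e1 : modOp j W (X x) (∑ i, ∑ k, (gram (A.ginn x))⁻¹ i k • A.hessM X x (e i) (e k)) =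
      ∑ i, ∑ k, (gram (A.ginn x))⁻¹ i k • modOp j W (X x) (A.hessM X x (e i) (e k)) := by
    let f : B →+ B := AddMonoidHom.mk' (modOp j W (X x)) fun a b => modOp_add_right hW j _ a b
    change f _ = _
    simp only [map_sum]
    exact Finset.sum_congr rfl fun i _ => Finset.sum_congr rfl fun k _ => modOp_smul hW _ _ _ _
  rw [e1]
  simp only [Finset.mul_sum, mul_smul_comm, map_sum, map_smul, mul_add, map_add, smul_add,
    Finset.sum_add_distrib, modOp]
  rw [← sum_gcontr_flip (A.gram_ginn_isSymm x) fun i k => τ (Y x * (bexp (-2 * j) (X x) *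
    bcalc (rightSymbol W) (X x) (dM X x (e i)) (dM X x (e k))))]
  abel

variable [T2Space M] [CompactSpace M] [MeasurableSpace M] [BorelSpace M]

/-- The first variation of the trace of the local expression. The gradient is the local expression
in which the one-variable symbol is `-(W + W')`, and the two-variable symbol consists of the rotated
difference quotients of `W` minus the difference quotients of `W` and `W'`. -/
theorem hasDerivAt_integral_trace_localB (hτ : ∀ a b, τ (a * b) = τ (b * a)) {K W W' K' : ℝ → ℝ}
    {H H' : ℝ → ℝ → ℝ} (hK : IsExp fun s _ => K s) (hH : IsExp H) (hW : IsExp fun s _ => W s)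
    (c : ℝ) (hWe : ∀ s, W s = 2 * j * K 0 * f₁ (-j * s) + H s (-s))
    (hW' : ∀ s, W' s = W (-s) * Real.exp (-j * s)) (hK' : ∀ s, K' s = -(W s + W' s))
    (hH' : ∀ s t, H' s t = rotLeft j (leftSymbol j W) s t + rotRight j (rightSymbol W) s t
      - ((leftSymbol j W s t + rightSymbol W s t) + (leftSymbol j W' s t + rightSymbol W' s t)))
    (hX : ContMDiff (𝓡 m) 𝓘(ℝ, B) ∞ X) (hY : ContMDiff (𝓡 m) 𝓘(ℝ, B) ∞ Y) :
    HasDerivAt (fun ε : ℝ => ∫ x, τ (A.localB j K H c (fun x => X x + ε • Y x) x) ∂A.volM)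
      (∫ x, τ (Y x * A.localB j K' H' (-2 * j * c) X x) ∂A.volM) 0 := by
  have hXe : ∀ ε : ℝ, ContMDiff (𝓡 m) 𝓘(ℝ, B) ∞ fun x => X x + ε • Y x := fun ε =>
    hX.add ((contDiff_const_smul (𝕜 := ℝ) (n := ∞) ε).contMDiff.comp hY)
  have hde : ∀ (ε : ℝ) x, dM (m := m) (fun x => X x + ε • Y x) x = dM X x + ε • dM Y x :=
    fun ε x => ((hasFDerivAt_dM hX x).add ((hasFDerivAt_dM hY x).const_smul ε)).fderiv
  have hW'' : IsExp fun s _ => W' s := (hW.tilde j).congr fun s _ => hW' s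
  -- The divergence terms do not contribute.
  have e1 : ∀ ε : ℝ, ∫ x, τ (A.localB j K H c (fun x => X x + ε • Y x) x) ∂A.volM =
      ∫ x, (gcontr (gram (A.ginn x)) (energyForm τ j W (X x + ε • Y x)
        (dM X x + ε • dM Y x) (dM X x + ε • dM Y x))
          + (c * A.scalarCurvature x) • τ (bexp (-2 * j) (X x + ε • Y x))) ∂A.volM := fun ε => by
    have hl := contMDiff_expFunctional τ j (hXe ε)
    simp only [A.trace_localB τ hτ hK hH hW c hWe (hXe ε)]
    refine (A.integral_add_of_integral_eq_zero (D := fun x => K 0 •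
      A.divM (fun x => expFunctional τ j (X x + ε • Y x)) (fun x => X x + ε • Y x) x)
      ((A.continuous_divM hl (hXe ε)).const_smul (K 0)) ?_).trans ?_
    · rw [integral_smul, A.integral_divM hl (hXe ε), smul_zero]
    · simp only [hde]
  -- Adding the divergences of `τ(Y V(∇X))` for the symbols `W` and `W'` turns the claimed gradient
  -- into the derivative of the integrand.
  have e2 : ∫ x, τ (Y x * A.localB j K' H' (-2 * j * c) X x) ∂A.volM = ∫ x,
      (τ (Y x * A.localB j K' H' (-2 * j * c) X x) +
        (A.divM (fun x => opFunctional τ j W (Y x) (X x)) X x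
          + A.divM (fun x => opFunctional τ j W' (Y x) (X x)) X x)) ∂A.volM := by
    have h1 := A.continuous_divM (contMDiff_opFunctional τ hW j hX hY) hX
    have h2 := A.continuous_divM (contMDiff_opFunctional τ hW'' j hX hY) hX
    refine (A.integral_add_of_integral_eq_zero (D := fun x =>
      A.divM (fun x => opFunctional τ j W (Y x) (X x)) X x
        + A.divM (fun x => opFunctional τ j W' (Y x) (X x)) X x) (h1.add h2) ?_).symm
    rw [integral_add (A.integrable_volM h1) (A.integrable_volM h2),
      A.integral_divM (contMDiff_opFunctional τ hW j hX hY) hX,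
      A.integral_divM (contMDiff_opFunctional τ hW'' j hX hY) hX, add_zero]
  simp only [e1, e2]
  refine A.hasDerivAt_integral (fun p z =>
    gcontr (gram (A.gForm p z.2)) (energyForm τ j W
      ((X ∘ (extChartAt (𝓡 m) p).symm) z.2 + z.1 • (Y ∘ (extChartAt (𝓡 m) p).symm) z.2)
      (fderiv ℝ (X ∘ (extChartAt (𝓡 m) p).symm) z.2
        + z.1 • fderiv ℝ (Y ∘ (extChartAt (𝓡 m) p).symm) z.2)
      (fderiv ℝ (X ∘ (extChartAt (𝓡 m) p).symm) z.2
        + z.1 • fderiv ℝ (Y ∘ (extChartAt (𝓡 m) p).symm) z.2))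
    + (c * (A.scalarCurvature ∘ (extChartAt (𝓡 m) p).symm) z.2) • τ (bexp (-2 * j)
      ((X ∘ (extChartAt (𝓡 m) p).symm) z.2 + z.1 • (Y ∘ (extChartAt (𝓡 m) p).symm) z.2)))
    (fun p => ?_) (fun p x hx ε => ?_) fun x => ?_
  · have hs : ContDiffOn ℝ ∞ (fun z : ℝ × Eu m => z.2)
        (Set.univ ×ˢ (extChartAt (𝓡 m) p).target) := contDiff_snd.contDiffOn
    have hm : Set.MapsTo (fun z : ℝ × Eu m => z.2) (Set.univ ×ˢ (extChartAt (𝓡 m) p).target)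
        (extChartAt (𝓡 m) p).target := fun z hz => hz.2
    have h1 : ContDiffOn ℝ ∞ (fun z : ℝ × Eu m => z.1)
        (Set.univ ×ˢ (extChartAt (𝓡 m) p).target) := contDiff_fst.contDiffOn
    have hf : ∀ {Z : M → B}, ContMDiff (𝓡 m) 𝓘(ℝ, B) ∞ Z →
        ContDiffOn ℝ ∞ (fderiv ℝ (Z ∘ (extChartAt (𝓡 m) p).symm)) (extChartAt (𝓡 m) p).target :=
      fun hZ => (contDiffOn_comp_symm hZ p).fderiv_of_isOpen (isOpen_extChartAt_target p)
        (by norm_cast)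
    have a1 := ((contDiffOn_comp_symm hX p).comp hs hm).add
      (h1.smul ((contDiffOn_comp_symm hY p).comp hs hm))
    have a2 := ((hf hX).comp hs hm).add (h1.smul ((hf hY).comp hs hm))
    refine (contDiffOn_gcontr (fun i k =>
      ((A.isMetricOn_gForm p).contDiffOn_gram_inv i k).comp hs hm)
      (contDiffOn_energyForm τ hW j a1 a2 a2)).add ?_
    exact (contDiffOn_const.mul ((contDiffOn_comp_symm A.contMDiff_scalarCurvature p).comp hs
      hm)).smul (τ.contDiff.comp_contDiffOn
        ((contDiff_const.bexp le_rfl contDiff_id).comp_contDiffOn a1))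
  · simp only [Function.comp, (extChartAt (𝓡 m) p).left_inv hx]
    rw [A.gcontr_transfer hx fun u v => ?_]
    simp only [energyForm_apply τ hW, add_apply, smul_apply, A.fderiv_transfer hx hX,
      A.fderiv_transfer hx hY]
  · have hl : HasDerivAt (fun ε : ℝ => X x + ε • Y x) (Y x) 0 := by
      simpa using ((hasDerivAt_id (0 : ℝ)).smul_const (Y x)).const_add (X x)
    have h1 := (hasFDerivAt_bexp j (X x)).1.comp_hasDerivAt_of_eq 0 hl (by simp)
    rw [(hasFDerivAt_bexp j (X x)).2] at h1
    have h2 := (hasDerivAt_gcontr_energyForm τ hW j (gram (A.ginn x)) (X x) (Y x) (dM X x)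
      (dM Y x)).add ((τ.hasFDerivAt.comp_hasDerivAt 0 h1).const_smul (c * A.scalarCurvature x))
    refine h2.congr_deriv ?_
    have hV : IsExp fun s _ => -2 * j * f₁ (-j * s) :=
      ((isExp_f₁.subst (-j) 0 0 0).const_mul (-2 * j)).congr fun s t => by ring_nf
    have hWf : (fun s => W (-s) * Real.exp (-j * s)) = W' := funext fun s => (hW' s).symm
    have hKf : (fun s _ => K' s : ℝ → ℝ → ℝ) = fun s _ => (-1) * (W s + W' s) := by
      funext s _
      rw [hK', neg_one_mul]
    have iL := isExp_leftSymbol hW j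
    have iR := isExp_rightSymbol hW
    have iL' := isExp_leftSymbol hW'' j
    have iR' := isExp_rightSymbol hW''
    have hHf : H' = fun s t => (rotLeft j (leftSymbol j W) s t + rotRight j (rightSymbol W) s t)
      - ((leftSymbol j W s t + rightSymbol W s t)
        + (leftSymbol j W' s t + rightSymbol W' s t)) := by
      funext s t
      exact hH' s t
    have e3 : ∀ y z, bcalc H' (X x) y z =
        bcalc (rotLeft j (leftSymbol j W)) (X x) y z + bcalc (rotRight j (rightSymbol W)) (X x) y z
        - (bcalc (leftSymbol j W) (X x) y z + bcalc (rightSymbol W) (X x) y z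
          + (bcalc (leftSymbol j W') (X x) y z + bcalc (rightSymbol W') (X x) y z)) := fun y z => by
      rw [hHf, ((iL.rotLeft j).add (iR.rotRight j)).bcalc_sub ((iL.add iR).add (iL'.add iR')),
        (iL.rotLeft j).bcalc_add (iR.rotRight j), (iL.add iR).bcalc_add (iL'.add iR'),
        iL.bcalc_add iR, iL'.bcalc_add iR']
    have e4 : ∀ y, bcalc (fun s _ => K' s) (X x) y 1 = -(bcalc (fun s _ => W s) (X x) y 1
        + bcalc (fun s _ => W' s) (X x) y 1) := fun y => by
      rw [hKf, (hW.add hW'').bcalc_const_mul, hW.bcalc_add hW'', neg_one_smul]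
    rw [sum_energy_rotate τ hτ hW j (A.gram_ginn_isSymm x), hWf, A.divM_opFunctional τ hW j hX hY,
      A.divM_opFunctional τ hW'' j hX hY, hV.trace_bcalc_one τ hτ j, localB]
    simp only [gcontr, kcalcT, bcalcT, add_apply, bilinE_e, e3, e4, mul_zero, f₁_zero, mul_one]
    rw [hτ (bexp (-2 * j) (X x)) (Y x)]
    simp only [Finset.mul_sum, mul_smul_comm, map_sum, map_smul, mul_add, mul_sub, map_add, map_sub,
      smul_add, smul_sub, Finset.sum_add_distrib, Finset.sum_sub_distrib, mul_neg, map_neg, smul_neg,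
      Finset.sum_neg_distrib, smul_smul]
    rw [show c * A.scalarCurvature x * (-2 * j) = -2 * j * c * A.scalarCurvature x by ring]
    abel

end ToricManifold
end FirstVariation

/-! ### Summable families -/

section SummableSequences

variable {ι : Type*}

/-- The Banach space `ℓ¹(ι)`. -/
abbrev ELL (ι : Type*) : Type _ := lp (fun _ : ι => ℂ) 1

theorem ELL.hasSum_norm (a : ELL ι) : HasSum (fun r => ‖a r‖) ‖a‖ := by
  simpa using lp.hasSum_norm (p := 1) (by simp) a

variable [DecidableEq ι] {V : Type*} [NormedAddCommGroup V] [NormedSpace ℂ V] [CompleteSpace V]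

/-- The basis vector `δ_r` of `ℓ¹(ι)`. -/
def delta (r : ι) : ELL ι := lp.single 1 r 1

theorem ELL.hasSum_delta (a : ELL ι) : HasSum (fun r => a r • delta r) a := by
  have h := lp.hasSum_single (p := 1) (by simp) a
  have e : (fun r => lp.single (E := fun _ : ι => ℂ) 1 r (a r)) = fun r => a r • delta r := by
    funext r
    rw [delta, ← lp.single_smul, smul_eq_mul, mul_one]
  rwa [e] at h

theorem norm_delta (r : ι) : ‖delta r‖ = 1 := by
  rw [delta, lp.norm_single (by simp), norm_one]

theorem ELL.summable_smul (v : ι → V) (hv : ∀ r, ‖v r‖ ≤ 1) (a : ELL ι) :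
    Summable fun r => a r • v r :=
  Summable.of_norm_bounded a.hasSum_norm.summable fun r => by
    rw [norm_smul]
    exact mul_le_of_le_one_right (norm_nonneg _) (hv r)

/-- The universal property of `ℓ¹(ι)`: a family in the unit ball of a Banach space extends to a
contraction. -/
def lift (v : ι → V) (hv : ∀ r, ‖v r‖ ≤ 1) : ELL ι →L[ℂ] V :=
  LinearMap.mkContinuous
    { toFun := fun a => ∑' r, a r • v r
      map_add' := fun a b => by
        rw [← (ELL.summable_smul v hv a).tsum_add (ELL.summable_smul v hv b)]
        exact tsum_congr fun r => by simp [add_smul]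
      map_smul' := fun c a => by
        rw [RingHom.id_apply, ← (ELL.summable_smul v hv a).tsum_const_smul]
        exact tsum_congr fun r => by simp [mul_smul] } 1 fun a => by
    rw [one_mul]
    refine tsum_of_norm_bounded a.hasSum_norm fun r => ?_
    rw [norm_smul]
    exact mul_le_of_le_one_right (norm_nonneg _) (hv r)

theorem hasSum_lift (v : ι → V) (hv : ∀ r, ‖v r‖ ≤ 1) (a : ELL ι) :
    HasSum (fun r => a r • v r) (lift v hv a) := (ELL.summable_smul v hv a).hasSum

theorem norm_lift_le (v : ι → V) (hv : ∀ r, ‖v r‖ ≤ 1) : ‖lift v hv‖ ≤ 1 :=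
  LinearMap.mkContinuous_norm_le _ zero_le_one _

theorem lift_delta (v : ι → V) (hv : ∀ r, ‖v r‖ ≤ 1) (r : ι) : lift v hv (delta r) = v r := by
  refine (hasSum_lift v hv _).unique ?_
  have : (fun k => delta r k • v k) = fun k => if k = r then v r else 0 := by
    funext k
    rcases eq_or_ne k r with rfl | h
    · simp [delta]
    · simp [delta, h]
  rw [this]
  exact hasSum_ite_eq r (v r)

theorem ext_delta {f g : ELL ι →L[ℂ] V} (h : ∀ r, f (delta r) = g (delta r)) : f = g := by
  ext a
  refine (f.hasSum a.hasSum_delta).unique ?_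
  have := g.hasSum a.hasSum_delta
  simp only [map_smul, ← h] at this
  simpa only [map_smul] using this

/-- The coefficient of `δ_k`. -/
def lcoef (k : ι) : ELL ι →L[ℂ] ℂ := lp.evalCLM ℂ _ _ k


theorem lcoef_apply (k : ι) (a : ELL ι) : lcoef k a = a k := rfl

theorem lcoef_delta (k r : ι) : lcoef k (delta r) = if k = r then 1 else 0 := by
  rcases eq_or_ne k r with rfl | h
  · simp [lcoef_apply, delta]
  · simp [lcoef_apply, delta, h]

end SummableSequences

/-! ### The twisted group algebra -/

section TwistedAlgebra

variable {n : ℕ} (θ : Matrix (Fin n) (Fin n) ℝ)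

theorem χ_add_left (r r' l : Fin n → ℤ) : χ θ (r + r') l = χ θ r l * χ θ r' l := by
  rw [χ, χ, χ, ← Complex.exp_add]
  congr 1
  have : (fun i => ((r + r') i : ℝ)) = (fun i => (r i : ℝ)) + fun i => (r' i : ℝ) := by
    ext i; simp
  rw [this, Matrix.mulVec_add, add_dotProduct]
  push_cast
  ring

theorem χ_add_right (r l l' : Fin n → ℤ) : χ θ r (l + l') = χ θ r l * χ θ r l' := by
  rw [χ, χ, χ, ← Complex.exp_add]
  congr 1
  have : (fun i => ((l + l') i : ℝ)) = (fun i => (l i : ℝ)) + fun i => (l' i : ℝ) := by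
    ext i; simp
  rw [this, dotProduct_add]
  push_cast
  ring

theorem χ_zero_left (l : Fin n → ℤ) : χ θ 0 l = 1 := by
  have : (fun i => ((0 : Fin n → ℤ) i : ℝ)) = 0 := by ext i; simp
  rw [χ, this]
  simp

theorem χ_zero_right (l : Fin n → ℤ) : χ θ l 0 = 1 := by
  have : (fun i => ((0 : Fin n → ℤ) i : ℝ)) = 0 := by ext i; simp
  rw [χ, this]
  simp

theorem norm_χ (r l : Fin n → ℤ) : ‖χ θ r l‖ = 1 := by
  rw [χ, show Complex.I * Real.pi * ((θ.mulVec (fun i => (r i : ℝ)) ⬝ᵥ fun i => (l i : ℝ) : ℝ) : ℂ)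
    = ((Real.pi * (θ.mulVec (fun i => (r i : ℝ)) ⬝ᵥ fun i => (l i : ℝ)) : ℝ) : ℂ) * Complex.I by
      push_cast; ring, Complex.norm_exp_ofReal_mul_I]

/-- Skew-symmetry of `θ` is used here. -/
theorem χ_neg_self (hθ : θ.transpose = -θ) (r : Fin n → ℤ) : χ θ r (-r) = 1 := by
  have h : ∀ v : Fin n → ℝ, θ.mulVec v ⬝ᵥ v = 0 := fun v => by
    have h1 : θ.mulVec v ⬝ᵥ v = v ⬝ᵥ θ.transpose.mulVec v := by
      rw [Matrix.mulVec_transpose, dotProduct_comm, Matrix.dotProduct_mulVec, dotProduct_comm]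
    rw [hθ, Matrix.neg_mulVec, dotProduct_neg, dotProduct_comm v] at h1
    linarith
  have : (fun i => ((-r) i : ℝ)) = -fun i => (r i : ℝ) := by ext i; simp
  rw [χ, this, dotProduct_neg, h]
  simp

/-- The twisted group algebra `ℓ¹(ℤⁿ, θ)`, in which `δ_r δ_l = χ_θ(r,l) δ_{r+l}`. -/
def TwAlg (_ : Matrix (Fin n) (Fin n) ℝ) : Type := ELL (Fin n → ℤ)

namespace TwAlg

instance : NormedAddCommGroup (TwAlg θ) := inferInstanceAs (NormedAddCommGroup (ELL (Fin n → ℤ)))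
instance : NormedSpace ℂ (TwAlg θ) := inferInstanceAs (NormedSpace ℂ (ELL (Fin n → ℤ)))
instance : CompleteSpace (TwAlg θ) := inferInstanceAs (CompleteSpace (ELL (Fin n → ℤ)))

/-- The basis of the twisted group algebra. -/
def u (r : Fin n → ℤ) : TwAlg θ := delta r

theorem norm_u (r : Fin n → ℤ) : ‖u θ r‖ = 1 := norm_delta r

variable {θ} in
/-- The contraction defined by a family of vectors in the unit ball. -/
def ofFamily {V : Type*} [NormedAddCommGroup V] [NormedSpace ℂ V] [CompleteSpace V]
    (v : (Fin n → ℤ) → V) (hv : ∀ r, ‖v r‖ ≤ 1) : TwAlg θ →L[ℂ] V := lift v hv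

theorem norm_ofFamily_le {V : Type*} [NormedAddCommGroup V] [NormedSpace ℂ V] [CompleteSpace V]
    (v : (Fin n → ℤ) → V) (hv : ∀ r, ‖v r‖ ≤ 1) : ‖(ofFamily v hv : TwAlg θ →L[ℂ] V)‖ ≤ 1 :=
  norm_lift_le v hv

@[simp]
theorem ofFamily_u {V : Type*} [NormedAddCommGroup V] [NormedSpace ℂ V] [CompleteSpace V]
    (v : (Fin n → ℤ) → V) (hv : ∀ r, ‖v r‖ ≤ 1) (r : Fin n → ℤ) :
    ofFamily v hv (u θ r) = v r := lift_delta v hv r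

/-- The multiplication of the twisted group algebra. -/
def mulCLM : TwAlg θ →L[ℂ] TwAlg θ →L[ℂ] TwAlg θ :=
  ofFamily (fun r => ofFamily (fun l => χ θ r l • u θ (r + l)) fun l => by
    rw [norm_smul, norm_χ, norm_u, one_mul]) fun r => norm_ofFamily_le θ _ _

instance : Mul (TwAlg θ) := ⟨fun a b => mulCLM θ a b⟩
instance : One (TwAlg θ) := ⟨u θ 0⟩

theorem mul_def (a b : TwAlg θ) : a * b = mulCLM θ a b := rfl
theorem one_def : (1 : TwAlg θ) = u θ 0 := rfl

theorem u_mul_u (r l : Fin n → ℤ) : u θ r * u θ l = χ θ r l • u θ (r + l) := by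
  rw [mul_def, mulCLM, ofFamily_u, ofFamily_u]

variable {θ} in
theorem ext_u {V : Type*} [NormedAddCommGroup V] [NormedSpace ℂ V] [CompleteSpace V]
    {f g : TwAlg θ →L[ℂ] V} (h : ∀ r, f (u θ r) = g (u θ r)) (a : TwAlg θ) : f a = g a :=
  DFunLike.congr_fun (ext_delta (f := (f : ELL (Fin n → ℤ) →L[ℂ] V)) (g := g) h) a

theorem smul_mul' (c : ℂ) (a b : TwAlg θ) : c • a * b = c • (a * b) := by
  simp only [mul_def, map_smul, smul_apply]

theorem mul_smul' (c : ℂ) (a b : TwAlg θ) : a * c • b = c • (a * b) := by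
  simp only [mul_def, map_smul]

theorem mul_assoc' (a b c : TwAlg θ) : a * b * c = a * (b * c) := by
  refine ext_u (f := ((mulCLM θ).flip c).comp ((mulCLM θ).flip b))
    (g := (mulCLM θ).flip (mulCLM θ b c)) (fun r => ?_) a
  refine ext_u (f := ((mulCLM θ).flip c).comp (mulCLM θ (u θ r)))
    (g := (mulCLM θ (u θ r)).comp ((mulCLM θ).flip c)) (fun l => ?_) b
  refine ext_u (f := mulCLM θ (mulCLM θ (u θ r) (u θ l)))
    (g := (mulCLM θ (u θ r)).comp (mulCLM θ (u θ l))) (fun k => ?_) c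
  change u θ r * u θ l * u θ k = u θ r * (u θ l * u θ k)
  rw [u_mul_u, u_mul_u, smul_mul', mul_smul', u_mul_u, u_mul_u, smul_smul, smul_smul, χ_add_left,
    χ_add_right, add_assoc]
  congr 1
  ring

instance : NormedRing (TwAlg θ) :=
  { (inferInstance : NormedAddCommGroup (TwAlg θ)) with
    mul := fun a b => a * b
    one := 1
    left_distrib := fun a b c => by
      change a * (b + c) = a * b + a * c
      simp only [mul_def, map_add]
    right_distrib := fun a b c => by
      change (a + b) * c = a * c + b * c
      simp only [mul_def, map_add, add_apply]
    zero_mul := fun a => by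
      change 0 * a = 0
      simp only [mul_def, map_zero, zero_apply]
    mul_zero := fun a => by
      change a * 0 = 0
      simp only [mul_def, map_zero]
    mul_assoc := mul_assoc' θ
    one_mul := fun a => ext_u (f := mulCLM θ (u θ 0)) (g := ContinuousLinearMap.id ℂ _)
      (fun r => by
        change u θ 0 * u θ r = u θ r
        rw [u_mul_u, χ_zero_left, one_smul, zero_add]) a
    mul_one := fun a => ext_u (f := (mulCLM θ).flip (u θ 0)) (g := ContinuousLinearMap.id ℂ _)
      (fun r => by
        change u θ r * u θ 0 = u θ r
        rw [u_mul_u, χ_zero_right, one_smul, add_zero]) a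
    norm_mul_le := fun a b => ((mulCLM θ).le_opNorm₂ a b).trans (by
      have h := norm_ofFamily_le θ (fun r => ofFamily (fun l => χ θ r l • u θ (r + l)) fun l => by
        rw [norm_smul, norm_χ, norm_u, one_mul]) fun r => norm_ofFamily_le θ _ _
      exact mul_le_mul_of_nonneg_right (mul_le_of_le_one_left (norm_nonneg _) h) (norm_nonneg _)) }

instance : NormedAlgebra ℂ (TwAlg θ) :=
  { Algebra.ofModule (smul_mul' θ) (fun c a b => mul_smul' θ c a b) with
    norm_smul_le := norm_smul_le }

variable {θ}

/-- The coefficient functionals. -/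
def coef (r : Fin n → ℤ) : TwAlg θ →L[ℂ] ℂ := lcoef (ι := Fin n → ℤ) r

theorem coef_u (k r : Fin n → ℤ) : coef k (u θ r) = if k = r then 1 else 0 := lcoef_delta k r

theorem hasSum_u (a : TwAlg θ) : HasSum (fun r => coef r a • u θ r) a := ELL.hasSum_delta a

theorem hasSum_norm_coef (a : TwAlg θ) : HasSum (fun r => ‖coef r a‖) ‖a‖ := ELL.hasSum_norm a

theorem ext_coef {a b : TwAlg θ} (h : ∀ r, coef r a = coef r b) : a = b := by
  have ha := hasSum_u a
  simp only [h] at ha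
  exact ha.unique (hasSum_u b)

/-- The sum of the coefficients. -/
def ev : TwAlg θ →L[ℂ] ℂ := ofFamily (fun _ => (1 : ℂ)) fun _ => by simp

theorem ev_u (r : Fin n → ℤ) : ev (u θ r) = 1 := ofFamily_u θ _ _ r

theorem hasSum_ev (a : TwAlg θ) : HasSum (fun r => coef r a) (ev a) := by
  simpa [ev_u] using ev.hasSum (hasSum_u a)

/-- The sum of the coefficients of a product is the series which defines the deformed product. -/
theorem hasSum_ev_mul (a b : TwAlg θ) : HasSum (fun p : (Fin n → ℤ) × (Fin n → ℤ) =>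
    χ θ p.1 p.2 * (coef p.1 a * coef p.2 b)) (ev (a * b)) := by
  have ha : Summable fun r => ‖coef r a • u θ r‖ := by
    simpa [norm_smul, norm_u] using (hasSum_norm_coef a).summable
  have hb : Summable fun r => ‖coef r b • u θ r‖ := by
    simpa [norm_smul, norm_u] using (hasSum_norm_coef b).summable
  have h1 := (summable_mul_of_summable_norm ha hb).hasSum
  rw [← tsum_mul_tsum_of_summable_norm ha hb, (hasSum_u a).tsum_eq, (hasSum_u b).tsum_eq] at h1
  refine (ev.hasSum h1).congr_fun fun p => ?_
  rw [smul_mul_assoc, mul_smul_comm, u_mul_u, map_smul, map_smul, map_smul, ev_u]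
  simp only [smul_eq_mul, mul_one]
  ring

/-- The coefficient at the unit is a trace. -/
theorem coef_zero_mul_comm (hθ : θ.transpose = -θ) (a b : TwAlg θ) :
    coef 0 (a * b) = coef 0 (b * a) := by
  refine ext_u (f := (coef 0).comp ((mulCLM θ).flip b)) (g := (coef 0).comp (mulCLM θ b))
    (fun r => ?_) a
  refine ext_u (f := (coef 0).comp (mulCLM θ (u θ r)))
    (g := (coef 0).comp ((mulCLM θ).flip (u θ r))) (fun l => ?_) b
  change coef 0 (u θ r * u θ l) = coef 0 (u θ l * u θ r)
  rw [u_mul_u, u_mul_u, map_smul, map_smul, coef_u, coef_u, add_comm l r]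
  split_ifs with h
  -- Only the terms with `l = -r` contribute, and there the bicharacter is trivial.
  · obtain rfl : l = -r := (neg_eq_of_add_eq_zero_right h.symm).symm
    have h1 := χ_neg_self θ hθ (-r)
    rw [neg_neg] at h1
    rw [χ_neg_self θ hθ, h1]
  · simp

/-- The pairing of the trace does not see the deformation. -/
theorem hasSum_coef_zero_mul (hθ : θ.transpose = -θ) (a b : TwAlg θ) :
    HasSum (fun r => coef r a * coef (-r) b) (coef 0 (a * b)) := by
  have h := ((coef 0).comp ((mulCLM θ).flip b)).hasSum (hasSum_u a)
  refine h.congr_fun fun r => ?_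
  have e : coef 0 (u θ r * b) = coef (-r) b := by
    refine ext_u (f := (coef 0).comp (mulCLM θ (u θ r))) (g := coef (-r)) (fun l => ?_) b
    change coef 0 (u θ r * u θ l) = _
    rw [u_mul_u, map_smul, coef_u, coef_u]
    by_cases h : r + l = 0
    · obtain rfl : l = -r := (neg_eq_of_add_eq_zero_right h).symm
      simp [χ_neg_self θ hθ]
    · have h' : ¬ -r = l := fun h' => h (by rw [← h']; simp)
      simp [Ne.symm h, h']
  rw [map_smul, ← e]
  rfl

/-- The character `t ↦ e^{2πi r·t}`. -/
def char (r : Fin n → ℤ) (t : Fin n → ℝ) : ℂ :=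
  Complex.exp (2 * Real.pi * Complex.I * ∑ i, (r i : ℂ) * (t i : ℂ))

theorem norm_char (r : Fin n → ℤ) (t : Fin n → ℝ) : ‖char r t‖ = 1 := by
  rw [char, show 2 * (Real.pi : ℂ) * Complex.I * ∑ i, (r i : ℂ) * (t i : ℂ) =
    ((2 * Real.pi * ∑ i, (r i : ℝ) * t i : ℝ) : ℂ) * Complex.I by push_cast; ring,
    Complex.norm_exp_ofReal_mul_I]

theorem char_add_left (r l : Fin n → ℤ) (t : Fin n → ℝ) : char (r + l) t = char r t * char l t := by
  rw [char, char, char, ← Complex.exp_add]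
  congr 1
  simp only [Pi.add_apply, Int.cast_add, add_mul, Finset.sum_add_distrib]
  ring

theorem char_zero_left (t : Fin n → ℝ) : char 0 t = 1 := by simp [char]

theorem char_zero_right (r : Fin n → ℤ) : char r 0 = 1 := by simp [char]

theorem continuous_char (r : Fin n → ℤ) : Continuous (char r) := by
  unfold char
  fun_prop

/-- The torus action on the twisted group algebra. -/
def rot (t : Fin n → ℝ) : TwAlg θ →L[ℂ] TwAlg θ :=
  ofFamily (fun r => char r t • u θ r) fun r => by rw [norm_smul, norm_char, norm_u, one_mul]

theorem rot_u (t : Fin n → ℝ) (r : Fin n → ℤ) : rot t (u θ r) = char r t • u θ r :=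
  ofFamily_u θ _ _ r

theorem rot_one (t : Fin n → ℝ) : rot t (1 : TwAlg θ) = 1 := by
  rw [one_def, rot_u, char_zero_left, one_smul]

theorem rot_mul (t : Fin n → ℝ) (a b : TwAlg θ) : rot t (a * b) = rot t a * rot t b := by
  refine ext_u (f := (rot t).comp ((mulCLM θ).flip b))
    (g := ((mulCLM θ).flip (rot t b)).comp (rot t)) (fun r => ?_) a
  refine ext_u (f := (rot t).comp (mulCLM θ (u θ r)))
    (g := (mulCLM θ (rot t (u θ r))).comp (rot t)) (fun l => ?_) b
  change rot t (u θ r * u θ l) = rot t (u θ r) * rot t (u θ l)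
  rw [u_mul_u, map_smul, rot_u, rot_u, rot_u, smul_mul_assoc, mul_smul_comm, u_mul_u, smul_smul,
    smul_smul, smul_smul, char_add_left]
  congr 1
  ring

theorem coef_rot (t : Fin n → ℝ) (r : Fin n → ℤ) (a : TwAlg θ) :
    coef r (rot t a) = char r t * coef r a := by
  refine ext_u (f := (coef r).comp (rot t)) (g := char r t • coef r) (fun l => ?_) a
  simp only [ContinuousLinearMap.comp_apply, smul_apply, rot_u, map_smul, coef_u]
  split_ifs with h
  · rw [h]
  · simp

theorem hasSum_ev_rot (t : Fin n → ℝ) (a : TwAlg θ) :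
    HasSum (fun r => char r t * coef r a) (ev (rot t a)) := by
  simpa only [coef_rot] using hasSum_ev (rot t a)

theorem continuous_ev_rot (a : TwAlg θ) : Continuous fun t => ev (rot t a) := by
  have h : (fun t => ev (rot t a)) = fun t => ∑' r, char r t * coef r a :=
    funext fun t => (hasSum_ev_rot t a).tsum_eq.symm
  rw [h]
  refine continuous_tsum (fun r => (continuous_char r).mul continuous_const)
    (hasSum_norm_coef a).summable fun r t => ?_
  rw [norm_mul, norm_char, one_mul]

theorem integral_char (r : Fin n → ℤ) :
    ∫ t in Set.Icc (0 : Fin n → ℝ) 1, char r t = if r = 0 then 1 else 0 := by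
  have h1 : ∀ k : ℤ, ∫ s in Set.Icc (0 : ℝ) 1, Complex.exp (2 * Real.pi * Complex.I * k * s) =
      if k = 0 then 1 else 0 := fun k => by
    rw [integral_Icc_eq_integral_Ioc, ← intervalIntegral.integral_of_le zero_le_one]
    split_ifs with hk
    · simp [hk]
    · have hc : 2 * (Real.pi : ℂ) * Complex.I * k ≠ 0 := by
        simp [Real.pi_ne_zero, hk]
      rw [integral_exp_mul_complex hc]
      have : Complex.exp (2 * Real.pi * Complex.I * k) = 1 := by
        rw [Complex.exp_eq_one_iff]
        exact ⟨k, by ring⟩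
      simp [this]
  have h2 : Set.Icc (0 : Fin n → ℝ) 1 = Set.univ.pi fun _ => Set.Icc 0 1 := by
    rw [Set.pi_univ_Icc]
    rfl
  have h3 : ∀ t : Fin n → ℝ, char r t = ∏ i, Complex.exp (2 * Real.pi * Complex.I * r i * t i) :=
    fun t => by
      rw [← Complex.exp_sum, char, Finset.mul_sum]
      simp only [mul_assoc]
  simp only [h3]
  rw [h2, volume_pi, Measure.restrict_pi_pi, integral_fintype_prod_eq_prod
    (f := fun i (s : ℝ) => Complex.exp (2 * Real.pi * Complex.I * r i * s))]
  simp only [h1]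
  split_ifs with h
  · simp [h]
  · obtain ⟨i, hi⟩ := Function.ne_iff.1 h
    exact Finset.prod_eq_zero (Finset.mem_univ i) (if_neg hi)

/-- Fourier inversion for the torus action. -/
theorem integral_ev_rot (r : Fin n → ℤ) (a : TwAlg θ) :
    ∫ t in Set.Icc (0 : Fin n → ℝ) 1, char (-r) t * ev (rot t a) = coef r a := by
  have h1 : ∀ t, HasSum (fun k => char (k - r) t * coef k a) (char (-r) t * ev (rot t a)) := fun t =>
    ((hasSum_ev_rot t a).mul_left (char (-r) t)).congr_fun fun k => by
      rw [sub_eq_add_neg, char_add_left]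
      ring
  have hc : ∀ k, Continuous fun t => char (k - r) t * coef k a := fun k =>
    (continuous_char _).mul continuous_const
  have hi : ∀ k, Integrable (fun t => char (k - r) t * coef k a)
      (volume.restrict (Set.Icc (0 : Fin n → ℝ) 1)) := fun k =>
    (hc k).continuousOn.integrableOn_compact isCompact_Icc
  have h2 := hasSum_integral_of_summable_integral_norm hi (by
    simp only [norm_mul, norm_char, one_mul, integral_const]
    exact (hasSum_norm_coef a).summable.const_smul _)
  have h3 : ∀ t, ∑' k, char (k - r) t * coef k a = char (-r) t * ev (rot t a) := fun t =>
    (h1 t).tsum_eq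
  simp only [h3, integral_mul_const, integral_char] at h2
  refine h2.unique ?_
  have : (fun k : Fin n → ℤ => (if k - r = 0 then (1 : ℂ) else 0) * coef k a) =
      fun k => if k = r then coef r a else 0 := by
    funext k
    by_cases h : k = r
    · simp [h]
    · simp [h, sub_eq_zero]
  rw [this]
  exact hasSum_ite_eq r _

end TwAlg
end TwistedAlgebra

/-! ### Fourier series of periodic functions -/

section PeriodicFourier

open TwAlg

variable {n : ℕ}

theorem mFourier_coe (r : Fin n → ℤ) (t : Fin n → ℝ) :
    UnitAddTorus.mFourier r (fun i => (t i : UnitAddCircle)) = char r t := by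
  rw [UnitAddTorus.mFourier, ContinuousMap.coe_mk, char, Finset.mul_sum, Complex.exp_sum]
  refine Finset.prod_congr rfl fun i _ => ?_
  rw [fourier_coe_apply]
  congr 1
  push_cast
  ring

theorem char_neg (r : Fin n → ℤ) (t : Fin n → ℝ) : char (-r) t = char r (-t) := by
  simp [char]

theorem char_add_right (r : Fin n → ℤ) (s t : Fin n → ℝ) : char r (s + t) = char r s * char r t := by
  rw [char, char, char, ← Complex.exp_add]
  congr 1
  simp only [Pi.add_apply, Complex.ofReal_add, mul_add, Finset.sum_add_distrib]

theorem char_mul_char_neg (r : Fin n → ℤ) (t : Fin n → ℝ) : char r t * char (-r) t = 1 := by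
  rw [← char_add_left, add_neg_cancel, char_zero_left]

/-- A continuous periodic function descends to the torus. -/
theorem exists_torus_lift {g : (Fin n → ℝ) → ℂ} (hg : Continuous g)
    (hper : ∀ (k : Fin n → ℤ) t, g (t + fun i => (k i : ℝ)) = g t) :
    ∃ G : C(UnitAddTorus (Fin n), ℂ), ∀ t : Fin n → ℝ, G (fun i => (t i : UnitAddCircle)) = g t := by
  have hq' : IsOpenQuotientMap (Pi.map fun (_ : Fin n) (s : ℝ) => (s : UnitAddCircle)) :=
    IsOpenQuotientMap.piMap fun _ => QuotientAddGroup.isOpenQuotientMap_mk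
  let Q : C(Fin n → ℝ, UnitAddTorus (Fin n)) := ⟨_, hq'.continuous⟩
  have hq : Topology.IsQuotientMap Q := hq'.isQuotientMap
  have hf : Function.FactorsThrough (⟨g, hg⟩ : C(Fin n → ℝ, ℂ)) Q := fun a b hab => by
    have h1 : ∀ i, ∃ k : ℤ, (k : ℝ) = b i - a i := fun i => by
      have h2 : ((a i : ℝ) : UnitAddCircle) = (b i : ℝ) := congrFun hab i
      rw [QuotientAddGroup.eq, AddSubgroup.mem_zmultiples_iff] at h2
      obtain ⟨k, hk⟩ := h2
      exact ⟨k, by rw [zsmul_eq_mul, mul_one] at hk; rw [hk]; ring⟩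
    choose k hk using h1
    have h2 : b = a + fun i => (k i : ℝ) := by
      ext i
      simp [hk]
    change g a = g b
    rw [h2, hper]
  exact ⟨hq.lift ⟨g, hg⟩ hf, fun t => DFunLike.congr_fun (hq.lift_comp ⟨g, hg⟩ hf) t⟩

theorem integral_Icc_eq_box (g : (Fin n → ℝ) → ℂ) : ∫ t in Set.Icc (0 : Fin n → ℝ) 1, g t =
    ∫ t in {t : Fin n → ℝ | ∀ i, t i ∈ Set.Ioc ((0 : Fin n → ℝ) i) ((0 : Fin n → ℝ) i + 1)}, g t := by
  refine (setIntegral_congr_set ?_).symm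
  have := Measure.univ_pi_Ioc_ae_eq_Icc (μ := fun _ : Fin n => (volume : Measure ℝ))
    (f := fun _ => 0) (g := fun _ => 1)
  refine Filter.EventuallyEq.trans (.of_eq ?_) this
  have : {t : Fin n → ℝ | ∀ i, t i ∈ Set.Ioc ((0 : Fin n → ℝ) i) ((0 : Fin n → ℝ) i + 1)} =
      Set.univ.pi fun _ => Set.Ioc 0 1 := by
    ext t
    simp [Set.mem_pi]
  exact this

/-- The Fourier coefficients of a translate. -/
theorem integral_shift {g : (Fin n → ℝ) → ℂ} (hg : Continuous g)
    (hper : ∀ (k : Fin n → ℤ) t, g (t + fun i => (k i : ℝ)) = g t) (r : Fin n → ℤ)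
    (s : Fin n → ℝ) : ∫ t in Set.Icc (0 : Fin n → ℝ) 1, char (-r) t * g (t + s) =
      char r s * ∫ t in Set.Icc (0 : Fin n → ℝ) 1, char (-r) t * g t := by
  obtain ⟨G, hG⟩ := exists_torus_lift hg hper
  have h1 := UnitAddTorus.mFourierCoeff_eq_integral G r 0
  have h2 := UnitAddTorus.mFourierCoeff_eq_integral G r s
  simp only [mFourier_coe, hG, smul_eq_mul] at h1 h2
  rw [integral_Icc_eq_box, integral_Icc_eq_box, ← h1, h2, ← integral_const_mul]
  have h3 := (measurePreserving_add_right (volume : Measure (Fin n → ℝ)) s).setIntegral_preimage_emb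
    (measurableEmbedding_addRight s) (fun t => char r s * (char (-r) t * g t))
    {t | ∀ i, t i ∈ Set.Ioc (s i) (s i + 1)}
  rw [← h3]
  have h4 : (fun t => t + s) ⁻¹' {t : Fin n → ℝ | ∀ i, t i ∈ Set.Ioc (s i) (s i + 1)} =
      {t : Fin n → ℝ | ∀ i, t i ∈ Set.Ioc ((0 : Fin n → ℝ) i) ((0 : Fin n → ℝ) i + 1)} := by
    ext t
    simp only [Set.mem_preimage, Set.mem_ofPred_eq, Set.mem_Ioc, Pi.add_apply, Pi.zero_apply]
    refine forall_congr' fun i => ?_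
    constructor <;> rintro ⟨a, b⟩ <;> constructor <;> linarith
  rw [h4]
  congr 1
  funext t
  rw [char_add_right]
  linear_combination (-(char (-r) t * g (t + s))) * char_mul_char_neg r s

/-- Fourier inversion at the origin. -/
theorem hasSum_fourier_zero {g : (Fin n → ℝ) → ℂ} (hg : Continuous g)
    (hper : ∀ (k : Fin n → ℤ) t, g (t + fun i => (k i : ℝ)) = g t)
    (hs : Summable fun r => ∫ t in Set.Icc (0 : Fin n → ℝ) 1, char (-r) t * g t) :
    HasSum (fun r => ∫ t in Set.Icc (0 : Fin n → ℝ) 1, char (-r) t * g t) (g 0) := by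
  obtain ⟨G, hG⟩ := exists_torus_lift hg hper
  have h1 : ∀ r, UnitAddTorus.mFourierCoeff G r =
      ∫ t in Set.Icc (0 : Fin n → ℝ) 1, char (-r) t * g t := fun r => by
    rw [UnitAddTorus.mFourierCoeff_eq_integral G r 0, integral_Icc_eq_box]
    simp only [mFourier_coe, hG, smul_eq_mul]
  have hs' : Summable (UnitAddTorus.mFourierCoeff G) := by
    simpa only [← h1] using hs
  have h2 := UnitAddTorus.hasSum_mFourier_series_apply_of_summable hs'
    (fun i => ((0 : Fin n → ℝ) i : UnitAddCircle))
  simpa only [mFourier_coe, hG, char_zero_right, smul_eq_mul, mul_one, h1] using h2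

theorem summable_prod_apply {w : ℤ → ℝ} (h0 : ∀ k, 0 ≤ w k) (h1 : Summable w) :
    Summable fun r : Fin n → ℤ => ∏ i, w (r i) := by
  refine summable_of_sum_le (c := ∏ _i : Fin n, ∑' k, w k)
    (fun r => Finset.prod_nonneg fun i _ => h0 _) fun u => ?_
  have e1 : ∑ r ∈ u, ∏ i, w (r i) ≤
      ∑ r ∈ Fintype.piFinset fun i => u.image fun r => r i, ∏ i, w (r i) := by
    refine Finset.sum_le_sum_of_subset_of_nonneg (fun r hr => ?_)
      fun r _ _ => Finset.prod_nonneg fun i _ => h0 _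
    rw [Fintype.mem_piFinset]
    exact fun i => Finset.mem_image_of_mem (fun r : Fin n → ℤ => r i) hr
  rw [← Finset.prod_univ_sum (fun i => u.image fun r => r i) fun _ k => w k] at e1
  exact e1.trans (Finset.prod_le_prod (fun i _ => Finset.sum_nonneg fun k _ => h0 k)
    fun i _ => h1.sum_le_tsum _ fun k _ => h0 k)

theorem summable_inv_one_add_sq : Summable fun k : ℤ => (1 + (2 * Real.pi * k) ^ 2 : ℝ)⁻¹ := by
  refine Summable.of_norm_bounded_eventually (g := fun k : ℤ => 1 / (k : ℝ) ^ 2)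
    (Real.summable_one_div_int_pow.2 one_lt_two) ?_
  rw [Filter.eventually_cofinite]
  refine (Set.finite_singleton (0 : ℤ)).subset fun k hk => ?_
  by_contra h0
  refine hk ?_
  have hk0 : (0 : ℝ) < (k : ℝ) ^ 2 := by
    have : (k : ℝ) ≠ 0 := by exact_mod_cast h0
    positivity
  rw [Real.norm_of_nonneg (by positivity), one_div]
  refine inv_anti₀ hk0 ?_
  have h2 : (1 : ℝ) ≤ (2 * Real.pi) ^ 2 := by nlinarith [Real.pi_gt_three]
  rw [mul_pow]
  nlinarith

/-- The Fourier multiplier `∏ (1 + 4π² r_i²)⁻¹`. -/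
def weight (r : Fin n → ℤ) : ℝ := ∏ i, (1 + (2 * Real.pi * r i) ^ 2 : ℝ)⁻¹

theorem weight_pos (r : Fin n → ℤ) : 0 < weight r :=
  Finset.prod_pos fun i _ => by positivity

theorem summable_weight : Summable (weight (n := n)) := by
  have h := summable_inv_one_add_sq
  have h0 : ∀ k : ℤ, 0 ≤ (1 + (2 * Real.pi * k) ^ 2 : ℝ)⁻¹ := fun k => by positivity
  unfold weight
  generalize hw : (fun k : ℤ => (1 + (2 * Real.pi * k) ^ 2 : ℝ)⁻¹) = w at h
  have hw' : ∀ k : ℤ, (1 + (2 * Real.pi * k) ^ 2 : ℝ)⁻¹ = w k := fun k => by rw [← hw]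
  simp only [hw'] at h0 ⊢
  exact summable_prod_apply h0 h

end PeriodicFourier

/-! ### Lifting smooth functions to the twisted group algebra -/

section SmoothLift

open TwAlg

instance isFiniteMeasure_restrict_cube {n : ℕ} :
    IsFiniteMeasure ((volume : Measure (Fin n → ℝ)).restrict (Set.Icc 0 1)) :=
  ⟨by rw [Measure.restrict_apply_univ]; exact isCompact_Icc.measure_lt_top⟩

variable {m n : ℕ} {M : Type*} [TopologicalSpace M] [ChartedSpace (Eu m) M]
  [IsManifold (𝓡 m) ∞ M] (A : ToricManifold m n M)

namespace ToricManifold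

theorem act_neg_add (s t : Fin n → ℝ) (x : M) :
    A.act (-(t + s)) x = A.act (-t) (A.act (-s) x) := by
  rw [neg_add, A.act_add]

theorem act_neg_add_int (k : Fin n → ℤ) (t : Fin n → ℝ) (x : M) :
    A.act (-(t + fun i => (k i : ℝ))) x = A.act (-t) x := by
  rw [act_neg_add]
  have := A.act_int (-k) x
  rw [show (fun i => (((-k) i : ℤ) : ℝ)) = -fun i => (k i : ℝ) by ext i; simp] at this
  rw [this]

theorem contDiffOn_orbit {V : Type*} [NormedAddCommGroup V] [NormedSpace ℝ V] {f : M → V}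
    (hf : ContMDiff (𝓡 m) 𝓘(ℝ, V) ∞ f) (p : M) :
    ContDiffOn ℝ ∞ (fun z : (Fin n → ℝ) × Eu m =>
      f (A.act (-z.1) ((extChartAt (𝓡 m) p).symm z.2)))
      (Set.univ ×ˢ (extChartAt (𝓡 m) p).target) := by
  rw [← contMDiffOn_iff_contDiffOn]
  have h1 : ContMDiff 𝓘(ℝ, (Fin n → ℝ) × Eu m) 𝓘(ℝ, Fin n → ℝ) ∞
      fun z : (Fin n → ℝ) × Eu m => -z.1 := contDiff_fst.neg.contMDiff
  have h2 : ContMDiffOn 𝓘(ℝ, (Fin n → ℝ) × Eu m) (𝓡 m) ∞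
      (fun z : (Fin n → ℝ) × Eu m => (extChartAt (𝓡 m) p).symm z.2)
      (Set.univ ×ˢ (extChartAt (𝓡 m) p).target) :=
    (contMDiffOn_extChartAt_symm (n := ∞) p).comp
      (contDiff_snd.contMDiff.contMDiffOn) fun z hz => hz.2
  exact (hf.comp A.act_smooth).comp_contMDiffOn (h1.contMDiffOn.prodMk h2)

theorem contDiff_orbit {V : Type*} [NormedAddCommGroup V] [NormedSpace ℝ V] {f : M → V}
    (hf : ContMDiff (𝓡 m) 𝓘(ℝ, V) ∞ f) (x : M) : ContDiff ℝ ∞ fun t => f (A.act (-t) x) := by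
  have h1 := (A.contDiffOn_orbit hf x).comp
    (contDiff_id.prodMk (contDiff_const (c := extChartAt (𝓡 m) x x))).contDiffOn
    (s := Set.univ) fun t _ => ⟨trivial, mem_extChartAt_target x⟩
  refine contDiffOn_univ.1 (h1.congr fun t _ => ?_)
  simp only [Function.comp, id, extChartAt_to_inv]

/-- The derivative of a function along the `i`-th generator of the torus action. -/
def flowD (i : Fin n) (f : M → ℂ) (x : M) : ℂ :=
  fderiv ℝ (fun t => f (A.act (-t) x)) 0 (Pi.single i 1)

theorem contMDiff_flowD (i : Fin n) {f : M → ℂ} (hf : ContMDiff (𝓡 m) 𝓘(ℝ, ℂ) ∞ f) :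
    ContMDiff (𝓡 m) 𝓘(ℝ, ℂ) ∞ (A.flowD i f) := by
  refine contMDiff_of_charts fun p => ?_
  have hopen : IsOpen (Set.univ ×ˢ (extChartAt (𝓡 m) p).target : Set ((Fin n → ℝ) × Eu m)) :=
    isOpen_univ.prod (isOpen_extChartAt_target p)
  have h0 := A.contDiffOn_orbit hf p
  have h1 := h0.fderiv_of_isOpen hopen (m := ∞) (by norm_cast)
  refine ⟨fun y => fderiv ℝ (fun z : (Fin n → ℝ) × Eu m =>
      f (A.act (-z.1) ((extChartAt (𝓡 m) p).symm z.2))) (0, y) (Pi.single i 1, 0),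
    (h1.comp (contDiff_const.prodMk contDiff_id).contDiffOn fun y hy => ⟨trivial, hy⟩).clm_apply
      contDiffOn_const, fun x hx => ?_⟩
  have h2 := ((h0.contDiffAt (hopen.mem_nhds (x := ((0 : Fin n → ℝ), extChartAt (𝓡 m) p x))
    ⟨trivial, (extChartAt (𝓡 m) p).map_source hx⟩)).differentiableAt (by simp)).hasFDerivAt
  have h3 := HasFDerivAt.comp (f := fun t : Fin n → ℝ => (id t, extChartAt (𝓡 m) p x)) 0 h2
    ((hasFDerivAt_id (𝕜 := ℝ) (0 : Fin n → ℝ)).prodMk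
      (hasFDerivAt_const (extChartAt (𝓡 m) p x) (0 : Fin n → ℝ)))
  have h4 : ((fun z : (Fin n → ℝ) × Eu m => f (A.act (-z.1) ((extChartAt (𝓡 m) p).symm z.2))) ∘
      fun t : Fin n → ℝ => (id t, extChartAt (𝓡 m) p x)) = fun t => f (A.act (-t) x) := by
    funext t
    simp only [Function.comp, id, (extChartAt (𝓡 m) p).left_inv hx]
  rw [h4] at h3
  rw [flowD, h3.fderiv]
  simp

theorem hasDerivAt_flow (i : Fin n) {f : M → ℂ} (hf : ContMDiff (𝓡 m) 𝓘(ℝ, ℂ) ∞ f)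
    (t : Fin n → ℝ) (x : M) : HasDerivAt (fun s : ℝ => f (A.act (-(t + s • Pi.single i 1)) x))
      (A.flowD i f (A.act (-t) x)) 0 := by
  have h1 := ((A.contDiff_orbit hf (A.act (-t) x)).differentiable (by simp) 0).hasFDerivAt
  have h2 : HasDerivAt (fun s : ℝ => s • (Pi.single i 1 : Fin n → ℝ)) (Pi.single i 1) 0 := by
    simpa using (hasDerivAt_id (0 : ℝ)).smul_const (Pi.single i 1 : Fin n → ℝ)
  have h3 := h1.comp_hasDerivAt_of_eq 0 h2 (by simp)
  refine h3.congr_of_eventuallyEq (.of_forall fun s => ?_)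
  simp only [Function.comp, add_comm t, act_neg_add]

/-- The Fourier coefficients of `t ↦ f(α_{-t} x)`. -/
def fc (r : Fin n → ℤ) (f : M → ℂ) (x : M) : ℂ :=
  ∫ t in Set.Icc (0 : Fin n → ℝ) 1, char (-r) t * f (A.act (-t) x)

theorem fc_act {f : M → ℂ} (hf : ContMDiff (𝓡 m) 𝓘(ℝ, ℂ) ∞ f) (r : Fin n → ℤ)
    (s : Fin n → ℝ) (x : M) : A.fc r f (A.act (-s) x) = char r s * A.fc r f x := by
  rw [fc, fc, ← integral_shift (A.contDiff_orbit hf x).continuous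
    (fun k t => by rw [act_neg_add_int]) r s]
  simp only [act_neg_add]

theorem fc_flowD {f : M → ℂ} (hf : ContMDiff (𝓡 m) 𝓘(ℝ, ℂ) ∞ f) (r : Fin n → ℤ)
    (i : Fin n) (x : M) : A.fc r (A.flowD i f) x = 2 * Real.pi * Complex.I * r i * A.fc r f x := by
  have hc : ∀ r : Fin n → ℤ, ContDiff ℝ ∞ (char r) := fun r =>
    Complex.contDiff_exp.comp (contDiff_const.mul (ContDiff.sum fun i _ =>
      contDiff_const.mul (Complex.ofRealCLM.contDiff.comp (contDiff_apply ℝ ℝ i))))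
  have h1 : ContDiff ℝ ∞ fun z : (Fin n → ℝ) × ℝ =>
      char (-r) z.1 * f (A.act (-(z.1 + z.2 • Pi.single i 1)) x) :=
    ((hc (-r)).comp contDiff_fst).mul ((A.contDiff_orbit hf x).comp
      (contDiff_fst.add (contDiff_snd.smul contDiff_const)))
  have h2 := hasDerivAt_parametric_integral
    (μ := volume.restrict (Set.Icc (0 : Fin n → ℝ) 1)) (q := fun t => t)
    (g' := fun t => char (-r) t * A.flowD i f (A.act (-t) x)) (s := 0)
    (h1.of_le (by norm_cast)) aestronglyMeasurable_id isCompact_Icc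
    (ae_restrict_mem measurableSet_Icc) fun t =>
      (A.hasDerivAt_flow i hf t x).const_mul (char (-r) t)
  have h3 : HasDerivAt (fun s : ℝ => char r (s • Pi.single i 1))
      (2 * Real.pi * Complex.I * r i) 0 := by
    have e1 : ∀ s : ℝ, char r (s • Pi.single i 1) =
        Complex.exp (2 * Real.pi * Complex.I * r i * s) := fun s => by
      rw [char]
      congr 1
      rw [Finset.sum_eq_single i (fun j _ hj => by simp [hj]) (by simp)]
      simp
      ring
    simp only [e1]
    have h4 : HasDerivAt (fun s : ℝ => (2 * Real.pi * Complex.I * r i * s : ℂ))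
        (2 * Real.pi * Complex.I * r i) 0 := by
      simpa using (Complex.ofRealCLM.hasDerivAt (x := (0 : ℝ))).const_mul
        (2 * Real.pi * Complex.I * r i : ℂ)
    simpa using h4.cexp
  have h5 := h3.mul_const (A.fc r f x)
  refine h2.unique (h5.congr_of_eventuallyEq (.of_forall fun s => ?_))
  simp only [← A.fc_act hf]
  simp only [fc, act_neg_add]

/-- The Fourier coefficients of a smooth function are those of the smooth function `∏ (1 - ∂ᵢ²)
f`, multiplied by the summable factor `weight r`. -/
theorem exists_fc_eq_weight {f : M → ℂ} (hf : ContMDiff (𝓡 m) 𝓘(ℝ, ℂ) ∞ f) :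
    ∃ f' : M → ℂ, ContMDiff (𝓡 m) 𝓘(ℝ, ℂ) ∞ f' ∧
      ∀ r x, (weight r : ℂ) * A.fc r f' x = A.fc r f x := by
  classical
  have key : ∀ s : Finset (Fin n), ∃ f' : M → ℂ, ContMDiff (𝓡 m) 𝓘(ℝ, ℂ) ∞ f' ∧
      ∀ r x, A.fc r f' x = (∏ i ∈ s, (1 + (2 * Real.pi * r i) ^ 2 : ℝ) : ℝ) * A.fc r f x := by
    intro s
    induction s using Finset.induction_on with
    | empty => exact ⟨f, hf, fun r x => by simp⟩
    | insert i s hi ih =>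
      obtain ⟨f', h1, h2⟩ := ih
      have h3 := A.contMDiff_flowD i h1
      have h4 := A.contMDiff_flowD i h3
      refine ⟨fun x => f' x - A.flowD i (A.flowD i f') x, h1.sub h4, fun r x => ?_⟩
      have hint : ∀ {k : M → ℂ}, ContMDiff (𝓡 m) 𝓘(ℝ, ℂ) ∞ k → Integrable
          (fun t => char (-r) t * k (A.act (-t) x)) (volume.restrict (Set.Icc (0 : Fin n → ℝ) 1)) :=
        fun hk => ((continuous_char _).mul
          (A.contDiff_orbit hk x).continuous).continuousOn.integrableOn_compact isCompact_Icc
      have h5 : A.fc r (fun x => f' x - A.flowD i (A.flowD i f') x) x =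
          A.fc r f' x - A.fc r (A.flowD i (A.flowD i f')) x := by
        simp only [fc, mul_sub]
        exact integral_sub (hint h1) (hint h4)
      rw [h5, A.fc_flowD h3, A.fc_flowD h1, h2, Finset.prod_insert hi]
      push_cast
      linear_combination (-(2 * Real.pi * r i) ^ 2 * (∏ i ∈ s, (1 + (2 * Real.pi * r i) ^ 2 : ℂ))
        * A.fc r f x : ℂ) * Complex.I_sq
  obtain ⟨f', h1, h2⟩ := key Finset.univ
  refine ⟨f', h1, fun r x => ?_⟩
  rw [h2, ← mul_assoc, ← Complex.ofReal_mul, weight, ← Finset.prod_mul_distrib,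
    Finset.prod_eq_one fun i _ => inv_mul_cancel₀ (by positivity)]
  simp

end ToricManifold

variable (θ : Matrix (Fin n) (Fin n) ℝ)

/-- The element of the twisted group algebra with coefficients `∏ (1 + 4π² r_i²)⁻¹`. -/
def weightElt : TwAlg θ := ∑' r, (weight r : ℂ) • u θ r

theorem coef_weightElt (r : Fin n → ℤ) : coef r (weightElt θ) = weight r := by
  have h1 : Summable fun r : Fin n → ℤ => (weight r : ℂ) • u θ r :=
    Summable.of_norm (by simpa [norm_smul, norm_u, abs_of_pos (weight_pos _)] using summable_weight)
  rw [weightElt, (coef r).map_tsum h1, tsum_eq_single r fun k hk => by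
    simp [coef_u, hk.symm]]
  simp [coef_u]

variable {θ}

theorem TwAlg.continuous_rot (a : TwAlg θ) : Continuous fun t => rot t a := by
  have h : (fun t => rot t a) = fun t => ∑' r, (char r t * coef r a) • u θ r := by
    funext t
    simpa only [coef_rot] using (hasSum_u (rot t a)).tsum_eq.symm
  rw [h]
  refine continuous_tsum (fun r => ((continuous_char r).mul continuous_const).smul continuous_const)
    (hasSum_norm_coef a).summable fun r t => ?_
  rw [norm_smul, norm_u, mul_one, norm_mul, norm_char, one_mul]

/-- A smooth function on `M` is the composite of a smooth equivariant map into the twisted group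
algebra with the sum of coefficients. -/
theorem ToricManifold.exists_lift {f : M → ℂ} (hf : ContMDiff (𝓡 m) 𝓘(ℝ, ℂ) ∞ f) :
    ∃ X : M → TwAlg θ, ContMDiff (𝓡 m) 𝓘(ℝ, TwAlg θ) ∞ X ∧ (∀ x, f x = ev (X x)) ∧
      (∀ t x, X (A.act (-t) x) = rot t (X x)) ∧ ∀ r x, coef r (X x) = A.fc r f x := by
  obtain ⟨f', h1, h2⟩ := A.exists_fc_eq_weight hf
  have hrot : Continuous fun t : Fin n → ℝ => rot (-t) (weightElt θ) :=
    (continuous_rot (weightElt θ)).comp continuous_neg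
  -- Averaging over the torus produces the coefficient `weight r * fc r f'` at `r`, and keeps the
  -- smoothness in `x` visible.
  let X : M → TwAlg θ := fun x =>
    ∫ t in Set.Icc (0 : Fin n → ℝ) 1, f' (A.act (-t) x) • rot (-t) (weightElt θ)
  have hcoef : ∀ r x, coef r (X x) = A.fc r f x := fun r x => by
    have hi : Integrable (fun t => f' (A.act (-t) x) • rot (-t) (weightElt θ))
        (volume.restrict (Set.Icc (0 : Fin n → ℝ) 1)) :=
      ((A.contDiff_orbit h1 x).continuous.smul hrot).continuousOn.integrableOn_compact isCompact_Icc
    rw [← (coef r).integral_comp_comm hi, ← h2, ToricManifold.fc, ← integral_const_mul]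
    refine integral_congr_ae (.of_forall fun t => ?_)
    simp only [map_smul, coef_rot, coef_weightElt, smul_eq_mul, char_neg]
    ring
  refine ⟨X, contMDiff_of_charts fun p => ⟨fun y => ∫ t in Set.Icc (0 : Fin n → ℝ) 1,
    f' (A.act (-t) ((extChartAt (𝓡 m) p).symm y)) • rot (-t) (weightElt θ), ?_, fun x hx => ?_⟩,
    fun x => ?_, fun t x => ?_, hcoef⟩
  · have hq : Continuous fun t : Fin n → ℝ => (t, rot (-t) (weightElt θ)) :=
      continuous_id.prodMk hrot
    refine contDiffOn_parametric_integral (μ := volume.restrict (Set.Icc (0 : Fin n → ℝ) 1))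
      (P := (Fin n → ℝ) × TwAlg θ) (q := fun t => (t, rot (-t) (weightElt θ)))
      (g := fun z => f' (A.act (-z.1.1) ((extChartAt (𝓡 m) p).symm z.2)) • z.1.2)
      (isOpen_extChartAt_target p) ?_ hq.aestronglyMeasurable (isCompact_Icc.image hq)
      ((ae_restrict_mem measurableSet_Icc).mono fun t ht => Set.mem_image_of_mem _ ht)
    have h3 : ContDiff ℝ ∞ fun z : ((Fin n → ℝ) × TwAlg θ) × Eu m => (z.1.1, z.2) := by fun_prop
    have h4 : ContDiff ℝ ∞ fun z : ((Fin n → ℝ) × TwAlg θ) × Eu m => z.1.2 := by fun_prop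
    exact ((A.contDiffOn_orbit h1 p).comp h3.contDiffOn fun z hz => ⟨trivial, hz.2⟩).smul
      h4.contDiffOn
  · simp only [X, (extChartAt (𝓡 m) p).left_inv hx]
  · have h3 := hasSum_fourier_zero (A.contDiff_orbit hf x).continuous
      (fun k t => by rw [A.act_neg_add_int]) (by
        have := (hasSum_ev (X x)).summable
        simp only [hcoef] at this
        exact this)
    rw [neg_zero, A.act_zero] at h3
    have h4 := hasSum_ev (X x)
    simp only [hcoef] at h4
    exact h3.unique h4
  · refine ext_coef fun r => ?_
    rw [hcoef, A.fc_act hf, coef_rot, hcoef]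

end SmoothLift

/-! ### Tensor fields represented in the twisted group algebra -/

section Representation

open TwAlg

variable {m n : ℕ} {M : Type*} [TopologicalSpace M] [ChartedSpace (Eu m) M]
  [IsManifold (𝓡 m) ∞ M]

/-- A kind of tensor fields with values in `V`, with its pull-back action `U` of the torus: tensors
are determined by their evaluations `coord k` at tuples `k` of tangent vectors, and `push t x`
carries a tuple at `x` to one at `α_{-t} x`. -/
structure TensorKind (A : ToricManifold m n M) (V : Type*) [NormedAddCommGroup V]
    [NormedSpace ℂ V] where
  ι : Type
  U : (Fin n → ℝ) → (M → V) → M → V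
  coord : ι → V →L[ℂ] ℂ
  frame : (ι → ℂ) →L[ℂ] V
  frame_coord : ∀ v, frame (fun k => coord k v) = v
  push : (Fin n → ℝ) → M → ι → ι
  coord_U : ∀ t s x k, coord k (U t s x) = coord (push t x k) (s (A.act (-t) x))

variable {A : ToricManifold m n M} {θ : Matrix (Fin n) (Fin n) ℝ}
  {V W Z : Type*} [NormedAddCommGroup V] [NormedSpace ℂ V] [CompleteSpace V]
  [NormedAddCommGroup W] [NormedSpace ℂ W] [CompleteSpace W]
  [NormedAddCommGroup Z] [NormedSpace ℂ Z] [CompleteSpace Z]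

namespace TensorKind

/-- The equivariant family `F` of elements of the twisted group algebra represents the tensor
field `s`. -/
def Rep (K : TensorKind A V) (s : M → V) (F : M → K.ι → TwAlg θ) : Prop :=
  (∀ x k, K.coord k (s x) = ev (F x k)) ∧
    ∀ t x k, F (A.act (-t) x) (K.push t x k) = rot t (F x k)

theorem coord_tsum (K : TensorKind A V) {ι' : Type*} {z : ι' → V} {g : K.ι → ℂ}
    (h : ∀ k, HasSum (fun i => K.coord k (z i)) (g k)) (k : K.ι) :
    K.coord k (∑' i, z i) = g k := by
  have h1 := K.frame.hasSum (Pi.hasSum.2 h)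
  simp only [K.frame_coord] at h1
  rw [h1.tsum_eq]
  exact ((K.coord k).hasSum h1).unique (h k)

namespace Rep

variable {K : TensorKind A V} {K' : TensorKind A W} {K'' : TensorKind A Z} {s s' : M → V}
  {F F' : M → K.ι → TwAlg θ}

/-- The isotypic components of a tensor field are the coefficients of its representative. -/
theorem coord_isotypic (h : K.Rep s F) (r : Fin n → ℤ) (x : M) (k : K.ι) :
    K.coord k (isotypic K.U r s x) = coef r (F x k) := by
  have h1 : ∀ t k, K.coord k (K.U t s x) = ev (rot t (F x k)) := fun t k => by
    rw [K.coord_U, h.1, h.2]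
  have h2 : Continuous fun t => K.U t s x := by
    have : (fun t => K.U t s x) = fun t => K.frame fun k => ev (rot t (F x k)) := by
      funext t
      rw [← K.frame_coord (K.U t s x)]
      simp only [h1]
    rw [this]
    exact K.frame.continuous.comp (continuous_pi fun k => continuous_ev_rot _)
  have h3 : ∀ t : Fin n → ℝ, Complex.exp (-2 * Real.pi * Complex.I * ∑ i, (r i : ℂ) * (t i : ℂ)) =
      char (-r) t := fun t => by
    rw [char]
    congr 1
    simp only [Pi.neg_apply, Int.cast_neg, neg_mul, Finset.sum_neg_distrib, mul_neg]
  unfold isotypic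
  simp only [h3]
  have hi : Integrable (fun t => char (-r) t • K.U t s x)
      (volume.restrict (Set.Icc (0 : Fin n → ℝ) 1)) :=
    ((continuous_char _).smul h2).continuousOn.integrableOn_compact isCompact_Icc
  rw [← (K.coord k).integral_comp_comm hi, ← integral_ev_rot]
  simp only [map_smul, h1, smul_eq_mul]

/-- A deformed product is represented by the product in the twisted group algebra. -/
theorem dprod {w : M → W} {F' : M → K'.ι → TwAlg θ} (h : K.Rep s F) (h' : K'.Rep w F')
    {β : V → W → Z} (p : K''.ι → K.ι) (q : K''.ι → K'.ι)
    (hβ : ∀ k v w, K''.coord k (β v w) = K.coord (p k) v * K'.coord (q k) w)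
    (hp : ∀ t x k, K.push t x (p k) = p (K''.push t x k))
    (hq : ∀ t x k, K'.push t x (q k) = q (K''.push t x k)) :
    K''.Rep (ConnesLandi.dprod θ K.U K'.U β s w) (fun x k => F x (p k) * F' x (q k)) := by
  refine ⟨fun x k => ?_, fun t x k => ?_⟩
  · refine K''.coord_tsum (g := fun k => ev (F x (p k) * F' x (q k))) (fun k => ?_) k
    refine (hasSum_ev_mul (F x (p k)) (F' x (q k))).congr_fun fun a => ?_
    rw [map_smul, hβ, h.coord_isotypic, h'.coord_isotypic, smul_eq_mul]
  · rw [rot_mul, ← h.2, ← h'.2, hp, hq]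

theorem add (h : K.Rep s F) (h' : K.Rep s' F') :
    K.Rep (fun x => s x + s' x) (fun x k => F x k + F' x k) :=
  ⟨fun x k => by rw [map_add, map_add, h.1, h'.1], fun t x k => by simp only [map_add, h.2, h'.2]⟩

theorem sub (h : K.Rep s F) (h' : K.Rep s' F') :
    K.Rep (fun x => s x - s' x) (fun x k => F x k - F' x k) :=
  ⟨fun x k => by rw [map_sub, map_sub, h.1, h'.1], fun t x k => by simp only [map_sub, h.2, h'.2]⟩

theorem smul (h : K.Rep s F) (c : ℂ) : K.Rep (fun x => c • s x) (fun x k => c • F x k) :=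
  ⟨fun x k => by rw [map_smul, map_smul, h.1], fun t x k => by simp only [map_smul, h.2]⟩

theorem tsum {ι' : Type*} {z : ι' → M → V} {E : ι' → M → K.ι → TwAlg θ}
    (h : ∀ i, K.Rep (z i) (E i)) (hs : ∀ x k, HasSum (fun i => E i x k) (F x k)) :
    K.Rep (fun x => ∑' i, z i x) F := by
  refine ⟨fun x k => K.coord_tsum (g := fun k => ev (F x k)) (fun k => ?_) k, fun t x k => ?_⟩
  · simp only [(h _).1]
    exact ev.hasSum (hs x k)
  · have h1 := hs (A.act (-t) x) (K.push t x k)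
    simp only [(h _).2] at h1
    exact h1.unique ((rot t).hasSum (hs x k))

end Rep

variable (A)

/-- Functions. -/
def functions : TensorKind A ℂ where
  ι := Unit
  U := A.U₀
  coord _ := ContinuousLinearMap.id ℂ ℂ
  frame := ContinuousLinearMap.proj ()
  frame_coord _ := rfl
  push _ _ k := k
  coord_U _ _ _ _ := rfl

/-- One-forms, evaluated at a tangent vector. -/
def forms : TensorKind A (CForm m) where
  ι := Eu m
  U := A.U₁
  coord u := LinearMap.mkContinuous ⟨⟨fun τ => τ u, fun _ _ => rfl⟩, fun _ _ => rfl⟩ ‖u‖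
    fun τ => by rw [mul_comm]; exact τ.le_opNorm u
  frame := ∑ i, (ContinuousLinearMap.proj (e i)).smulRight (dx i)
  frame_coord τ := by
    refine ContinuousLinearMap.ext fun u => ?_
    conv_rhs => rw [← sum_smul_e u]
    simp [sum_apply, dx, mul_comm]
  push t x u := A.dact (-t) x u
  coord_U _ _ _ _ := rfl

/-- Two-tensors, evaluated at a pair of tangent vectors. -/
def tensors : TensorKind A (CTensor m) where
  ι := Eu m × Eu m
  U := A.U₂
  coord p := LinearMap.mkContinuous ⟨⟨fun b => b p.1 p.2, fun _ _ => rfl⟩, fun _ _ => rfl⟩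
    (‖p.1‖ * ‖p.2‖) fun b => by
      rw [mul_comm, ← mul_assoc]
      exact b.le_opNorm₂ p.1 p.2
  frame := ∑ i, ∑ j, (ContinuousLinearMap.proj (e i, e j)).smulRight (tens (dx i) (dx j))
  frame_coord b := by
    refine clm_ext_e₂ fun i j => ?_
    simp [sum_apply, tens, dx, e_apply, apply_ite]
  push t x p := (A.dact (-t) x p.1, A.dact (-t) x p.2)
  coord_U _ _ _ _ := rfl

end TensorKind

end Representation

/-! ### The local expression in the twisted group algebra -/

section LocalExpression

open TwAlg TensorKind

variable {m n : ℕ} {M : Type*} [TopologicalSpace M] [ChartedSpace (Eu m) M]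
  [IsManifold (𝓡 m) ∞ M] {A : ToricManifold m n M} {θ : Matrix (Fin n) (Fin n) ℝ}
  {V : Type*} [NormedAddCommGroup V] [NormedSpace ℂ V] [CompleteSpace V]

theorem hessE_clm_comp {V W : Type*} [NormedAddCommGroup V] [NormedSpace ℝ V]
    [NormedAddCommGroup W] [NormedSpace ℝ W] {g : Eu m → Eu m →L[ℝ] Eu m →L[ℝ] ℝ}
    (l : V →L[ℝ] W) {F : Eu m → V} {U : Set (Eu m)} (hU : IsOpen U) (hF : ContDiffOn ℝ ∞ F U)
    {y : Eu m} (hy : y ∈ U) (u v : Eu m) :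
    hessE g (fun z => l (F z)) y u v = l (hessE g F y u v) := by
  have h1 : ∀ z ∈ U, fderiv ℝ (fun z => l (F z)) z = l.comp (fderiv ℝ F z) := fun z hz =>
    (l.hasFDerivAt.comp z ((hF.contDiffAt (hU.mem_nhds hz)).differentiableAt
      (by simp)).hasFDerivAt).fderiv
  have h2 : HasFDerivAt (fderiv ℝ F) (fderiv ℝ (fderiv ℝ F) y) y :=
    (((hF.fderiv_of_isOpen hU (m := ∞) (by norm_cast)).contDiffAt (hU.mem_nhds hy)).differentiableAt
      (by simp)).hasFDerivAt
  have h3 : HasFDerivAt (fderiv ℝ fun z => l (F z))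
      ((ContinuousLinearMap.compL ℝ (Eu m) V W l).comp (fderiv ℝ (fderiv ℝ F) y)) y :=
    ((ContinuousLinearMap.compL ℝ (Eu m) V W l).hasFDerivAt.comp y h2).congr_of_eventuallyEq
      (by filter_upwards [hU.mem_nhds hy] with z hz using h1 z hz)
  rw [hessE_apply, hessE_apply, h1 y hy, h3.fderiv, map_sub]
  rfl

theorem ToricManifold.hessM_clm_comp {V W : Type*} [NormedAddCommGroup V] [NormedSpace ℝ V]
    [NormedAddCommGroup W] [NormedSpace ℝ W] (A : ToricManifold m n M) (l : V →L[ℝ] W) {F : M → V}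
    (hF : ContMDiff (𝓡 m) 𝓘(ℝ, V) ∞ F) (x : M) (u v : Eu m) :
    A.hessM (fun x => l (F x)) x u v = l (A.hessM F x u v) :=
  hessE_clm_comp l (isOpen_extChartAt_target x) (contDiffOn_comp_symm hF x)
    (mem_extChartAt_target x) u v

namespace TensorKind.Rep

variable {h f f' : M → ℂ} {X Y : M → TwAlg θ}

theorem mulθ (hf : (functions A).Rep f fun x _ => X x) (hf' : (functions A).Rep f' fun x _ => Y x) :
    (functions A).Rep (ConnesLandi.mulθ A θ f f') fun x _ => X x * Y x :=
  hf.dprod (K'' := functions A) hf' (fun k => k) (fun k => k) (fun _ _ _ => rfl)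
    (fun _ _ _ => rfl) fun _ _ _ => rfl

theorem one : (functions A).Rep (fun _ => 1) fun _ _ => (1 : TwAlg θ) :=
  ⟨fun _ _ => by rw [one_def, ev_u]; rfl, fun t _ _ => (rot_one t).symm⟩

theorem powθ (hf : (functions A).Rep f fun x _ => X x) (k : ℕ) :
    (functions A).Rep (ConnesLandi.powθ A θ f k) fun x _ => X x ^ k := by
  induction k with
  | zero =>
    simp only [pow_zero]
    exact one
  | succ k ih =>
    simp only [pow_succ']
    exact hf.mulθ ih

theorem expθ (hf : (functions A).Rep f fun x _ => X x) :
    (functions A).Rep (ConnesLandi.expθ A θ f) fun x _ => NormedSpace.exp (X x) :=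
  Rep.tsum (fun k => (hf.powθ k).smul ((k ! : ℂ))⁻¹) fun x _ =>
    NormedSpace.exp_series_hasSum_exp' (𝕂 := ℂ) (X x)

theorem modDer {K : TensorKind A V} {s : M → V} {F : M → K.ι → TwAlg θ}
    (hh : (functions A).Rep h fun x _ => X x) (hs : K.Rep s F) :
    K.Rep (ConnesLandi.modDer A θ K.U h s) fun x k => bder (X x) (F x k) := by
  have h1 : K.Rep (ConnesLandi.dprod θ K.U A.U₀ (fun v c => c • v) s h) (fun x k => F x k * X x) :=
    hs.dprod hh (fun k => k) (fun _ => ()) (fun k v c => by rw [map_smul]; exact mul_comm _ _)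
      (fun _ _ _ => rfl) fun _ _ _ => rfl
  have h2 : K.Rep (ConnesLandi.dprod θ A.U₀ K.U (fun c v => c • v) h s) (fun x k => X x * F x k) :=
    hh.dprod hs (fun _ => ()) (fun k => k) (fun k v c => by rw [map_smul]; rfl)
      (fun _ _ _ => rfl) fun _ _ _ => rfl
  have h3 := (h1.sub h2).smul 2
  simp only [bder_apply, ← Complex.coe_smul]
  exact h3

theorem iterate_modDer {K : TensorKind A V} {s : M → V} {F : M → K.ι → TwAlg θ}
    (hh : (functions A).Rep h fun x _ => X x) (hs : K.Rep s F) (k : ℕ) :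
    K.Rep ((ConnesLandi.modDer A θ K.U h)^[k] s) fun x i => (bder (X x))^[k] (F x i) := by
  induction k with
  | zero => exact hs
  | succ k ih =>
    simp only [Function.iterate_succ_apply']
    exact modDer hh ih

theorem calc₁ {W : ℝ → ℝ} (hW : IsExp fun s _ => W s) {b : M → CTensor m}
    {F : M → (tensors A).ι → TwAlg θ} (hh : (functions A).Rep h fun x _ => X x)
    (hb : (tensors A).Rep b F) :
    (tensors A).Rep (ConnesLandi.calc₁ A θ W h b)
      fun x k => bcalc (fun s _ => W s) (X x) (F x k) 1 :=
  Rep.tsum (fun k => (iterate_modDer hh hb k).smul _) fun x k => by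
    simpa only [Complex.coe_smul] using IsExp.hasSum_bcalc_one hW (X x) (F x k)

theorem calc₂ {H : ℝ → ℝ → ℝ} (hH : IsExp H) {τ η : M → CForm m}
    {F F' : M → (forms A).ι → TwAlg θ} (hh : (functions A).Rep h fun x _ => X x)
    (hτ : (forms A).Rep τ F) (hη : (forms A).Rep η F') :
    (tensors A).Rep (ConnesLandi.calc₂ A θ H h τ η)
      fun x k => bcalc H (X x) (F x k.1) (F' x k.2) :=
  Rep.tsum (fun p => ((iterate_modDer hh hτ p.1).dprod (K'' := tensors A)
      (iterate_modDer hh hη p.2) (fun k => k.1) (fun k => k.2) (fun _ _ _ => rfl)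
      (fun _ _ _ => rfl) fun _ _ _ => rfl).smul _) fun x k => by
    simpa only [Complex.coe_smul, taylor₂] using hH.hasSum_bcalc (X x) (F x k.1) (F' x k.2)

theorem comp_act (hf : (functions A).Rep f fun x _ => X x) (t : Fin n → ℝ) :
    X ∘ A.act (-t) = fun x => rot t (X x) :=
  funext fun x => hf.2 t x ()

theorem eq_ev (hf : (functions A).Rep f fun x _ => X x) : f = fun x => ev (X x) :=
  funext fun x => hf.1 x ()

theorem contMDiff (hf : (functions A).Rep f fun x _ => X x)
    (hX : ContMDiff (𝓡 m) 𝓘(ℝ, TwAlg θ) ∞ X) : ContMDiff (𝓡 m) 𝓘(ℝ, ℂ) ∞ f := by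
  rw [hf.eq_ev]
  exact (ev.restrictScalars ℝ).contMDiff.comp hX

theorem grad₁ (hh : (functions A).Rep h fun x _ => X x)
    (hX : ContMDiff (𝓡 m) 𝓘(ℝ, TwAlg θ) ∞ X) :
    (forms A).Rep (ToricManifold.grad₁ h) fun x (u : Eu m) => dM (m := m) X x u := by
  refine ⟨fun x (u : Eu m) => ?_, fun t x (u : Eu m) => ?_⟩
  · change (ToricManifold.grad₁ h x) u = _
    unfold ToricManifold.grad₁
    rw [← dM_eq_mfderiv ((hh.contMDiff hX).mdifferentiable (by simp) x), hh.eq_ev]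
    exact congrArg (fun l => l u) (hasFDerivAt_comp_symm (ev.restrictScalars ℝ).hasFDerivAt hX)
  · change dM (m := m) X (A.act (-t) x) (A.dact (-t) x u) = rot t (dM (m := m) X x u)
    rw [← A.dM_act (-t) x hX, hh.comp_act]
    exact congrArg (fun l => l u) (hasFDerivAt_comp_symm ((rot t).restrictScalars ℝ).hasFDerivAt hX)

theorem hess (hh : (functions A).Rep h fun x _ => X x)
    (hX : ContMDiff (𝓡 m) 𝓘(ℝ, TwAlg θ) ∞ X) :
    (tensors A).Rep (A.hess h) fun x (p : Eu m × Eu m) => A.hessM X x p.1 p.2 := by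
  refine ⟨fun x (p : Eu m × Eu m) => ?_, fun t x (p : Eu m × Eu m) => ?_⟩
  · change (A.hess h x) p.1 p.2 = _
    rw [A.hess_eq, hh.eq_ev]
    exact A.hessM_clm_comp (ev.restrictScalars ℝ) hX x p.1 p.2
  · change A.hessM X (A.act (-t) x) (A.dact (-t) x p.1) (A.dact (-t) x p.2) =
      rot t (A.hessM X x p.1 p.2)
    rw [← A.hessM_act (-t) x hX, hh.comp_act]
    exact A.hessM_clm_comp ((rot t).restrictScalars ℝ) hX x p.1 p.2

theorem contract {b : M → CTensor m} {β : M → Eu m →L[ℝ] Eu m →L[ℝ] TwAlg θ}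
    (hb : (tensors A).Rep b fun x (p : Eu m × Eu m) => β x p.1 p.2) :
    (functions A).Rep (A.contract b) fun x _ => A.contrM β x := by
  refine ⟨fun x _ => ?_, fun t x _ => ?_⟩
  · rw [A.contract_eq]
    exact gcontr_comp (ev.restrictScalars ℝ) _ _ _ fun u v => hb.1 x (u, v)
  · change A.contrM β (A.act (-t) x) = rot t (A.contrM β x)
    have h1 : ∀ u v, (ContinuousLinearMap.compL ℝ (Eu m) (TwAlg θ) (TwAlg θ)
        ((rot t).restrictScalars ℝ)).comp (β x) u v = rot t (β x u v) := fun u v => rfl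
    refine (A.gcontr_act (-t) x fun u v => ?_).symm.trans
      (gcontr_comp ((rot t).restrictScalars ℝ) _ _ _ h1)
    exact (h1 u v).trans (hb.2 t x (u, v)).symm

theorem scalarCurvature :
    (functions A).Rep (fun x => (A.scalarCurvature x : ℂ))
      fun x _ => A.scalarCurvature x • (1 : TwAlg θ) := by
  refine ⟨fun x _ => ?_, fun t x _ => ?_⟩
  · change (A.scalarCurvature x : ℂ) = ev (A.scalarCurvature x • (1 : TwAlg θ))
    rw [← Complex.coe_smul, map_smul, one_def, ev_u, smul_eq_mul, mul_one]
  · change A.scalarCurvature (A.act (-t) x) • (1 : TwAlg θ) =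
      rot t (A.scalarCurvature x • (1 : TwAlg θ))
    rw [← Complex.coe_smul, ← Complex.coe_smul, map_smul, rot_one, A.scalarCurvature_act]

/-- The local expression is represented by its analogue in the twisted group algebra. -/
theorem localExpr {K : ℝ → ℝ} {H : ℝ → ℝ → ℝ} (hK : IsExp fun s _ => K s) (hH : IsExp H) (c : ℝ)
    (hh : (functions A).Rep h fun x _ => X x) (hX : ContMDiff (𝓡 m) 𝓘(ℝ, TwAlg θ) ∞ X) :
    (functions A).Rep (ConnesLandi.localExpr A θ K H c h)
      fun x _ => A.localB (j₀ m) K H c X x := by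
  have h1 : (tensors A).Rep (fun z => ConnesLandi.calc₁ A θ K h (A.hess h) z
      + ConnesLandi.calc₂ A θ H h (ToricManifold.grad₁ h) (ToricManifold.grad₁ h) z)
      fun x (p : Eu m × Eu m) => (kcalcT K (X x) (A.hessM X x)
        + bcalcT H (X x) (dM (m := m) X x) (dM X x)) p.1 p.2 := by
    simp only [add_apply, kcalcT_apply hK, bcalcT_apply hH]
    exact (calc₁ hK hh (hh.hess hX)).add (calc₂ hH hh (hh.grad₁ hX) (hh.grad₁ hX))
  have h2 : (functions A).Rep (ConnesLandi.expθ A θ fun z => (2 - (m : ℂ)) * h z)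
      fun x _ => bexp (-2 * j₀ m) (X x) := by
    have h3 := (hh.smul (2 - (m : ℂ))).expθ
    have h4 : ((2 : ℂ) - m) = ((-2 * j₀ m : ℝ) : ℂ) := by
      rw [j₀]
      push_cast
      ring
    unfold bexp
    simp only [← Complex.coe_smul, ← h4]
    exact h3
  have h3 := (h2.mulθ h1.contract).add ((h2.mulθ scalarCurvature).smul c)
  have h4 : (fun x (_ : Unit) => A.localB (j₀ m) K H c X x) = fun x _ =>
      bexp (-2 * j₀ m) (X x) * A.contrM (fun x => kcalcT K (X x) (A.hessM X x)
        + bcalcT H (X x) (dM (m := m) X x) (dM X x)) x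
      + (c : ℂ) • (bexp (-2 * j₀ m) (X x) * A.scalarCurvature x • (1 : TwAlg θ)) := by
    funext x _
    rw [ToricManifold.localB, Complex.coe_smul, mul_smul_comm, mul_one, smul_smul]
    rfl
  exact h4 ▸ h3

end TensorKind.Rep

end LocalExpression

/-! ### The functional on the twisted group algebra -/

section Trace

open TwAlg TensorKind

variable {m n : ℕ} {M : Type*} [TopologicalSpace M] [ChartedSpace (Eu m) M]
  [IsManifold (𝓡 m) ∞ M] (A : ToricManifold m n M)

theorem ToricManifold.contMDiff_localB {B : Type*} [NormedRing B] [NormedAlgebra ℝ B]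
    [CompleteSpace B] (j : ℝ) {K : ℝ → ℝ} {H : ℝ → ℝ → ℝ} (hK : IsExp fun s _ => K s)
    (hH : IsExp H) (c : ℝ) {X : M → B} (hX : ContMDiff (𝓡 m) 𝓘(ℝ, B) ∞ X) :
    ContMDiff (𝓡 m) 𝓘(ℝ, B) ∞ (A.localB j K H c X) := by
  have h1 : ContMDiff (𝓡 m) 𝓘(ℝ, B) ∞ fun x => bexp (-2 * j) (X x) := by
    have h : ContDiff ℝ ∞ fun h : B => bexp (-2 * j) h :=
      (contDiff_bexp (B := B)).comp (contDiff_const.prodMk contDiff_id)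
    exact h.contMDiff.comp hX
  have h2 : ContMDiff (𝓡 m) 𝓘(ℝ, B) ∞ (A.contrM fun x =>
      kcalcT K (X x) (A.hessM X x) + bcalcT H (X x) (dM (m := m) X x) (dM X x)) := by
    refine A.contMDiff_contrM (fun p y =>
      kcalcT K ((X ∘ (extChartAt (𝓡 m) p).symm) y)
        (hessE (A.gForm p) (X ∘ (extChartAt (𝓡 m) p).symm) y)
      + bcalcT H ((X ∘ (extChartAt (𝓡 m) p).symm) y)
        (fderiv ℝ (X ∘ (extChartAt (𝓡 m) p).symm) y)
        (fderiv ℝ (X ∘ (extChartAt (𝓡 m) p).symm) y)) (fun p => ?_) fun p x hx u v => ?_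
    · have e0 := contDiffOn_comp_symm hX p
      have e1 := e0.fderiv_of_isOpen (m := ∞) (isOpen_extChartAt_target p) (by norm_cast)
      exact (contDiffOn_kcalcT hK e0 ((A.isMetricOn_gForm p).contDiffOn_hessE e0)).add
        (contDiffOn_bcalcT hH e0 e1 e1)
    · simp only [add_apply, kcalcT_apply hK, bcalcT_apply hH, Function.comp,
        (extChartAt (𝓡 m) p).left_inv hx]
      rw [← A.fderiv_transfer hx hX, ← A.fderiv_transfer hx hX, ← A.hessE_transfer hx hX]
  have h3 := (contDiff_fst.mul contDiff_snd : ContDiff ℝ ∞ fun p : B × B => p.1 * p.2)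
  have h4 : ContMDiff (𝓡 m) 𝓘(ℝ, ℝ) ∞ fun x => c * A.scalarCurvature x :=
    contMDiff_const.mul A.contMDiff_scalarCurvature
  exact (h3.contMDiff.comp (h1.prodMk_space h2)).add (h4.smul h1)

variable {A} {θ : Matrix (Fin n) (Fin n) ℝ} [T2Space M] [CompactSpace M] [MeasurableSpace M]
  [BorelSpace M]

theorem exists_char_eq_neg_one {r : Fin n → ℤ} (hr : r ≠ 0) : ∃ t, char r t = -1 := by
  obtain ⟨i, hi⟩ := Function.ne_iff.1 hr
  have hi' : (r i : ℂ) ≠ 0 := by exact_mod_cast hi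
  refine ⟨Pi.single i (1 / (2 * r i)), ?_⟩
  rw [char, Finset.sum_eq_single i (fun j _ hj => by simp [hj]) (by simp), ← Complex.exp_pi_mul_I]
  congr 1
  simp only [Pi.single_eq_same]
  push_cast
  field_simp

theorem coef_integral_eq_zero {F : M → TwAlg θ} (hc : Continuous F)
    (hF : ∀ t x, F (A.act (-t) x) = rot t (F x)) {r : Fin n → ℤ} (hr : r ≠ 0) :
    ∫ x, coef r (F x) ∂A.volM = 0 := by
  obtain ⟨t, ht⟩ := exists_char_eq_neg_one hr
  have h1 := A.integral_act (-t) ((coef (θ := θ) r).continuous.comp hc)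
  -- Invariance of the volume under a `t` with `char r t = -1` shows that the integral equals its
  -- negative.
  simp only [Function.comp, hF, coef_rot, ht, neg_one_mul, integral_neg] at h1
  exact CharZero.eq_neg_self_iff.1 h1.symm

/-- The functional `φ₀` is the integral of the coefficient at the unit, because the torus acts by
isometries. -/
theorem φ₀_eq_integral_coef {f : M → ℂ} {F : M → TwAlg θ}
    (h : (functions A).Rep f fun x _ => F x) (hc : Continuous F) :
    A.φ₀ f = 2 ^ (m / 2) * ∫ x, coef 0 (F x) ∂A.volM := by
  have hi := A.integrable_volM hc
  rw [ToricManifold.φ₀, h.eq_ev,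
    A.integral_eq (f := fun x => ev (F x)) (ev.continuous.comp hc),
    (ev (θ := θ)).integral_comp_comm hi, (coef 0).integral_comp_comm hi]
  congr 1
  refine (hasSum_ev _).unique (hasSum_single 0 fun r hr => ?_)
  rw [← (coef r).integral_comp_comm hi]
  exact coef_integral_eq_zero hc (fun t x => h.2 t x ()) hr

end Trace

/-! ### The gradient -/

section Gradient

open TwAlg TensorKind

variable {m n : ℕ} {M : Type*} [TopologicalSpace M] [ChartedSpace (Eu m) M]
  [IsManifold (𝓡 m) ∞ M] {A : ToricManifold m n M} {θ : Matrix (Fin n) (Fin n) ℝ}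

/-- For `θ = 0` the product is commutative and `ev` is a character. -/
theorem TwAlg.ev_mul (a b : TwAlg (0 : Matrix (Fin n) (Fin n) ℝ)) : ev (a * b) = ev a * ev b := by
  have h1 := hasSum_ev_mul a b
  have h2 : ∀ r l, χ (0 : Matrix (Fin n) (Fin n) ℝ) r l = 1 := fun r l => by simp [χ]
  simp only [h2, one_mul] at h1
  exact h1.unique ((hasSum_ev a).mul (hasSum_ev b) h1.summable)

/-- Smooth functions are represented by smooth maps into the twisted group algebra. -/
theorem exists_rep {f : M → ℂ} (hf : ContMDiff (𝓡 m) 𝓘(ℝ, ℂ) ∞ f) :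
    ∃ X : M → TwAlg θ, ContMDiff (𝓡 m) 𝓘(ℝ, TwAlg θ) ∞ X ∧
      ((functions A).Rep f fun x _ => X x) ∧ ∀ r x, coef r (X x) = A.fc r f x := by
  obtain ⟨X, h1, h2, h3, h4⟩ := A.exists_lift (θ := θ) hf
  exact ⟨X, h1, ⟨fun x _ => h2 x, fun t x _ => h3 t x⟩, h4⟩

theorem contMDiff_mul_twAlg {X Y : M → TwAlg θ} (hX : ContMDiff (𝓡 m) 𝓘(ℝ, TwAlg θ) ∞ X)
    (hY : ContMDiff (𝓡 m) 𝓘(ℝ, TwAlg θ) ∞ Y) :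
    ContMDiff (𝓡 m) 𝓘(ℝ, TwAlg θ) ∞ fun x => X x * Y x :=
  (contDiff_fst.mul contDiff_snd :
    ContDiff ℝ ∞ fun p : TwAlg θ × TwAlg θ => p.1 * p.2).contMDiff.comp (hX.prodMk_space hY)

variable [T2Space M] [CompactSpace M]

/-- Inside `φ₀` the deformed product of two functions may be replaced by the pointwise one. -/
theorem φ₀_mulθ (hθ : θ.transpose = -θ) {f f' : M → ℂ} (hf : ContMDiff (𝓡 m) 𝓘(ℝ, ℂ) ∞ f)
    (hf' : ContMDiff (𝓡 m) 𝓘(ℝ, ℂ) ∞ f') :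
    A.φ₀ (mulθ A θ f f') = A.φ₀ fun x => f x * f' x := by
  let _ : MeasurableSpace M := borel M
  have : BorelSpace M := ⟨rfl⟩
  obtain ⟨X, hX, hr, hc⟩ := exists_rep (A := A) (θ := θ) hf
  obtain ⟨Y, hY, hr', hc'⟩ := exists_rep (A := A) (θ := θ) hf'
  obtain ⟨X₀, hX₀, hr₀, hc₀⟩ := exists_rep (A := A) (θ := 0) hf
  obtain ⟨Y₀, hY₀, hr₀', hc₀'⟩ := exists_rep (A := A) (θ := 0) hf'
  have h1 : (functions A).Rep (fun x => f x * f' x) fun x _ => X₀ x * Y₀ x :=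
    ⟨fun x k => by rw [ev_mul, ← hr₀.1 x k, ← hr₀'.1 x k]; rfl, fun t x k => by
      rw [rot_mul, ← hr₀.2 t x k, ← hr₀'.2 t x k]⟩
  rw [φ₀_eq_integral_coef (hr.mulθ hr') (contMDiff_mul_twAlg hX hY).continuous,
    φ₀_eq_integral_coef h1 (contMDiff_mul_twAlg hX₀ hY₀).continuous]
  congr 2
  funext x
  have h2 := hasSum_coef_zero_mul hθ (X x) (Y x)
  have h3 := hasSum_coef_zero_mul (by simp) (X₀ x) (Y₀ x)
  simp only [hc, hc', hc₀, hc₀'] at h2 h3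
  exact h2.unique h3

/-- Gradients are unique: the functional `φ₀` is faithful. -/
theorem IsGradientAt.unique (hθ : θ.transpose = -θ) {F : (M → ℂ) → ℂ} {h G G' : M → ℂ}
    (hG : IsGradientAt A θ F h G) (hG' : IsGradientAt A θ F h G') : G = G' := by
  let _ : MeasurableSpace M := borel M
  have : BorelSpace M := ⟨rfl⟩
  have hD : ContMDiff (𝓡 m) 𝓘(ℝ, ℂ) ∞ fun x => G x - G' x := hG.1.sub hG'.1
  -- The difference of the two gradients is orthogonal to all real smooth functions.
  have key : ∀ a : M → ℝ, ContMDiff (𝓡 m) 𝓘(ℝ, ℝ) ∞ a →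
      ∫ x, (a x : ℂ) * (G x - G' x) ∂A.volM = 0 := fun a ha => by
    have ha' : ContMDiff (𝓡 m) 𝓘(ℝ, ℂ) ∞ fun x => (a x : ℂ) :=
      Complex.ofRealCLM.contMDiff.comp ha
    have h1 := (hG.2 _ ha' fun x => Complex.conj_ofReal _).unique
      (hG'.2 _ ha' fun x => Complex.conj_ofReal _)
    have hc : ∀ {f : M → ℂ}, ContMDiff (𝓡 m) 𝓘(ℝ, ℂ) ∞ f → Continuous fun x => (a x : ℂ) * f x :=
      fun hf => ha'.continuous.mul hf.continuous
    rw [φ₀_mulθ hθ ha' hG.1, φ₀_mulθ hθ ha' hG'.1, ToricManifold.φ₀, ToricManifold.φ₀,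
      A.integral_eq (hc hG.1), A.integral_eq (hc hG'.1)] at h1
    simp only [mul_sub]
    rw [integral_sub (A.integrable_volM (hc hG.1)) (A.integrable_volM (hc hG'.1)),
      mul_left_cancel₀ (pow_ne_zero _ two_ne_zero) h1, sub_self]
  -- The real and the imaginary part `l(G - G')` of the difference are themselves test functions.
  have hl : ∀ l : ℂ →L[ℝ] ℝ, (∀ (a : ℝ) (z : ℂ), l (a * z) = a * l z) →
      ∀ x, l (G x - G' x) = 0 := fun l hl x => by
    have h1 : ContMDiff (𝓡 m) 𝓘(ℝ, ℝ) ∞ fun x => l (G x - G' x) := l.contMDiff.comp hD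
    have h2 := congrArg l (key _ h1)
    have h3 : Continuous fun x => (l (G x - G' x) : ℂ) * (G x - G' x) :=
      (Complex.continuous_ofReal.comp h1.continuous).mul hD.continuous
    rw [← l.integral_comp_comm (A.integrable_volM h3), map_zero] at h2
    simp only [hl] at h2
    exact mul_self_eq_zero.1 (A.eq_zero_of_integral_eq_zero (h1.continuous.mul h1.continuous)
      (fun x => mul_self_nonneg _) h2 x)
  funext x
  refine sub_eq_zero.1 (Complex.ext ?_ ?_)
  · exact hl Complex.reCLM (fun a z => by simp) x
  · exact hl Complex.imCLM (fun a z => by simp) x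

/-- The first variation of the Einstein–Hilbert action. -/
theorem isGradientAt_einsteinHilbert (hθ : θ.transpose = -θ) {h : M → ℂ}
    (hh : ContMDiff (𝓡 m) 𝓘(ℝ, ℂ) ∞ h) : IsGradientAt A θ (einsteinHilbert A θ) h
      (localExpr A θ (KEH m) (HEH m) (-2 * j₀ m * cScal m) h) := by
  let _ : MeasurableSpace M := borel M
  have : BorelSpace M := ⟨rfl⟩
  obtain ⟨X, hX, hr, -⟩ := exists_rep (A := A) (θ := θ) hh
  have hR := hr.localExpr (isExp_KEH m) (isExp_HEH m) (-2 * j₀ m * cScal m) hX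
  have hRc := A.contMDiff_localB (j₀ m) (isExp_KEH m) (isExp_HEH m) (-2 * j₀ m * cScal m) hX
  refine ⟨hR.contMDiff hRc, fun a ha _ => ?_⟩
  obtain ⟨Y, hY, hs, -⟩ := exists_rep (A := A) (θ := θ) ha
  have hE : ∀ ε : ℝ, einsteinHilbert A θ (fun x => h x + (ε : ℂ) * a x) = 2 ^ (m / 2) *
      ∫ x, coef 0 (A.localB (j₀ m) (KD m) (HD m) (cScal m) (fun x => X x + ε • Y x) x) ∂A.volM :=
    fun ε => by
      have h1 : (functions A).Rep (fun x => h x + (ε : ℂ) * a x) fun x _ => X x + ε • Y x := by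
        simp only [← Complex.coe_smul]
        exact hr.add (hs.smul ε)
      have h2 : ContMDiff (𝓡 m) 𝓘(ℝ, TwAlg θ) ∞ fun x => X x + ε • Y x :=
        hX.add ((ε • ContinuousLinearMap.id ℝ (TwAlg θ)).contMDiff.comp hY)
      exact φ₀_eq_integral_coef (F := A.localB (j₀ m) (KD m) (HD m) (cScal m) fun x => X x + ε • Y x)
        (h1.localExpr (isExp_KD m) (isExp_HD m) (cScal m) h2)
        (A.contMDiff_localB (j₀ m) (isExp_KD m) (isExp_HD m) (cScal m) h2).continuous
  simp only [hE]
  rw [φ₀_eq_integral_coef (hs.mulθ hR) (contMDiff_mul_twAlg hY hRc).continuous]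
  refine HasDerivAt.const_mul _ ?_
  exact A.hasDerivAt_integral_trace_localB ((coef (θ := θ) 0).restrictScalars ℝ)
    (coef_zero_mul_comm hθ) (W := T m) (W' := Ttilde m) (isExp_KD m) (isExp_HD m) (isExp_T m)
    (cScal m) (fun _ => rfl) (fun _ => rfl) (fun _ => rfl)
    (fun s t => by rw [HEH_eq, PQ_eq_add, PQ_eq_add]) hX hY

end Gradient

end ConnesLandi

end

end

theorem mainTheorem4 {m n : ℕ} (hm : Even m) (hm2 : 2 < m) {M : Type*} [TopologicalSpace M]
    [T2Space M] [CompactSpace M] [ChartedSpace (EuclideanSpace ℝ (Fin m)) M]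
    [IsManifold (𝓡 m) ∞ M] (A : ConnesLandi.ToricManifold m n M)
    (θ : Matrix (Fin n) (Fin n) ℝ) (hθ : θ.transpose = -θ)
    (h : M → ℂ) (hsmooth : ContMDiff (𝓡 m) 𝓘(ℝ, ℂ) ∞ h) (hself : ∀ x, star (h x) = h x)
    (G : M → ℂ) :
    ConnesLandi.IsGradientAt A θ (ConnesLandi.einsteinHilbert A θ) h G ↔
      G = fun x =>
        ConnesLandi.mulθ A θ
            (ConnesLandi.expθ A θ (fun z => ((-2 * ConnesLandi.j₀ m : ℝ) : ℂ) * h z))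
            (A.contract fun z =>
              ConnesLandi.calc₁ A θ (ConnesLandi.KEH m) h (A.hess h) z
                + ConnesLandi.calc₂ A θ (ConnesLandi.HEH m) h
                    (ConnesLandi.ToricManifold.grad₁ h) (ConnesLandi.ToricManifold.grad₁ h) z) x
          + ((-2 * ConnesLandi.j₀ m * ConnesLandi.cScal m : ℝ) : ℂ)
            * ConnesLandi.mulθ A θ
                (ConnesLandi.expθ A θ (fun z => ((-2 * ConnesLandi.j₀ m : ℝ) : ℂ) * h z))
                (fun z => (A.scalarCurvature z : ℂ)) x := by
  have hR : (fun x => ConnesLandi.mulθ A θ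
            (ConnesLandi.expθ A θ (fun z => ((-2 * ConnesLandi.j₀ m : ℝ) : ℂ) * h z))
            (A.contract fun z =>
              ConnesLandi.calc₁ A θ (ConnesLandi.KEH m) h (A.hess h) z
                + ConnesLandi.calc₂ A θ (ConnesLandi.HEH m) h
                    (ConnesLandi.ToricManifold.grad₁ h) (ConnesLandi.ToricManifold.grad₁ h) z) x
          + ((-2 * ConnesLandi.j₀ m * ConnesLandi.cScal m : ℝ) : ℂ)
            * ConnesLandi.mulθ A θ
                (ConnesLandi.expθ A θ (fun z => ((-2 * ConnesLandi.j₀ m : ℝ) : ℂ) * h z))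
                (fun z => (A.scalarCurvature z : ℂ)) x) =
      ConnesLandi.localExpr A θ (ConnesLandi.KEH m) (ConnesLandi.HEH m)
        (-2 * ConnesLandi.j₀ m * ConnesLandi.cScal m) h := by
    have h1 : ((-2 * ConnesLandi.j₀ m : ℝ) : ℂ) = 2 - (m : ℂ) := by
      rw [ConnesLandi.j₀]
      push_cast
      ring
    rw [h1]
    rfl
  rw [hR]
  refine ⟨fun hG => ConnesLandi.IsGradientAt.unique hθ hG
    (ConnesLandi.isGradientAt_einsteinHilbert hθ hsmooth), ?_⟩
  rintro rfl
  exact ConnesLandi.isGradientAt_einsteinHilbert hθ hsmooth
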